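/- Let $\epsilon\in\mathbb{R}$ and let $(\tilde M,\langle\,,\rangle,J)$ be a Kähler manifold of complex dimension $2$ with constant holomorphic sectional curvature $4\epsilon$ (in particular $\tilde M$ may be the complete simply connected complex space form $\tilde M^2(4\epsilon)$, i.e. $\mathbb{C}^2$, $\mathbb{C}P^2(4\epsilon)$ or $\mathbb{C}H^2(4\epsilon)$). Let $M$ be a smooth surface and $f\colon M\to\tilde M$ a smooth Lagrangian immersion, i.e. $\langle df X,J\,df Y\rangle=0$ for all vectors $X,Y$ tangent to $M$ at the same point; give $M$ the induced metric. Suppose that $f$ is Hamiltonian stationary, that is, a critical point of the area functional for all smooth compactly supported deformations of $f$ whose variation vector field is $J\,df(\nabla\varphi)$ for some smooth function $\varphi$ with compact support on $M$, where $\nabla\varphi$ is the gradient of $\varphi$. Let $h$ be the second fundamental form of $f$ and $H=\tfrac12\,\mathrm{trace}\,h$ its mean curvature vector field. If $|H|$ is a non-zero constant on $M$, then the second fundamental form is parallel: $\bar\nabla h=0$, where $$(\bar\nabla_X h)(Y,Z)=D_X\bigl(h(Y,Z)\bigr)-h(\nabla_XY,Z)-h(Y,\nabla_XZ),$$ $\nabla$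 (in this formula) is the Levi-Civita connection of $M$ and $D$ is the normal connection. -/

import Mathlib

open Set Filter Topology MeasureTheory
open scoped Manifold ContDiff

noncomputable section

namespace LagrangianSurface

/-! ### Riemannian geometry in coordinates

Let `G` be a Riemannian metric on an open subset of a finite-dimensional real vector space `E`:
`G z` is the inner product at the point `z`. Tangent vectors at `z` are elements of `E`. -/

section Coordinates

variable {E : Type*} [NormedAddCommGroup E] [NormedSpace ℝ E]
variable {F : Type*} [NormedAddCommGroup F] [NormedSpace ℝ F]

/-- The linear form `W ↦ (1/2) (∂_X G(Y,W) + ∂_Y G(X,W) - ∂_W G(X,Y))` at `z`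
(Christoffel symbols of the first kind). -/
def christoffelForm (G : E → E →L[ℝ] E →L[ℝ] ℝ) (z X Y : E) : E →L[ℝ] ℝ :=
  (1 / 2 : ℝ) • (fderiv ℝ G z X Y + fderiv ℝ G z Y X - ((fderiv ℝ G z).flip X).flip Y)

/-- The Christoffel symbols `Γ_z(X, Y)` of the Levi-Civita connection of `G`: the vector with
`G z (Γ_z(X, Y)) W = christoffelForm G z X Y W` for all `W`. For vector fields `X, Y` one has
`∇_X Y = ∂_X Y + Γ(X, Y)`. -/
def christoffel (G : E → E →L[ℝ] E →L[ℝ] ℝ) (z X Y : E) : E :=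
  (G z).inverse (christoffelForm G z X Y)

/-- The Riemann curvature tensor `R(X, Y)Z = ∇_X ∇_Y Z - ∇_Y ∇_X Z - ∇_[X,Y] Z` of `G` at `z`. -/
def curvature (G : E → E →L[ℝ] E →L[ℝ] ℝ) (z X Y Z : E) : E :=
  fderiv ℝ (fun y => christoffel G y Y Z) z X - fderiv ℝ (fun y => christoffel G y X Z) z Y
    + christoffel G z X (christoffel G z Y Z) - christoffel G z Y (christoffel G z X Z)

/-- The metric induced by `G` along an immersion `u`. -/
def inducedMetric (G : E → E →L[ℝ] E →L[ℝ] ℝ) (u : F → E) (x : F) : F →L[ℝ] F →L[ℝ] ℝ :=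
  (G (u x)).bilinearComp (fderiv ℝ u x) (fderiv ℝ u x)

/-- The ambient Levi-Civita derivative at `x`, in the direction `X`, of the vector field `ξ` of the
ambient space along `u`. -/
def covariantAlong (G : E → E →L[ℝ] E →L[ℝ] ℝ) (u : F → E) (ξ : F → E) (x X : F) : E :=
  fderiv ℝ ξ x X + christoffel G (u x) (fderiv ℝ u x X) (ξ x)

/-- The second fundamental form of the immersion `u`, from the Gauss formula
`∇̃_X (du Y) = du (∇_X Y) + h(X, Y)` (with `Y` a constant coordinate field), where `∇` is the
Levi-Civita connection of the induced metric. -/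
def secondFundamentalForm (G : E → E →L[ℝ] E →L[ℝ] ℝ) (u : F → E) (x X Y : F) : E :=
  covariantAlong G u (fun y => fderiv ℝ u y Y) x X
    - fderiv ℝ u x (christoffel (inducedMetric G u) x X Y)

/-- The tangential component at `x` of the ambient vector `v`, as a vector of the parameter domain:
the vector `T` with `G (du T) (du Y) = G v (du Y)` for all `Y`. -/
def tangentialPart (G : E → E →L[ℝ] E →L[ℝ] ℝ) (u : F → E) (x : F) (v : E) : F :=
  (inducedMetric G u x).inverse ((G (u x) v).comp (fderiv ℝ u x))

/-- The component of the ambient vector `v` normal to the immersion `u` at `x`. -/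
def normalPart (G : E → E →L[ℝ] E →L[ℝ] ℝ) (u : F → E) (x : F) (v : E) : E :=
  v - fderiv ℝ u x (tangentialPart G u x v)

/-- The normal connection `D_X ξ`: the normal component of `∇̃_X ξ`. -/
def normalConnection (G : E → E →L[ℝ] E →L[ℝ] ℝ) (u : F → E) (ξ : F → E) (x X : F) : E :=
  normalPart G u x (covariantAlong G u ξ x X)

/-- The covariant derivative of the second fundamental form,
`(∇̄_X h)(Y, Z) = D_X (h(Y, Z)) - h(∇_X Y, Z) - h(Y, ∇_X Z)`
(with `Y`, `Z` constant coordinate fields). -/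
def covariantDerivSFF (G : E → E →L[ℝ] E →L[ℝ] ℝ) (u : F → E) (x X Y Z : F) : E :=
  normalConnection G u (fun y => secondFundamentalForm G u y Y Z) x X
    - secondFundamentalForm G u x (christoffel (inducedMetric G u) x X Y) Z
    - secondFundamentalForm G u x Y (christoffel (inducedMetric G u) x X Z)

end Coordinates

/-- The real coordinate plane, on which surfaces are modelled. -/
abbrev R2 : Type := EuclideanSpace ℝ (Fin 2)

/-- The complex coordinate plane, on which complex surfaces are modelled. -/
abbrev C2 : Type := EuclideanSpace ℂ (Fin 2)

/-- The standard basis of `R2`. -/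
def stdVec (i : Fin 2) : R2 := EuclideanSpace.single i 1

/-- The Gram matrix of the coordinate vectors in the metric induced by `u`. -/
def gram (G : C2 → C2 →L[ℝ] C2 →L[ℝ] ℝ) (u : R2 → C2) (x : R2) : Matrix (Fin 2) (Fin 2) ℝ :=
  Matrix.of fun i j => inducedMetric G u x (stdVec i) (stdVec j)

/-- The mean curvature vector `H = (1/2) trace h = (1/2) ∑ g^{ij} h(∂_i, ∂_j)`. -/
def meanCurvatureVector (G : C2 → C2 →L[ℝ] C2 →L[ℝ] ℝ) (u : R2 → C2) (x : R2) : C2 :=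
  (1 / 2 : ℝ) • ∑ i, ∑ j,
    ((gram G u x)⁻¹ i j) • secondFundamentalForm G u x (stdVec i) (stdVec j)

/-- The mean curvature `|H|`. -/
def meanCurvature (G : C2 → C2 →L[ℝ] C2 →L[ℝ] ℝ) (u : R2 → C2) (x : R2) : ℝ :=
  Real.sqrt (G (u x) (meanCurvatureVector G u x) (meanCurvatureVector G u x))

/-! ### The ambient complex surface

A complex surface `N` is a complex manifold modelled on `C2`; it is also a real manifold modelled
on the underlying real vector space of `C2`. -/

section Ambient

variable {N : Type*} [TopologicalSpace N] [ChartedSpace C2 N] [IsManifold 𝓘(ℂ, C2) ω N]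

/-- A complex surface is a smooth real manifold. -/
instance realManifold : IsManifold 𝓘(ℝ, C2) ∞ N := by
  refine isManifold_of_contDiffOn 𝓘(ℝ, C2) ∞ N ?_
  intro e e' he he'
  have h := ((contDiffGroupoid ω 𝓘(ℂ, C2)).compatible he he')
  rw [contDiffGroupoid, mem_groupoid_of_pregroupoid] at h
  exact (h.1.restrict_scalars ℝ).of_le le_top

variable (N) in
/-- Smooth Riemannian metrics on the real manifold underlying `N`. -/
abbrev Metric : Type _ :=
  Bundle.ContMDiffRiemannianMetric 𝓘(ℝ, C2) ∞ C2 (fun p : N => TangentSpace 𝓘(ℝ, C2) p)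

/-- The complex structure `J` of `N`. The tangent space at `p` is identified with `C2` by the
differential of a holomorphic chart, and `J` is multiplication by `i`. -/
def complexStructure (p : N) (v : TangentSpace 𝓘(ℝ, C2) p) : TangentSpace 𝓘(ℝ, C2) p :=
  let w : C2 := v
  Complex.I • w

/-- The metric `g` in the coordinates given by the chart `ψ`, on `ψ.target`. -/
def chartMetric (g : Metric N) (ψ : OpenPartialHomeomorph N C2) (z : C2) :
    C2 →L[ℝ] C2 →L[ℝ] ℝ :=
  let A : C2 →L[ℝ] C2 := mfderiv 𝓘(ℝ, C2) 𝓘(ℝ, C2) ψ.symm z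
  let B : C2 →L[ℝ] C2 →L[ℝ] ℝ := g.inner (ψ.symm z)
  B.bilinearComp A A

/-- `g` is a Kähler metric: it is Hermitian and `∇̃ J = 0`. In a holomorphic chart `J` is the
constant field multiplication by `i`, so `∇̃ J = 0` says `Γ(X, iY) = i Γ(X, Y)`. -/
structure IsKaehler (g : Metric N) : Prop where
  hermitian : ∀ (p : N) (X Y : TangentSpace 𝓘(ℝ, C2) p),
    g.inner p (complexStructure p X) (complexStructure p Y) = g.inner p X Y
  parallel : ∀ ψ ∈ atlas C2 N, ∀ z ∈ ψ.target, ∀ X Y : C2,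
    christoffel (chartMetric g ψ) z X (Complex.I • Y)
      = Complex.I • christoffel (chartMetric g ψ) z X Y

/-- The Kähler surface `(N, g)` has constant holomorphic sectional curvature `κ`: the sectional
curvature of the plane spanned by `X` and `JX` is `κ` for all `X ≠ 0`. (As `|JX| = |X|` and
`JX ⟂ X`, the denominator in the sectional curvature is `g(X, X) ^ 2`.) -/
def HasConstHolSectCurvature (g : Metric N) (κ : ℝ) : Prop :=
  ∀ ψ ∈ atlas C2 N, ∀ z ∈ ψ.target, ∀ X : C2,
    chartMetric g ψ z (curvature (chartMetric g ψ) z X (Complex.I • X) (Complex.I • X)) X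
      = κ * (chartMetric g ψ z X X) ^ 2

/-- `(N, g)` is a complex space form of complex dimension 2 and constant holomorphic sectional
curvature `κ`. -/
structure IsComplexSpaceForm (g : Metric N) (κ : ℝ) : Prop where
  kaehler : IsKaehler g
  curvature_eq : HasConstHolSectCurvature g κ

end Ambient

/-! ### Lagrangian surfaces and Hamiltonian stationarity -/

section Surface

variable {N : Type*} [TopologicalSpace N] [ChartedSpace C2 N] [IsManifold 𝓘(ℂ, C2) ω N]
variable {M : Type*} [TopologicalSpace M] [ChartedSpace R2 M]

/-- `f : M → N` is a smooth Lagrangian immersion of a surface: `g(df X, J df Y) = 0` for all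
tangent vectors `X, Y`. -/
structure IsLagrangianImmersion (g : Metric N) (f : M → N) : Prop where
  smooth : ContMDiff 𝓘(ℝ, R2) 𝓘(ℝ, C2) ∞ f
  immersion : ∀ p : M, Function.Injective (mfderiv 𝓘(ℝ, R2) 𝓘(ℝ, C2) f p)
  lagrangian : ∀ (p : M) (X Y : TangentSpace 𝓘(ℝ, R2) p),
    g.inner (f p) (mfderiv 𝓘(ℝ, R2) 𝓘(ℝ, C2) f p X)
      (complexStructure (f p) (mfderiv 𝓘(ℝ, R2) 𝓘(ℝ, C2) f p Y)) = 0

/-- `φ` is a smooth function on `M` with compact support and `ξ` is the Hamiltonian variation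
`J ∇φ` along `f`. Here the gradient `∇φ` at `p` is the vector `Y` with `⟨Y, X⟩ = dφ X` for all `X`,
in the metric induced by `f`. -/
structure IsHamiltonianField (g : Metric N) (f : M → N) (φ : M → ℝ)
    (ξ : ∀ p : M, TangentSpace 𝓘(ℝ, C2) (f p)) : Prop where
  smooth : ContMDiff 𝓘(ℝ, R2) 𝓘(ℝ, ℝ) ∞ φ
  compactSupport : HasCompactSupport φ
  eq_J_grad : ∀ p : M, ∃ Y : TangentSpace 𝓘(ℝ, R2) p,
    (∀ X : TangentSpace 𝓘(ℝ, R2) p,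
      g.inner (f p) (mfderiv 𝓘(ℝ, R2) 𝓘(ℝ, C2) f p Y) (mfderiv 𝓘(ℝ, R2) 𝓘(ℝ, C2) f p X)
        = (mfderiv 𝓘(ℝ, R2) 𝓘(ℝ, ℝ) φ p X : ℝ)) ∧
    ξ p = complexStructure (f p) (mfderiv 𝓘(ℝ, R2) 𝓘(ℝ, C2) f p Y)

/-- `Φ t`, for `|t| < δ`, is a smooth deformation of `f` which is constant in `t` outside the
compact set `K`. -/
structure IsDeformation (f : M → N) (Φ : ℝ → M → N) (δ : ℝ) (K : Set M) : Prop where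
  pos : 0 < δ
  smooth : ContMDiffOn (𝓘(ℝ, ℝ).prod 𝓘(ℝ, R2)) 𝓘(ℝ, C2) ∞
    (fun q : ℝ × M => Φ q.1 q.2) (Ioo (-δ) δ ×ˢ univ)
  initial : Φ 0 = f
  isCompact : IsCompact K
  fixed : ∀ t ∈ Ioo (-δ) δ, ∀ p ∉ K, Φ t p = f p

/-- The variation vector field `∂Φ_t(p)/∂t` at `t = 0`, along `Φ 0`. -/
def variationField (Φ : ℝ → M → N) (p : M) : TangentSpace 𝓘(ℝ, C2) (Φ 0 p) :=
  mfderiv 𝓘(ℝ, ℝ) 𝓘(ℝ, C2) (fun t : ℝ => Φ t p) 0 (1 : ℝ)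

/-- The area density `√ det (g(∂_i f, ∂_j f))` of `f` in the coordinates of the chart `χ` of `M`. -/
def areaDensity (g : Metric N) (f : M → N) (χ : OpenPartialHomeomorph M R2) (x : R2) : ℝ :=
  Real.sqrt (Matrix.det (Matrix.of fun i j : Fin 2 =>
    g.inner (f (χ.symm x))
      (mfderiv 𝓘(ℝ, R2) 𝓘(ℝ, C2) (fun y => f (χ.symm y)) x (stdVec i))
      (mfderiv 𝓘(ℝ, R2) 𝓘(ℝ, C2) (fun y => f (χ.symm y)) x (stdVec j))))

/-- `(χ i, ρ i)`, `i < n`, are charts of `M` and smooth functions `ρ i` with compact support in the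
domain of `χ i` such that `∑ ρ i = 1` on `K`. -/
structure IsPartition (K : Set M) {n : ℕ} (χ : Fin n → OpenPartialHomeomorph M R2)
    (ρ : Fin n → M → ℝ) : Prop where
  chart : ∀ i, χ i ∈ atlas R2 M
  smooth : ∀ i, ContMDiff 𝓘(ℝ, R2) 𝓘(ℝ, ℝ) ∞ (ρ i)
  compactSupport : ∀ i, HasCompactSupport (ρ i)
  support : ∀ i, tsupport (ρ i) ⊆ (χ i).source
  sum_eq_one : ∀ p ∈ K, ∑ i, ρ i p = 1

/-- The integral `∫_M (∑ ρ i) dA` against the area element of the metric induced by `f`. If `f` is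
deformed only inside a compact set on which `∑ ρ i = 1`, the change of this integral is the change
of the area. -/
def area (g : Metric N) (f : M → N) {n : ℕ} (χ : Fin n → OpenPartialHomeomorph M R2)
    (ρ : Fin n → M → ℝ) : ℝ :=
  ∑ i, ∫ x in (χ i).target, ρ i ((χ i).symm x) * areaDensity g f (χ i) x

/-- `f` is Hamiltonian stationary: a critical point of the area for all compactly supported
deformations whose variation vector field is Hamiltonian. The area of the moving part of the surface
is computed by means of partitions of unity; its rate of change does not depend on their choice. -/
def IsHamiltonianStationary (g : Metric N) (f : M → N) : Prop :=
  ∀ (Φ : ℝ → M → N) (δ : ℝ) (K : Set M), IsDeformation f Φ δ K →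
    (∃ φ : M → ℝ, IsHamiltonianField g (Φ 0) φ (variationField Φ)) →
    ∀ (n : ℕ) (χ : Fin n → OpenPartialHomeomorph M R2) (ρ : Fin n → M → ℝ),
      IsPartition K χ ρ → HasDerivAt (fun t => area g (Φ t) χ ρ) 0 0

/-- The immersion `f` in the charts `χ` of `M` and `ψ` of `N`. -/
def localRep (f : M → N) (χ : OpenPartialHomeomorph M R2) (ψ : OpenPartialHomeomorph N C2)
    (x : R2) : C2 := ψ (f (χ.symm x))

/-- The mean curvature `|H|` of `f` is the constant `c` (in all charts; the value of `|H|` at a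
point does not depend on the charts). -/
def HasConstMeanCurvature (g : Metric N) (f : M → N) (c : ℝ) : Prop :=
  ∀ χ ∈ atlas R2 M, ∀ ψ ∈ atlas C2 N, ∀ x ∈ χ.target, f (χ.symm x) ∈ ψ.source →
    meanCurvature (chartMetric g ψ) (localRep f χ ψ) x = c

/-- The second fundamental form of `f` is parallel: `∇̄ h = 0`. -/
def HasParallelSFF (g : Metric N) (f : M → N) : Prop :=
  ∀ χ ∈ atlas R2 M, ∀ ψ ∈ atlas C2 N, ∀ x ∈ χ.target, f (χ.symm x) ∈ ψ.source →
    ∀ X Y Z : R2, covariantDerivSFF (chartMetric g ψ) (localRep f χ ψ) x X Y Z = 0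

end Surface

end LagrangianSurface

end

/-!
Write `γ` for the induced metric, `A` for the tensor with `h(X, Y) = J df A(X, Y)`, and `η` for the
tangent field with `H = J df η`, so that `2 γ(η, Z) = tr A(Z, ·)`. As `f` is Lagrangian and `J` is
parallel, the cubic form `γ(A(X, Y), Z)` is totally symmetric
(`IsLagrangianPatch.inner_shape_symm`), and `∇̄h = J df ∇A`
(`IsLagrangianPatch.covariantDerivSFF_eq`). The curvature tensor of a Kähler metric of constant
holomorphic sectional curvature `4ε` is determined by algebra (`IsKaehlerOn.curvature_of_const`);
its value on tangent vectors of a Lagrangian surface is tangent, so that `∇A` is totally symmetric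
(`IsLagrangianPatch.shapeDeriv_codazzi`).

The first variation of the area under `J df(∇φ)` is the integral of `-2 dφ(η)`
(`IsLagrangianPatch.hasDerivAt_area`). Since every test function supported in a chart gives such a
deformation (`isDeformation_chartDeformation`, `isHamiltonianField_chartDeformation`), Hamiltonian
stationarity says that `div η = 0` (`IsLagrangianPatch.trace_leviCivitaCLM_meanField`). By the
Codazzi equation `∇η` is self-adjoint, and `γ(∇η, η) = 0` because `k = |η|² = c²` is constant. A
self-adjoint traceless endomorphism of a plane whose image is orthogonal to some `η ≠ 0` vanishes,
so `η` is parallel (`IsLagrangianPatch.leviCivita_meanField`).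

The surface is therefore flat, and the Gauss equation is algebraic in `A`. In the frame `e₁ = η`,
`e₂ ⟂ e₁`, `|e₂| = |e₁|`, the tensor `A` is determined by `b = γ(A(e₁, e₁), e₂)` and
`c = γ(A(e₁, e₂), e₂)`, and the equation reads `(2b)² + (2c - k²)² = k³(k + 2ε)`
(`IsFlatCubic.circle`). The derivative of the equation is orthogonality to a radius of the circle,
while the total symmetry of the traceless tensor `∇A` makes the derivatives of `b`, `c` a
Cauchy-Riemann pair, so they vanish when the radius is positive (`IsFlatCubic.deriv_eq_zero`). When
it is zero, `A` is an expression in the parallel tensors `γ` and `η`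
(`IsFlatCubic.eq_of_degenerate`). In both cases `∇A = 0`
(`IsLagrangianPatch.shapeDeriv_eq_zero`).
-/

noncomputable section

set_option maxSynthPendingDepth 3
set_option linter.unusedSectionVars false

namespace LagrangianSurface

/-! ### Riemannian metrics in coordinates -/

section MetricCalculus

variable {E : Type*} [NormedAddCommGroup E] [NormedSpace ℝ E]
variable {F : Type*} [NormedAddCommGroup F] [NormedSpace ℝ F]

theorem two_le_infty : (2 : WithTop ℕ∞) ≤ ∞ := by
  exact WithTop.coe_le_coe.2 (le_top : (2 : ℕ∞) ≤ ⊤)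

/-- `G` is a smooth Riemannian metric on the open set `V`. -/
structure IsMetricOn (G : E → E →L[ℝ] E →L[ℝ] ℝ) (V : Set E) : Prop where
  isOpen : IsOpen V
  contDiffOn : ContDiffOn ℝ ∞ G V
  symm : ∀ z ∈ V, ∀ X Y, G z X Y = G z Y X
  pos : ∀ z ∈ V, ∀ X, X ≠ 0 → 0 < G z X X

/-- The Christoffel symbols as a bilinear map. -/
def christoffelCLM (G : E → E →L[ℝ] E →L[ℝ] ℝ) (z : E) : E →L[ℝ] E →L[ℝ] E :=
  (ContinuousLinearMap.compL ℝ E (E →L[ℝ] ℝ) E (G z).inverse).comp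
    ((1 / 2 : ℝ) • (fderiv ℝ G z + (fderiv ℝ G z).flip
      - (ContinuousLinearMap.flipₗᵢ ℝ E E ℝ).toContinuousLinearEquiv.toContinuousLinearMap.comp
          (fderiv ℝ G z).flip))

theorem christoffelCLM_apply (G : E → E →L[ℝ] E →L[ℝ] ℝ) (z X Y : E) :
    christoffelCLM G z X Y = christoffel G z X Y := by
  simp [christoffelCLM, christoffel, christoffelForm]

theorem isInvertible_of_pos [FiniteDimensional ℝ E] {B : E →L[ℝ] E →L[ℝ] ℝ}
    (h : ∀ X, X ≠ 0 → 0 < B X X) :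
    B.IsInvertible := by
  let B' : E →ₗ[ℝ] Module.Dual ℝ E := (ContinuousLinearMap.coeLM ℝ).comp B.toLinearMap
  have hinj : Function.Injective B' := by
    rw [injective_iff_map_eq_zero]
    intro X hX
    by_contra h0
    have h1 := h X h0
    have h2 : B' X X = B X X := rfl
    rw [hX] at h2
    simp at h2
    linarith
  have hinjB : Function.Injective B := fun X Y hXY => hinj (by
    change ((B X : E →L[ℝ] ℝ) : E →ₗ[ℝ] ℝ) = ((B Y : E →L[ℝ] ℝ) : E →ₗ[ℝ] ℝ); rw [hXY])
  have hdim : Module.finrank ℝ E = Module.finrank ℝ (E →L[ℝ] ℝ) := by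
    rw [← Subspace.dual_finrank_eq (K := ℝ) (V := E)]
    exact (LinearMap.toContinuousLinearMap (𝕜 := ℝ) (E := E) (F' := ℝ)).finrank_eq
  let e := LinearEquiv.ofInjectiveOfFinrankEq B.toLinearMap hinjB hdim
  exact ⟨e.toContinuousLinearEquiv, by ext; rfl⟩

namespace IsMetricOn

variable {G : E → E →L[ℝ] E →L[ℝ] ℝ} {V : Set E} (h : IsMetricOn G V) {z : E}

include h

theorem contDiffAt (hz : z ∈ V) : ContDiffAt ℝ ∞ G z :=
  h.contDiffOn.contDiffAt (h.isOpen.mem_nhds hz)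

theorem ext_inner (hz : z ∈ V) {X Y : E} (hXY : ∀ W, G z X W = G z Y W) : X = Y := by
  by_contra hne
  have := h.pos z hz (X - Y) (sub_ne_zero.2 hne)
  have e : G z (X - Y) (X - Y) = 0 := by
    rw [map_sub (G z) X Y, sub_apply, hXY, sub_self]
  exact absurd this (by rw [e]; exact lt_irrefl 0)

theorem fderiv_symm (hz : z ∈ V) (X Y W : E) : fderiv ℝ G z X Y W = fderiv ℝ G z X W Y := by
  have hd : DifferentiableAt ℝ G z := (h.contDiffAt hz).differentiableAt (by simp)
  have e : (fun y => G y Y W) =ᶠ[𝓝 z] fun y => G y W Y := by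
    filter_upwards [h.isOpen.mem_nhds hz] with y hy using h.symm y hy Y W
  have h1 : ∀ A B : E, fderiv ℝ (fun y => G y A B) z X = fderiv ℝ G z X A B := by
    intro A B
    have := ((hd.hasFDerivAt.clm_apply (hasFDerivAt_const A z)).clm_apply
      (hasFDerivAt_const B z)).fderiv
    rw [this]; simp
  rw [← h1, ← h1, e.fderiv_eq]

variable [FiniteDimensional ℝ E]

theorem isInvertible (hz : z ∈ V) : (G z).IsInvertible := isInvertible_of_pos (h.pos z hz)

theorem inner_inverse (hz : z ∈ V) (l : E →L[ℝ] ℝ) : G z ((G z).inverse l) = l :=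
  (h.isInvertible hz).self_apply_inverse l

theorem contDiffAt_christoffelCLM (hz : z ∈ V) : ContDiffAt ℝ ∞ (christoffelCLM G) z := by
  have hG := h.contDiffAt hz
  have hD : ContDiffAt ℝ ∞ (fderiv ℝ G) z := hG.fderiv_right (by simp)
  have hinv : ContDiffAt ℝ ∞ (fun y => (G y).inverse) z :=
    ContDiffAt.comp z (h.isInvertible hz).contDiffAt_map_inverse hG
  have hfl : ContDiffAt ℝ ∞ (fun y => (fderiv ℝ G y).flip) z :=
    ((ContinuousLinearMap.flipₗᵢ ℝ E E (E →L[ℝ] ℝ)).contDiff.contDiffAt).comp z hD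
  refine ContDiffAt.clm_comp ?_ ?_
  · exact ((ContinuousLinearMap.compL ℝ E (E →L[ℝ] ℝ) E).contDiff.contDiffAt).comp z hinv
  · exact ((hD.add hfl).sub (contDiffAt_const.clm_comp hfl)).const_smul (1 / 2 : ℝ)

theorem inner_christoffel (hz : z ∈ V) (X Y W : E) :
    G z (christoffel G z X Y) W
      = 1 / 2 * (fderiv ℝ G z X Y W + fderiv ℝ G z Y X W - fderiv ℝ G z W X Y) := by
  rw [christoffel, h.inner_inverse hz]
  simp [christoffelForm]

theorem christoffel_symm (hz : z ∈ V) (X Y : E) : christoffel G z X Y = christoffel G z Y X := by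
  refine h.ext_inner hz fun W => ?_
  rw [h.inner_christoffel hz, h.inner_christoffel hz, h.fderiv_symm hz W X Y]
  ring

/-- The Levi-Civita connection is compatible with the metric. -/
theorem fderiv_apply (hz : z ∈ V) (X Y W : E) :
    fderiv ℝ G z X Y W = G z (christoffel G z X Y) W + G z Y (christoffel G z X W) := by
  rw [h.symm z hz Y, h.inner_christoffel hz, h.inner_christoffel hz, h.fderiv_symm hz X W Y,
    h.fderiv_symm hz W X Y, h.fderiv_symm hz Y X W]
  ring

end IsMetricOn

/-! ### Covariant derivatives along a map -/

variable {G : E → E →L[ℝ] E →L[ℝ] ℝ} {V : Set E} (h : IsMetricOn G V) {u : F → E} {x : F}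

theorem covariantAlong_eq (ξ : F → E) (x X : F) : covariantAlong G u ξ x X
    = fderiv ℝ ξ x X + christoffelCLM G (u x) (fderiv ℝ u x X) (ξ x) := by
  rw [covariantAlong, christoffelCLM_apply]

theorem covariantAlong_congr {ξ ζ : F → E} (e : ξ =ᶠ[𝓝 x] ζ) (X : F) :
    covariantAlong G u ξ x X = covariantAlong G u ζ x X := by
  rw [covariantAlong, covariantAlong, e.fderiv_eq, e.eq_of_nhds]

theorem covariantAlong_add {ξ ζ : F → E} (hξ : DifferentiableAt ℝ ξ x)
    (hζ : DifferentiableAt ℝ ζ x) (X : F) : covariantAlong G u (fun y => ξ y + ζ y) x X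
      = covariantAlong G u ξ x X + covariantAlong G u ζ x X := by
  rw [covariantAlong_eq, covariantAlong_eq, covariantAlong_eq, fderiv_fun_add hξ hζ]
  simp only [add_apply, map_add]
  abel

variable [FiniteDimensional ℝ E]

include h in
theorem contDiffAt_covariantAlong (hu : ContDiffAt ℝ ∞ u x) (hx : u x ∈ V) {ξ : F → E}
    (hξ : ContDiffAt ℝ ∞ ξ x) {X : F → F} (hX : ContDiffAt ℝ ∞ X x) :
    ContDiffAt ℝ ∞ (fun y => covariantAlong G u ξ y (X y)) x := by
  simp only [covariantAlong_eq]
  have hdu : ContDiffAt ℝ ∞ (fderiv ℝ u) x := hu.fderiv_right (by simp)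
  have hdξ : ContDiffAt ℝ ∞ (fderiv ℝ ξ) x := hξ.fderiv_right (by simp)
  have hΓ : ContDiffAt ℝ ∞ (fun y => christoffelCLM G (u y)) x :=
    (h.contDiffAt_christoffelCLM hx).comp x hu
  exact (hdξ.clm_apply hX).add ((hΓ.clm_apply (hdu.clm_apply hX)).clm_apply hξ)

include h in
/-- The product rule for the inner product of two vector fields along `u`. -/
theorem fderiv_inner_along (hu : DifferentiableAt ℝ u x) (hx : u x ∈ V) {ξ ζ : F → E}
    (hξ : DifferentiableAt ℝ ξ x) (hζ : DifferentiableAt ℝ ζ x) (X : F) :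
    fderiv ℝ (fun y => G (u y) (ξ y) (ζ y)) x X
      = G (u x) (covariantAlong G u ξ x X) (ζ x) + G (u x) (ξ x) (covariantAlong G u ζ x X) := by
  have hd : DifferentiableAt ℝ G (u x) := (h.contDiffAt hx).differentiableAt (by simp)
  have h1 := ((hd.hasFDerivAt.comp x hu.hasFDerivAt).clm_apply hξ.hasFDerivAt).clm_apply
    hζ.hasFDerivAt
  have h2 := h1.fderiv
  simp only [Function.comp_def] at h2
  rw [h2]
  simp only [add_apply, ContinuousLinearMap.comp_apply,
    ContinuousLinearMap.flip_apply, covariantAlong, map_add, h.fderiv_apply hx]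
  abel

include h in
/-- The curvature tensor is the commutator of covariant derivatives along `u`. -/
theorem covariantAlong_comm (hu : ContDiffAt ℝ ∞ u x) (hx : u x ∈ V) {ξ : F → E}
    (hξ : ContDiffAt ℝ ∞ ξ x) (X Y : F) :
    covariantAlong G u (fun y => covariantAlong G u ξ y Y) x X
      - covariantAlong G u (fun y => covariantAlong G u ξ y X) x Y
      = curvature G (u x) (fderiv ℝ u x X) (fderiv ℝ u x Y) (ξ x) := by
  have hdu : DifferentiableAt ℝ (fderiv ℝ u) x :=
    (hu.fderiv_right (m := ∞) (by simp)).differentiableAt (by simp)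
  have hdξ : DifferentiableAt ℝ (fderiv ℝ ξ) x :=
    (hξ.fderiv_right (m := ∞) (by simp)).differentiableAt (by simp)
  have hΓ := (h.contDiffAt_christoffelCLM hx).differentiableAt (by simp)
  have hu1 := (hu.differentiableAt (by simp)).hasFDerivAt
  have hξ1 := (hξ.differentiableAt (by simp)).hasFDerivAt
  have key : ∀ X Y : F, fderiv ℝ (fun y => covariantAlong G u ξ y Y) x X
      = fderiv ℝ (fderiv ℝ ξ) x X Y
        + (fderiv ℝ (christoffelCLM G) (u x) (fderiv ℝ u x X) (fderiv ℝ u x Y) (ξ x)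
          + christoffelCLM G (u x) (fderiv ℝ (fderiv ℝ u) x X Y) (ξ x)
          + christoffelCLM G (u x) (fderiv ℝ u x Y) (fderiv ℝ ξ x X)) := by
    intro X Y
    simp only [covariantAlong_eq]
    have h1 := (hdξ.hasFDerivAt.clm_apply (hasFDerivAt_const Y x)).fun_add
      (((hΓ.hasFDerivAt.comp x hu1).clm_apply
        (hdu.hasFDerivAt.clm_apply (hasFDerivAt_const Y x))).clm_apply hξ1)
    have h2 := h1.fderiv
    simp only [Function.comp_def] at h2
    rw [h2]
    simp
    abel
  have kc : ∀ A B C : E, fderiv ℝ (fun y => christoffel G y B C) (u x) A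
      = fderiv ℝ (christoffelCLM G) (u x) A B C := by
    intro A B C
    simp only [← christoffelCLM_apply]
    have h1 := ((hΓ.hasFDerivAt.clm_apply (hasFDerivAt_const B (u x))).clm_apply
      (hasFDerivAt_const C (u x))).fderiv
    rw [h1]; simp
  have s1 : fderiv ℝ (fderiv ℝ ξ) x X Y = fderiv ℝ (fderiv ℝ ξ) x Y X :=
    (hξ.isSymmSndFDerivAt (by simpa using two_le_infty)) X Y
  have s2 : fderiv ℝ (fderiv ℝ u) x X Y = fderiv ℝ (fderiv ℝ u) x Y X :=
    (hu.isSymmSndFDerivAt (by simpa using two_le_infty)) X Y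
  rw [covariantAlong_eq (fun y => covariantAlong G u ξ y Y),
    covariantAlong_eq (fun y => covariantAlong G u ξ y X), key, key, curvature, kc, kc, s1, s2]
  simp only [covariantAlong_eq, christoffelCLM_apply, map_add]
  simp only [← christoffelCLM_apply]
  abel

end MetricCalculus

/-! ### Curvature tensors of Kähler manifolds -/

section CurvatureAlgebra

variable {E : Type*} [AddCommGroup E]

/-- The algebraic symmetries of the curvature tensor `D(X, Y, Z, W) = ⟨R(X, Y)Z, W⟩` of a Kähler
metric with complex structure `J`. -/
structure IsKaehlerCurvature (J : E →+ E) (D : E → E → E → E → ℝ) : Prop where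
  add₁ : ∀ X X' Y Z W, D (X + X') Y Z W = D X Y Z W + D X' Y Z W
  antisymm_left : ∀ X Y Z W, D X Y Z W = -D Y X Z W
  antisymm_right : ∀ X Y Z W, D X Y Z W = -D X Y W Z
  bianchi : ∀ X Y Z W, D X Y Z W + D Y Z X W + D Z X Y W = 0
  map_J : ∀ X Y Z W, D X Y (J Z) (J W) = D X Y Z W

namespace IsKaehlerCurvature

variable {J : E →+ E} {D : E → E → E → E → ℝ} (h : IsKaehlerCurvature J D)
include h

theorem pair_symm (X Y Z W : E) : D X Y Z W = D Z W X Y := by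
  linarith [h.bianchi X Y Z W, h.bianchi Y Z W X, h.bianchi Z W X Y, h.bianchi W X Y Z,
    h.antisymm_left X Y Z W, h.antisymm_right X Y Z W, h.antisymm_left Y Z X W,
    h.antisymm_right Y Z X W, h.antisymm_left Z X Y W, h.antisymm_right Z X Y W,
    h.antisymm_left Z W Y X, h.antisymm_right Z W Y X, h.antisymm_left W Y Z X,
    h.antisymm_right W Y Z X, h.antisymm_left Z W X Y, h.antisymm_right Z W X Y,
    h.antisymm_left W X Z Y, h.antisymm_right W X Z Y, h.antisymm_left X Z W Y,
    h.antisymm_right X Z W Y, h.antisymm_left W X Y Z, h.antisymm_right W X Y Z,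
    h.antisymm_left X Y W Z, h.antisymm_right X Y W Z, h.antisymm_left Y W X Z,
    h.antisymm_right Y W X Z]

theorem add₂ (X Y Y' Z W : E) : D X (Y + Y') Z W = D X Y Z W + D X Y' Z W := by
  rw [h.antisymm_left, h.add₁, h.antisymm_left X Y, h.antisymm_left X Y']; ring

theorem add₃ (X Y Z Z' W : E) : D X Y (Z + Z') W = D X Y Z W + D X Y Z' W := by
  rw [h.pair_symm, h.add₁, h.pair_symm Z, h.pair_symm Z']

theorem add₄ (X Y Z W W' : E) : D X Y Z (W + W') = D X Y Z W + D X Y Z W' := by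
  rw [h.pair_symm, h.add₂, h.pair_symm Z, h.pair_symm Z]

theorem neg₁ (X Y Z W : E) : D (-X) Y Z W = -D X Y Z W := by
  have h1 := h.add₁ X (-X) Y Z W
  have h2 := h.add₁ 0 0 Y Z W
  rw [add_neg_cancel] at h1
  rw [add_zero] at h2
  linarith

theorem neg₂ (X Y Z W : E) : D X (-Y) Z W = -D X Y Z W := by
  rw [h.antisymm_left, h.neg₁, h.antisymm_left X Y]

theorem neg₃ (X Y Z W : E) : D X Y (-Z) W = -D X Y Z W := by
  rw [h.pair_symm, h.neg₁, h.pair_symm Z]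

theorem neg₄ (X Y Z W : E) : D X Y Z (-W) = -D X Y Z W := by
  rw [h.pair_symm, h.neg₂, h.pair_symm Z]

theorem map_J' (X Y Z W : E) : D (J X) (J Y) Z W = D X Y Z W := by
  rw [h.pair_symm, h.map_J, h.pair_symm Z]

/-- A curvature-like tensor of a Kähler metric vanishes if its holomorphic sectional curvatures
do. -/
theorem eq_zero (hJ : ∀ X, J (J X) = -X) (h0 : ∀ X, D X (J X) (J X) X = 0) (X Y Z W : E) :
    D X Y Z W = 0 := by
  have e : ∀ X Y, D X (J Y) Z W = -D (J X) Y Z W := fun X Y => by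
    rw [← h.map_J' X (J Y), hJ, h.neg₂]
  -- Polarization of the quartic form `D X (J X) (J X) X`, in the part of degree two in `Y`.
  have pol : ∀ X Y, D X (J Y) (J Y) X + D X (J X) (J Y) Y + D X (J Y) (J X) Y = 0 := by
    intro X Y
    have p := h0 (X + Y)
    have m := h0 (X + -Y)
    simp only [map_add, map_neg, h.add₁, h.add₂, h.add₃, h.add₄, h.neg₁, h.neg₂, h.neg₃,
      h.neg₄] at p m
    have a1 : D Y (J X) (J X) Y = D X (J Y) (J Y) X := by
      have := h.map_J' Y (J X) (J X) Y
      rw [hJ, h.neg₂] at this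
      have t := h.map_J (J Y) X (J X) Y
      rw [hJ, h.neg₃] at t
      have q := h.antisymm_left (J Y) X X (J Y)
      have q' := h.antisymm_right X (J Y) X (J Y)
      linarith
    have a2 : D Y (J Y) (J X) X = D X (J X) (J Y) Y := by
      have := h.pair_symm Y (J Y) (J X) X
      have q := h.antisymm_left (J X) X Y (J Y)
      have q' := h.antisymm_right X (J X) Y (J Y)
      linarith
    have a3 : D Y (J X) (J Y) X = D X (J Y) (J X) Y := by
      have := h.pair_symm Y (J X) (J Y) X
      have q := h.antisymm_left (J Y) X Y (J X)
      have q' := h.antisymm_right X (J Y) Y (J X)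
      linarith
    linarith [h0 X, h0 Y]
  -- Combined with the Bianchi identity.
  have sec : ∀ X Y, 3 * D X (J Y) X (J Y) + D X Y X Y = 0 := by
    intro X Y
    have p := pol X Y
    have b := h.bianchi X (J X) Y (J Y)
    have c1 := h.map_J' (J X) Y X (J Y)
    rw [hJ, h.neg₁] at c1
    have c2 := h.antisymm_left Y X (J X) (J Y)
    have c3 := h.map_J X Y X Y
    have c4 := h.antisymm_right X (J X) (J Y) Y
    have c5 := h.antisymm_right X (J Y) (J Y) X
    have c6 := h.map_J X (J Y) (J X) Y
    rw [hJ, h.neg₃] at c6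
    linarith
  have sec0 : ∀ X Y, D X Y X Y = 0 := by
    intro X Y
    have p := sec X Y
    have q := sec X (J Y)
    rw [hJ, h.neg₂, h.neg₄] at q
    linarith
  have half : ∀ X Y W, D X Y X W = 0 := by
    intro X Y W
    have p := sec0 X (Y + W)
    rw [h.add₂, h.add₄, h.add₄, sec0, sec0, h.pair_symm X W] at p
    linarith
  have alt : ∀ X Y Z W, D X Y Z W = -D Z Y X W := by
    intro X Y Z W
    have p := half (X + Z) Y W
    rw [h.add₁, h.add₃, h.add₃, half, half] at p
    linarith
  linarith [h.bianchi X Y Z W, alt X Y Z W, alt Z X Y W, h.antisymm_left Z Y X W,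
    h.antisymm_left Y X Z W]

end IsKaehlerCurvature

end CurvatureAlgebra

section KaehlerCurvature

variable {E : Type*} [NormedAddCommGroup E] [NormedSpace ℝ E] [FiniteDimensional ℝ E]
variable {G : E → E →L[ℝ] E →L[ℝ] ℝ} {V : Set E} (h : IsMetricOn G V) {z : E}
include h

theorem curvature_eq (hz : z ∈ V) (X Y Z : E) : curvature G z X Y Z
    = fderiv ℝ (christoffelCLM G) z X Y Z - fderiv ℝ (christoffelCLM G) z Y X Z
      + christoffelCLM G z X (christoffelCLM G z Y Z)
      - christoffelCLM G z Y (christoffelCLM G z X Z) := by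
  have hΓ := (h.contDiffAt_christoffelCLM hz).differentiableAt (by simp)
  have kc : ∀ A B C : E, fderiv ℝ (fun y => christoffel G y B C) z A
      = fderiv ℝ (christoffelCLM G) z A B C := by
    intro A B C
    simp only [← christoffelCLM_apply]
    have h1 := ((hΓ.hasFDerivAt.clm_apply (hasFDerivAt_const B z)).clm_apply
      (hasFDerivAt_const C z)).fderiv
    rw [h1]; simp
  rw [curvature, kc, kc]
  simp only [christoffelCLM_apply]

theorem fderiv_christoffelCLM_symm (hz : z ∈ V) (A X Y : E) :
    fderiv ℝ (christoffelCLM G) z A X Y = fderiv ℝ (christoffelCLM G) z A Y X := by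
  have hΓ := (h.contDiffAt_christoffelCLM hz).differentiableAt (by simp)
  have kc : ∀ A B C : E, fderiv ℝ (fun y => christoffelCLM G y B C) z A
      = fderiv ℝ (christoffelCLM G) z A B C := by
    intro A B C
    have h1 := ((hΓ.hasFDerivAt.clm_apply (hasFDerivAt_const B z)).clm_apply
      (hasFDerivAt_const C z)).fderiv
    rw [h1]; simp
  have e : (fun y => christoffelCLM G y X Y) =ᶠ[𝓝 z] fun y => christoffelCLM G y Y X := by
    filter_upwards [h.isOpen.mem_nhds hz] with y hy
    rw [christoffelCLM_apply, christoffelCLM_apply, h.christoffel_symm hy]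
  rw [← kc, ← kc, e.fderiv_eq]

theorem curvature_antisymm_right (hz : z ∈ V) (X Y Z W : E) :
    G z (curvature G z X Y Z) W = -G z (curvature G z X Y W) Z := by
  have hid : ∀ y : E, ContDiffAt ℝ ∞ (fun y : E => y) y := fun y => contDiffAt_id
  have hc : ∀ (A y : E), ContDiffAt ℝ ∞ (fun _ : E => A) y := fun A y => contDiffAt_const
  have hca : ∀ A B y : E, y ∈ V →
      ContDiffAt ℝ ∞ (fun y => covariantAlong G (fun y => y) (fun _ => A) y B) y := fun A B y hy =>
    contDiffAt_covariantAlong h (hid y) hy (hc A y) (hc B y)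
  have hd : ∀ {f : E → E} {y : E}, ContDiffAt ℝ ∞ f y → DifferentiableAt ℝ f y :=
    fun hf => hf.differentiableAt (by simp)
  have key : ∀ X Y : E, fderiv ℝ (fderiv ℝ (fun y => G y Z W)) z X Y
      = G z (covariantAlong G (fun y => y)
            (fun y => covariantAlong G (fun y => y) (fun _ => Z) y Y) z X) W
        + G z (covariantAlong G (fun y => y) (fun _ => Z) z Y)
            (covariantAlong G (fun y => y) (fun _ => W) z X)
        + (G z (covariantAlong G (fun y => y) (fun _ => Z) z X)
            (covariantAlong G (fun y => y) (fun _ => W) z Y)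
        + G z Z (covariantAlong G (fun y => y)
            (fun y => covariantAlong G (fun y => y) (fun _ => W) y Y) z X)) := by
    intro X Y
    have hs : ContDiffAt ℝ ∞ (fun y => G y Z W) z :=
      ((h.contDiffAt hz).clm_apply contDiffAt_const).clm_apply contDiffAt_const
    have h1 := ((((hs.fderiv_right (m := ∞) (by simp)).differentiableAt (by simp)).hasFDerivAt
      ).clm_apply (hasFDerivAt_const Y z)).fderiv
    have h2 : fderiv ℝ (fun y => fderiv ℝ (fun y => G y Z W) y Y) z X
        = fderiv ℝ (fderiv ℝ (fun y => G y Z W)) z X Y := by rw [h1]; simp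
    have e : (fun y => fderiv ℝ (fun y => G y Z W) y Y) =ᶠ[𝓝 z] fun y =>
        G y (covariantAlong G (fun y => y) (fun _ => Z) y Y) W
          + G y Z (covariantAlong G (fun y => y) (fun _ => W) y Y) := by
      filter_upwards [h.isOpen.mem_nhds hz] with y hy
      exact fderiv_inner_along h (u := fun y => y) (hd (hid y)) hy (hd (hc Z y)) (hd (hc W y)) Y
    have hG : ∀ {f k : E → E}, ContDiffAt ℝ ∞ f z → ContDiffAt ℝ ∞ k z →
        DifferentiableAt ℝ (fun y => G y (f y) (k y)) z := fun hf hk =>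
      (((h.contDiffAt hz).clm_apply hf).clm_apply hk).differentiableAt (by simp)
    rw [← h2, e.fderiv_eq, fderiv_fun_add (hG (hca _ _ _ hz) (hc _ _))
      (hG (hc _ _) (hca _ _ _ hz)), add_apply]
    rw [fderiv_inner_along h (u := fun y => y) (hd (hid z)) hz (hd (hca _ _ _ hz)) (hd (hc W z)) X,
      fderiv_inner_along h (u := fun y => y) (hd (hid z)) hz (hd (hc Z z)) (hd (hca _ _ _ hz)) X]
  have hs : ContDiffAt ℝ ∞ (fun y => G y Z W) z :=
    ((h.contDiffAt hz).clm_apply contDiffAt_const).clm_apply contDiffAt_const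
  have sy : fderiv ℝ (fderiv ℝ (fun y => G y Z W)) z X Y
      = fderiv ℝ (fderiv ℝ (fun y => G y Z W)) z Y X :=
    (hs.isSymmSndFDerivAt (by simpa using two_le_infty)) X Y
  rw [key, key] at sy
  have r1 := covariantAlong_comm h (u := fun y => y) (hid z) hz (hc Z z) X Y
  have r2 := covariantAlong_comm h (u := fun y => y) (hid z) hz (hc W z) X Y
  simp only [fderiv_fun_id, ContinuousLinearMap.id_apply] at r1 r2
  rw [← r1, ← r2, h.symm z hz _ Z, map_sub (G z), map_sub (G z Z), sub_apply]
  linarith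

end KaehlerCurvature

section ComplexSpaceForm

variable {E : Type*} [NormedAddCommGroup E] [NormedSpace ℝ E] [FiniteDimensional ℝ E]

/-- `G` is a Kähler metric on the open set `V` for the constant complex structure `J`. -/
structure IsKaehlerOn (J : E →L[ℝ] E) (G : E → E →L[ℝ] E →L[ℝ] ℝ) (V : Set E) : Prop
    extends IsMetricOn G V where
  sq : ∀ X, J (J X) = -X
  hermitian : ∀ z ∈ V, ∀ X Y, G z (J X) (J Y) = G z X Y
  parallel : ∀ z ∈ V, ∀ X Y, christoffel G z X (J Y) = J (christoffel G z X Y)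

namespace IsKaehlerOn

variable {J : E →L[ℝ] E} {G : E → E →L[ℝ] E →L[ℝ] ℝ} {V : Set E} (h : IsKaehlerOn J G V) {z : E}
include h

omit [FiniteDimensional ℝ E] in
theorem inner_J_left (hz : z ∈ V) (X Y : E) : G z (J X) Y = -G z X (J Y) := by
  rw [← h.hermitian z hz (J X) Y, h.sq, map_neg, neg_apply]

theorem curvature_J (hz : z ∈ V) (X Y Z : E) :
    curvature G z X Y (J Z) = J (curvature G z X Y Z) := by
  have hΓ := (h.contDiffAt_christoffelCLM hz).differentiableAt (by simp)
  have kc : ∀ A B : E, fderiv ℝ (fun y => christoffel G y A (J Z)) z B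
      = J (fderiv ℝ (fun y => christoffel G y A Z) z B) := by
    intro A B
    have e : (fun y => christoffel G y A (J Z)) =ᶠ[𝓝 z] fun y => J (christoffel G y A Z) := by
      filter_upwards [h.isOpen.mem_nhds hz] with y hy using h.parallel y hy A Z
    have hd : DifferentiableAt ℝ (fun y => christoffel G y A Z) z := by
      simp only [← christoffelCLM_apply]
      exact (hΓ.clm_apply (differentiableAt_const _)).clm_apply (differentiableAt_const _)
    have := (J.hasFDerivAt.comp z hd.hasFDerivAt).fderiv
    simp only [Function.comp_def] at this
    rw [e.fderiv_eq, this]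
    rfl
  simp only [curvature, kc, h.parallel z hz, map_add, map_sub]

theorem isKaehlerCurvature (hz : z ∈ V) :
    IsKaehlerCurvature (J : E →+ E) (fun X Y Z W => G z (curvature G z X Y Z) W) where
  add₁ X X' Y Z W := by
    simp only [curvature_eq h.toIsMetricOn hz, map_add, add_apply, map_sub, sub_apply]
    ring
  antisymm_left X Y Z W := by
    simp only [curvature_eq h.toIsMetricOn hz, map_add, add_apply, map_sub, sub_apply]
    ring
  antisymm_right X Y Z W := curvature_antisymm_right h.toIsMetricOn hz X Y Z W
  bianchi X Y Z W := by
    have hs : ∀ A B : E, christoffelCLM G z A B = christoffelCLM G z B A := fun A B => by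
      rw [christoffelCLM_apply, christoffelCLM_apply, h.christoffel_symm hz]
    have hd := fderiv_christoffelCLM_symm h.toIsMetricOn hz
    have : curvature G z X Y Z + curvature G z Y Z X + curvature G z Z X Y = 0 := by
      rw [curvature_eq h.toIsMetricOn hz, curvature_eq h.toIsMetricOn hz,
        curvature_eq h.toIsMetricOn hz, hd X Y Z, hd Y Z X, hd Z X Y, hs Y Z, hs X Z, hs X Y]
      abel
    rw [← add_apply, ← add_apply, ← map_add, ← map_add, this, map_zero, zero_apply]
  map_J X Y Z W := by
    change G z (curvature G z X Y (J Z)) (J W) = _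
    rw [h.curvature_J hz, h.hermitian z hz]

/-- The curvature tensor of a Kähler metric of constant holomorphic sectional curvature `4 * ε`. -/
theorem curvature_of_const {ε : ℝ} (hz : z ∈ V)
    (hc : ∀ X, G z (curvature G z X (J X) (J X)) X = 4 * ε * (G z X X) ^ 2) (X Y Z W : E) :
    G z (curvature G z X Y Z) W = ε * (G z Y Z * G z X W - G z X Z * G z Y W
      + G z (J Y) Z * G z (J X) W - G z (J X) Z * G z (J Y) W - 2 * G z (J X) Y * G z (J Z) W) := by
  have hR := h.isKaehlerCurvature hz
  have sy := h.symm z hz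
  have jl : ∀ X Y, G z (J X) Y = -G z (J Y) X := fun X Y => by rw [h.inner_J_left hz, sy]
  have jr : ∀ X Y, G z X (J Y) = -G z (J X) Y := fun X Y => by rw [h.inner_J_left hz, neg_neg]
  have main : IsKaehlerCurvature (J : E →+ E) (fun X Y Z W => G z (curvature G z X Y Z) W
      - ε * (G z Y Z * G z X W - G z X Z * G z Y W
      + G z (J Y) Z * G z (J X) W - G z (J X) Z * G z (J Y) W
      - 2 * G z (J X) Y * G z (J Z) W)) := by
    refine ⟨fun X X' Y Z W => ?_, fun X Y Z W => ?_, fun X Y Z W => ?_, fun X Y Z W => ?_,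
      fun X Y Z W => ?_⟩
    · have := hR.add₁ X X' Y Z W
      simp only [map_add, add_apply] at this ⊢
      linear_combination this
    · have := hR.antisymm_left X Y Z W
      rw [jl Y X]
      linear_combination this
    · have := hR.antisymm_right X Y Z W
      rw [jl W Z]
      linear_combination this
    · have := hR.bianchi X Y Z W
      rw [sy Z X, sy Y X, sy Z Y, jl Z X, jl Z Y, jl Y X]
      linear_combination this
    · have := hR.map_J X Y Z W
      simp only [AddMonoidHom.coe_coe] at this ⊢
      rw [this]
      simp only [h.hermitian z hz, h.sq, map_neg, neg_apply, jr]
      ring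
  have := main.eq_zero h.sq (fun X => ?_) X Y Z W
  · linarith
  · have j0 : G z (J X) X = 0 := by linarith [jl X X]
    simp only [AddMonoidHom.coe_coe]
    simp only [hc, h.hermitian z hz, h.sq, map_neg, neg_apply, j0, sy X (J X)]
    ring

end IsKaehlerOn

end ComplexSpaceForm

/-! ### Lagrangian immersions in coordinates -/

section LagrangianPatch

variable {E : Type*} [NormedAddCommGroup E] [NormedSpace ℝ E] [FiniteDimensional ℝ E]
variable {F : Type*} [NormedAddCommGroup F] [NormedSpace ℝ F] [FiniteDimensional ℝ F]

/-- `u` is a smooth Lagrangian immersion of the open set `U` into the Kähler domain `(V, G, J)`. -/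
structure IsLagrangianPatch (J : E →L[ℝ] E) (G : E → E →L[ℝ] E →L[ℝ] ℝ) (V : Set E) (u : F → E)
    (U : Set F) : Prop where
  kaehler : IsKaehlerOn J G V
  isOpen : IsOpen U
  mapsTo : ∀ x ∈ U, u x ∈ V
  smooth : ∀ x ∈ U, ContDiffAt ℝ ∞ u x
  immersion : ∀ x ∈ U, Function.Injective (fderiv ℝ u x)
  lagrangian : ∀ x ∈ U, ∀ X Y, G (u x) (fderiv ℝ u x X) (J (fderiv ℝ u x Y)) = 0
  finrank_eq : Module.finrank ℝ E = Module.finrank ℝ F + Module.finrank ℝ F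

/-- The Levi-Civita derivative `∇_X T` of a vector field `T` in the metric `γ`. -/
def leviCivita (γ : F → F →L[ℝ] F →L[ℝ] ℝ) (T : F → F) (x X : F) : F :=
  covariantAlong γ (fun y => y) T x X

theorem leviCivita_eq (γ : F → F →L[ℝ] F →L[ℝ] ℝ) (T : F → F) (x X : F) :
    leviCivita γ T x X = fderiv ℝ T x X + christoffelCLM γ x X (T x) := by
  rw [leviCivita, covariantAlong_eq, fderiv_fun_id, ContinuousLinearMap.id_apply]

/-- The ambient derivatives `∇̃_X (du Y)` of the coordinate fields, as a bilinear map. -/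
def secondDerivCLM (G : E → E →L[ℝ] E →L[ℝ] ℝ) (u : F → E) (x : F) : F →L[ℝ] F →L[ℝ] E :=
  fderiv ℝ (fderiv ℝ u) x + ((ContinuousLinearMap.compL ℝ F E E).flip (fderiv ℝ u x)).comp
    ((christoffelCLM G (u x)).comp (fderiv ℝ u x))

/-- The tangential part as a linear map. -/
def tangentialCLM (G : E → E →L[ℝ] E →L[ℝ] ℝ) (u : F → E) (x : F) : E →L[ℝ] F :=
  (inducedMetric G u x).inverse.comp
    (((ContinuousLinearMap.compL ℝ F E ℝ).flip (fderiv ℝ u x)).comp (G (u x)))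

/-- The tensor `A` with `h(X, Y) = J du (A(X, Y))`, for a Lagrangian immersion `u`. Its cubic form
`γ(A(X, Y), Z)` is totally symmetric. -/
def shape (J : E →L[ℝ] E) (G : E → E →L[ℝ] E →L[ℝ] ℝ) (u : F → E) (x : F) :
    F →L[ℝ] F →L[ℝ] F :=
  (ContinuousLinearMap.compL ℝ F E F ((tangentialCLM G u x).comp (-J))).comp (secondDerivCLM G u x)

/-- The covariant derivative `(∇_V A)(X, Y)` of the tensor `A`. -/
def shapeDeriv (J : E →L[ℝ] E) (G : E → E →L[ℝ] E →L[ℝ] ℝ) (u : F → E) (x V X Y : F) : F :=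
  leviCivita (inducedMetric G u) (fun y => shape J G u y X Y) x V
    - shape J G u x (christoffelCLM (inducedMetric G u) x V X) Y
    - shape J G u x X (christoffelCLM (inducedMetric G u) x V Y)

theorem tangentialCLM_apply (G : E → E →L[ℝ] E →L[ℝ] ℝ) (u : F → E) (x : F) (v : E) :
    tangentialCLM G u x v = tangentialPart G u x v := rfl

theorem inducedMetric_apply (G : E → E →L[ℝ] E →L[ℝ] ℝ) (u : F → E) (x X Y : F) :
    inducedMetric G u x X Y = G (u x) (fderiv ℝ u x X) (fderiv ℝ u x Y) := rfl

namespace IsLagrangianPatch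

variable {J : E →L[ℝ] E} {G : E → E →L[ℝ] E →L[ℝ] ℝ} {V : Set E} {u : F → E} {U : Set F}
  (h : IsLagrangianPatch J G V u U) {x : F}
include h

theorem isMetricOn_inducedMetric : IsMetricOn (inducedMetric G u) U where
  isOpen := h.isOpen
  contDiffOn := by
    refine contDiffOn_clm_apply.2 fun X => contDiffOn_clm_apply.2 fun Y => fun x hx => ?_
    have hdu : ContDiffAt ℝ ∞ (fderiv ℝ u) x := (h.smooth x hx).fderiv_right (by simp)
    have hG := (h.kaehler.contDiffAt (h.mapsTo x hx)).comp x (h.smooth x hx)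
    exact ((hG.clm_apply (hdu.clm_apply contDiffAt_const)).clm_apply
      (hdu.clm_apply contDiffAt_const)).contDiffWithinAt
  symm x hx X Y := h.kaehler.symm _ (h.mapsTo x hx) _ _
  pos x hx X hX := h.kaehler.pos _ (h.mapsTo x hx) _ fun h0 =>
    hX (h.immersion x hx (h0.trans (map_zero _).symm))

theorem contDiffAt_inducedMetric (hx : x ∈ U) : ContDiffAt ℝ ∞ (inducedMetric G u) x :=
  h.isMetricOn_inducedMetric.contDiffAt hx

theorem contDiffAt_fderiv (hx : x ∈ U) : ContDiffAt ℝ ∞ (fderiv ℝ u) x :=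
  (h.smooth x hx).fderiv_right (by simp)

theorem inner_tangentialPart (hx : x ∈ U) (v : E) (W : F) :
    inducedMetric G u x (tangentialPart G u x v) W = G (u x) v (fderiv ℝ u x W) := by
  rw [tangentialPart, h.isMetricOn_inducedMetric.inner_inverse hx]
  rfl

theorem eq_zero_of_orthogonal (hx : x ∈ U) {v : E}
    (h1 : ∀ W, G (u x) v (fderiv ℝ u x W) = 0) (h2 : ∀ W, G (u x) v (J (fderiv ℝ u x W)) = 0) :
    v = 0 := by
  have hz := h.mapsTo x hx
  let L : F × F →ₗ[ℝ] E := (fderiv ℝ u x).toLinearMap.coprod (J.comp (fderiv ℝ u x)).toLinearMap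
  have hL : ∀ p, L p = fderiv ℝ u x p.1 + J (fderiv ℝ u x p.2) := fun p => rfl
  have key : ∀ a b, L (a, b) = 0 → a = 0 := by
    intro a b hab
    rw [hL] at hab
    refine h.isMetricOn_inducedMetric.ext_inner hx fun W => ?_
    have := congrArg (fun w => G (u x) w (fderiv ℝ u x W)) hab
    simp only [map_add, add_apply, map_zero, zero_apply] at this
    rw [h.kaehler.inner_J_left hz, h.lagrangian x hx, neg_zero, add_zero] at this
    rw [map_zero, zero_apply]
    exact this
  have inj : Function.Injective L := by
    rw [injective_iff_map_eq_zero]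
    rintro ⟨a, b⟩ hab
    have ha := key a b hab
    have hb : L (b, -a) = 0 := by
      have := congrArg J hab
      rw [hL, map_add, h.kaehler.sq, map_zero] at this
      rw [hL]
      simp only [map_neg] at this ⊢
      have h3 : fderiv ℝ u x b + -J (fderiv ℝ u x a)
        = -(J (fderiv ℝ u x a) + -fderiv ℝ u x b) := by abel
      rw [h3, this, neg_zero]
    rw [ha, key b (-a) hb]
    rfl
  have surj : Function.Surjective L :=
    (LinearMap.injective_iff_surjective_of_finrank_eq_finrank (by
      rw [Module.finrank_prod, h.finrank_eq])).1 inj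
  obtain ⟨p, hp⟩ := surj v
  by_contra hv
  have := h.kaehler.pos _ hz v hv
  have e : G (u x) v v = 0 := by
    have e2 : G (u x) v v = G (u x) v (L p) := by rw [hp]
    rw [e2, hL, map_add, h1, h2, add_zero]
  rw [e] at this
  exact lt_irrefl _ this

/-- A vector is the sum of a tangent vector and of `J` applied to a tangent vector. -/
theorem eq_tangential_add (hx : x ∈ U) (v : E) : v = fderiv ℝ u x (tangentialPart G u x v)
    + J (fderiv ℝ u x (tangentialPart G u x (-J v))) := by
  have hz := h.mapsTo x hx
  refine sub_eq_zero.1 (h.eq_zero_of_orthogonal hx (fun W => ?_) fun W => ?_)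
  · rw [map_sub, sub_apply, map_add, add_apply, ← inducedMetric_apply, h.inner_tangentialPart hx,
      h.kaehler.inner_J_left hz, h.lagrangian x hx]
    ring
  · rw [map_sub, sub_apply, map_add, add_apply, h.kaehler.hermitian _ hz, ← inducedMetric_apply,
      h.inner_tangentialPart hx, h.lagrangian x hx, map_neg, neg_apply,
      h.kaehler.inner_J_left hz]
    ring

theorem secondDerivCLM_apply (hx : x ∈ U) (X Y : F) :
    secondDerivCLM G u x X Y = covariantAlong G u (fun y => fderiv ℝ u y Y) x X := by
  have hd := (h.contDiffAt_fderiv hx).differentiableAt (by simp)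
  have := (hd.hasFDerivAt.clm_apply (hasFDerivAt_const Y x)).fderiv
  rw [covariantAlong_eq, this]
  simp [secondDerivCLM]

theorem secondDerivCLM_symm (hx : x ∈ U) (X Y : F) :
    secondDerivCLM G u x X Y = secondDerivCLM G u x Y X := by
  have s := ((h.smooth x hx).isSymmSndFDerivAt (by simpa using two_le_infty)) X Y
  simp only [secondDerivCLM, add_apply, ContinuousLinearMap.comp_apply,
    ContinuousLinearMap.flip_apply, ContinuousLinearMap.compL_apply, s, christoffelCLM_apply,
    h.kaehler.christoffel_symm (h.mapsTo x hx) (fderiv ℝ u x X)]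

/-- The product rule for the induced metric, in terms of the ambient connection. -/
theorem fderiv_inducedMetric (hx : x ∈ U) (X Y Z : F) : fderiv ℝ (inducedMetric G u) x X Y Z
    = G (u x) (secondDerivCLM G u x X Y) (fderiv ℝ u x Z)
      + G (u x) (fderiv ℝ u x Y) (secondDerivCLM G u x X Z) := by
  have hd : ∀ Y, DifferentiableAt ℝ (fun y => fderiv ℝ u y Y) x := fun Y =>
    ((h.contDiffAt_fderiv hx).clm_apply contDiffAt_const).differentiableAt (by simp)
  rw [h.secondDerivCLM_apply hx, h.secondDerivCLM_apply hx, ← fderiv_inner_along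
    h.kaehler.toIsMetricOn ((h.smooth x hx).differentiableAt (by simp)) (h.mapsTo x hx) (hd Y)
    (hd Z) X]
  have hγ := ((h.contDiffAt_inducedMetric hx).differentiableAt (by simp)).hasFDerivAt
  have := ((hγ.clm_apply (hasFDerivAt_const Y x)).clm_apply (hasFDerivAt_const Z x)).fderiv
  simp only [inducedMetric_apply] at this
  rw [this]
  simp

theorem inner_secondDerivCLM (hx : x ∈ U) (X Y Z : F) :
    G (u x) (secondDerivCLM G u x X Y) (fderiv ℝ u x Z)
      = inducedMetric G u x (christoffelCLM (inducedMetric G u) x X Y) Z := by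
  have sy := h.kaehler.symm _ (h.mapsTo x hx)
  rw [christoffelCLM_apply, h.isMetricOn_inducedMetric.inner_christoffel hx,
    h.fderiv_inducedMetric hx, h.fderiv_inducedMetric hx, h.fderiv_inducedMetric hx,
    h.secondDerivCLM_symm hx Y X, h.secondDerivCLM_symm hx Z X, h.secondDerivCLM_symm hx Z Y,
    sy _ (secondDerivCLM G u x X Z), sy _ (secondDerivCLM G u x Y Z)]
  ring

theorem shape_apply (x X Y : F) :
    shape J G u x X Y = tangentialPart G u x (-J (secondDerivCLM G u x X Y)) := by
  simp [shape, ← tangentialCLM_apply]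

/-- The Gauss formula. -/
theorem secondDerivCLM_eq (hx : x ∈ U) (X Y : F) : secondDerivCLM G u x X Y
    = fderiv ℝ u x (christoffelCLM (inducedMetric G u) x X Y)
      + J (fderiv ℝ u x (shape J G u x X Y)) := by
  conv_lhs => rw [h.eq_tangential_add hx (secondDerivCLM G u x X Y)]
  rw [h.shape_apply]
  congr 2
  refine h.isMetricOn_inducedMetric.ext_inner hx fun W => ?_
  rw [h.inner_tangentialPart hx, h.inner_secondDerivCLM hx]

theorem inner_shape (hx : x ∈ U) (X Y Z : F) : inducedMetric G u x (shape J G u x X Y) Z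
    = G (u x) (secondDerivCLM G u x X Y) (J (fderiv ℝ u x Z)) := by
  rw [h.shape_apply, h.inner_tangentialPart hx, map_neg, neg_apply,
    h.kaehler.inner_J_left (h.mapsTo x hx), neg_neg]

theorem shape_symm (hx : x ∈ U) (X Y : F) : shape J G u x X Y = shape J G u x Y X := by
  rw [h.shape_apply, h.shape_apply, h.secondDerivCLM_symm hx]

theorem covariantAlong_J (hx : x ∈ U) {ξ : F → E} (hξ : DifferentiableAt ℝ ξ x) (X : F) :
    covariantAlong G u (fun y => J (ξ y)) x X = J (covariantAlong G u ξ x X) := by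
  have := (J.hasFDerivAt.comp x hξ.hasFDerivAt).fderiv
  simp only [Function.comp_def] at this
  rw [covariantAlong, this, h.kaehler.parallel _ (h.mapsTo x hx), covariantAlong, map_add]
  rfl

/-- The cubic form of a Lagrangian immersion is totally symmetric. -/
theorem inner_shape_symm (hx : x ∈ U) (X Y Z : F) :
    inducedMetric G u x (shape J G u x X Y) Z = inducedMetric G u x (shape J G u x X Z) Y := by
  have hz := h.mapsTo x hx
  have hd : ∀ Y, DifferentiableAt ℝ (fun y => fderiv ℝ u y Y) x := fun Y =>
    ((h.contDiffAt_fderiv hx).clm_apply contDiffAt_const).differentiableAt (by simp)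
  have e : (fun y => G (u y) (fderiv ℝ u y Y) (J (fderiv ℝ u y Z))) =ᶠ[𝓝 x] fun _ => 0 := by
    filter_upwards [h.isOpen.mem_nhds hx] with y hy using h.lagrangian y hy Y Z
  have p := fderiv_inner_along h.kaehler.toIsMetricOn ((h.smooth x hx).differentiableAt (by simp))
    hz (hd Y) (J.differentiableAt.comp x (hd Z)) X
  simp only [Function.comp_def] at p
  rw [e.fderiv_eq, h.covariantAlong_J hx (hd Z), ← h.secondDerivCLM_apply hx,
    ← h.secondDerivCLM_apply hx, ← h.inner_shape hx] at p
  simp only [fderiv_fun_const, Pi.zero_apply, zero_apply] at p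
  rw [h.inner_shape hx X Z, h.kaehler.symm _ hz, h.kaehler.inner_J_left hz]
  linarith

theorem contDiffAt_shape (hx : x ∈ U) : ContDiffAt ℝ ∞ (shape J G u) x := by
  have hu := h.smooth x hx
  have hdu := h.contDiffAt_fderiv hx
  have hz := h.mapsTo x hx
  have hG := (h.kaehler.contDiffAt hz).comp x hu
  have hinv : ContDiffAt ℝ ∞ (fun y => (inducedMetric G u y).inverse) x :=
    ContDiffAt.comp x (h.isMetricOn_inducedMetric.isInvertible hx).contDiffAt_map_inverse
      (h.contDiffAt_inducedMetric hx)
  have hΓ := (h.kaehler.contDiffAt_christoffelCLM hz).comp x hu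
  have hK : ContDiffAt ℝ ∞ (secondDerivCLM G u) x := by
    refine (hdu.fderiv_right (by simp)).add (ContDiffAt.clm_comp ?_ (hΓ.clm_comp hdu))
    exact ((ContinuousLinearMap.compL ℝ F E E).flip.contDiff.contDiffAt).comp x hdu
  have hT : ContDiffAt ℝ ∞ (tangentialCLM G u) x := by
    refine hinv.clm_comp (ContDiffAt.clm_comp ?_ hG)
    exact ((ContinuousLinearMap.compL ℝ F E ℝ).flip.contDiff.contDiffAt).comp x hdu
  refine ContDiffAt.clm_comp ?_ hK
  exact ((ContinuousLinearMap.compL ℝ F E F).contDiff.contDiffAt).comp x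
    (hT.clm_comp contDiffAt_const)

theorem contDiffAt_shape_apply (hx : x ∈ U) {S T : F → F} (hS : ContDiffAt ℝ ∞ S x)
    (hT : ContDiffAt ℝ ∞ T x) : ContDiffAt ℝ ∞ (fun y => shape J G u y (S y) (T y)) x :=
  ((h.contDiffAt_shape hx).clm_apply hS).clm_apply hT

theorem contDiffAt_leviCivita (hx : x ∈ U) {S T : F → F} (hS : ContDiffAt ℝ ∞ S x)
    (hT : ContDiffAt ℝ ∞ T x) :
    ContDiffAt ℝ ∞ (fun y => leviCivita (inducedMetric G u) T y (S y)) x :=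
  contDiffAt_covariantAlong h.isMetricOn_inducedMetric contDiffAt_id hx hT hS

theorem fderiv_inner (hx : x ∈ U) {S T : F → F} (hS : DifferentiableAt ℝ S x)
    (hT : DifferentiableAt ℝ T x) (X : F) :
    fderiv ℝ (fun y => inducedMetric G u y (S y) (T y)) x X
      = inducedMetric G u x (leviCivita (inducedMetric G u) S x X) (T x)
        + inducedMetric G u x (S x) (leviCivita (inducedMetric G u) T x X) :=
  fderiv_inner_along h.isMetricOn_inducedMetric (u := fun y => y) differentiableAt_fun_id hx hS hT X

theorem covariantAlong_tangent (hx : x ∈ U) {T : F → F} (hT : DifferentiableAt ℝ T x) (X : F) :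
    covariantAlong G u (fun y => fderiv ℝ u y (T y)) x X
      = fderiv ℝ u x (leviCivita (inducedMetric G u) T x X)
        + J (fderiv ℝ u x (shape J G u x X (T x))) := by
  have hd := (h.contDiffAt_fderiv hx).differentiableAt (by simp)
  have e := (hd.hasFDerivAt.clm_apply hT.hasFDerivAt).fderiv
  have k := h.secondDerivCLM_eq hx X (T x)
  rw [leviCivita_eq, map_add, add_assoc, ← k, covariantAlong_eq, e]
  simp [secondDerivCLM, add_assoc]

theorem leviCivita_shape (hx : x ∈ U) {S T : F → F} (hS : DifferentiableAt ℝ S x)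
    (hT : DifferentiableAt ℝ T x) (X : F) :
    leviCivita (inducedMetric G u) (fun y => shape J G u y (S y) (T y)) x X
      = shapeDeriv J G u x X (S x) (T x)
        + shape J G u x (leviCivita (inducedMetric G u) S x X) (T x)
        + shape J G u x (S x) (leviCivita (inducedMetric G u) T x X) := by
  have hA := ((h.contDiffAt_shape hx).differentiableAt (by simp)).hasFDerivAt
  have e := ((hA.clm_apply hS.hasFDerivAt).clm_apply hT.hasFDerivAt).fderiv
  have e' := ((hA.clm_apply (hasFDerivAt_const (S x) x)).clm_apply
    (hasFDerivAt_const (T x) x)).fderiv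
  simp only [shapeDeriv, leviCivita_eq, e, e']
  simp
  abel

theorem shapeDeriv_eq (hx : x ∈ U) (X Y Z : F) : shapeDeriv J G u x X Y Z
    = fderiv ℝ (shape J G u) x X Y Z + christoffelCLM (inducedMetric G u) x X (shape J G u x Y Z)
      - shape J G u x (christoffelCLM (inducedMetric G u) x X Y) Z
      - shape J G u x Y (christoffelCLM (inducedMetric G u) x X Z) := by
  have hA := ((h.contDiffAt_shape hx).differentiableAt (by simp)).hasFDerivAt
  have e := ((hA.clm_apply (hasFDerivAt_const Y x)).clm_apply (hasFDerivAt_const Z x)).fderiv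
  simp only [shapeDeriv, leviCivita_eq, e]
  simp

theorem shapeDeriv_symm (hx : x ∈ U) (X Y Z : F) :
    shapeDeriv J G u x X Y Z = shapeDeriv J G u x X Z Y := by
  have e : (fun y => shape J G u y Y Z) =ᶠ[𝓝 x] fun y => shape J G u y Z Y := by
    filter_upwards [h.isOpen.mem_nhds hx] with y hy using h.shape_symm hy Y Z
  rw [shapeDeriv, leviCivita, covariantAlong_congr e, h.shape_symm hx _ Z, h.shape_symm hx Y,
    shapeDeriv, leviCivita]
  abel

theorem inner_shapeDeriv_symm (hx : x ∈ U) (X Y Z W : F) :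
    inducedMetric G u x (shapeDeriv J G u x X Y Z) W
      = inducedMetric G u x (shapeDeriv J G u x X Y W) Z := by
  have e : (fun y => inducedMetric G u y (shape J G u y Y Z) W) =ᶠ[𝓝 x]
      fun y => inducedMetric G u y (shape J G u y Y W) Z := by
    filter_upwards [h.isOpen.mem_nhds hx] with y hy using h.inner_shape_symm hy Y Z W
  have dA : ∀ A B, DifferentiableAt ℝ (fun y => shape J G u y A B) x := fun A B =>
    (h.contDiffAt_shape_apply hx contDiffAt_const contDiffAt_const).differentiableAt (by simp)
  have r := congrArg (fun L : F →L[ℝ] ℝ => L X) e.fderiv_eq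
  rw [h.fderiv_inner hx (dA Y Z) (differentiableAt_const W) X,
    h.fderiv_inner hx (dA Y W) (differentiableAt_const Z) X,
    h.leviCivita_shape hx (differentiableAt_const _) (differentiableAt_const _),
    h.leviCivita_shape hx (differentiableAt_const _) (differentiableAt_const _)] at r
  simp only [leviCivita_eq, map_add, add_apply, fderiv_fun_const, Pi.zero_apply, zero_apply,
    zero_add] at r
  rw [h.inner_shape_symm hx _ Z W, h.inner_shape_symm hx Y Z (christoffelCLM _ x X W),
    h.inner_shape_symm hx Y W (christoffelCLM _ x X Z)] at r
  linarith

/-- Second covariant derivatives of a tangent field, decomposed into tangent and normal parts. -/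
theorem covariantAlong_covariantAlong_tangent (hx : x ∈ U) {T : F → F}
    (hT : ∀ y ∈ U, ContDiffAt ℝ ∞ T y)
    (X Y : F) :
    covariantAlong G u (fun y => covariantAlong G u (fun y => fderiv ℝ u y (T y)) y Y) x X
      = fderiv ℝ u x (leviCivita (inducedMetric G u)
            (fun y => leviCivita (inducedMetric G u) T y Y) x X
          - shape J G u x X (shape J G u x Y (T x)))
        + J (fderiv ℝ u x (shape J G u x X (leviCivita (inducedMetric G u) T x Y)
          + leviCivita (inducedMetric G u) (fun y => shape J G u y Y (T y)) x X)) := by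
  have d : ∀ {f : F → F} {y : F}, ContDiffAt ℝ ∞ f y → DifferentiableAt ℝ f y :=
    fun hf => hf.differentiableAt (by simp)
  have hL := h.contDiffAt_leviCivita hx (contDiffAt_const (c := Y)) (hT x hx)
  have hS := h.contDiffAt_shape_apply hx (contDiffAt_const (c := Y)) (hT x hx)
  have e : (fun y => covariantAlong G u (fun y => fderiv ℝ u y (T y)) y Y) =ᶠ[𝓝 x] fun y =>
      fderiv ℝ u y (leviCivita (inducedMetric G u) T y Y)
        + J (fderiv ℝ u y (shape J G u y Y (T y))) := by
    filter_upwards [h.isOpen.mem_nhds hx] with y hy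
    exact h.covariantAlong_tangent hy (d (hT y hy)) Y
  have hdu := h.contDiffAt_fderiv hx
  have c1 := (hdu.clm_apply hL).differentiableAt (by simp)
  have c2 := (hdu.clm_apply hS).differentiableAt (by simp)
  have c3 : DifferentiableAt ℝ (fun x => J (fderiv ℝ u x (shape J G u x Y (T x)))) x :=
    J.differentiableAt.comp x c2
  rw [covariantAlong_congr e, covariantAlong_add c1 c3,
    h.covariantAlong_J hx c2, h.covariantAlong_tangent hx (d hL),
    h.covariantAlong_tangent hx (d hS)]
  simp only [map_add, map_sub, h.kaehler.sq]
  abel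

/-- The ambient curvature at tangent vectors, as the commutator of covariant derivatives along the
surface. -/
theorem curvature_tangent (hx : x ∈ U) {T : F → F} (hT : ∀ y ∈ U, ContDiffAt ℝ ∞ T y) (X Y : F) :
    curvature G (u x) (fderiv ℝ u x X) (fderiv ℝ u x Y) (fderiv ℝ u x (T x))
      = covariantAlong G u (fun y => covariantAlong G u (fun y => fderiv ℝ u y (T y)) y Y) x X
        - covariantAlong G u (fun y => covariantAlong G u (fun y => fderiv ℝ u y (T y)) y X) x Y :=
  (covariantAlong_comm h.kaehler.toIsMetricOn (h.smooth x hx) (h.mapsTo x hx)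
    ((h.contDiffAt_fderiv hx).clm_apply (hT x hx)) X Y).symm

/-- The second fundamental form, in terms of the tensor `A`. -/
theorem secondFundamentalForm_eq (hx : x ∈ U) (X Y : F) :
    secondFundamentalForm G u x X Y = J (fderiv ℝ u x (shape J G u x X Y)) := by
  rw [secondFundamentalForm, ← h.secondDerivCLM_apply hx, h.secondDerivCLM_eq hx,
    christoffelCLM_apply]
  abel

theorem normalPart_eq (hx : x ∈ U) (S T : F) :
    normalPart G u x (fderiv ℝ u x S + J (fderiv ℝ u x T)) = J (fderiv ℝ u x T) := by
  have : tangentialPart G u x (fderiv ℝ u x S + J (fderiv ℝ u x T)) = S := by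
    refine h.isMetricOn_inducedMetric.ext_inner hx fun W => ?_
    rw [h.inner_tangentialPart hx, map_add, add_apply, h.kaehler.inner_J_left (h.mapsTo x hx),
      h.lagrangian x hx, inducedMetric_apply]
    ring
  rw [normalPart, this]
  abel

/-- The covariant derivative of the second fundamental form, in terms of the tensor `A`. -/
theorem covariantDerivSFF_eq (hx : x ∈ U) (X Y Z : F) :
    covariantDerivSFF G u x X Y Z = J (fderiv ℝ u x (shapeDeriv J G u x X Y Z)) := by
  have e : (fun y => secondFundamentalForm G u y Y Z) =ᶠ[𝓝 x]
      fun y => J (fderiv ℝ u y (shape J G u y Y Z)) := by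
    filter_upwards [h.isOpen.mem_nhds hx] with y hy using h.secondFundamentalForm_eq hy Y Z
  have hS : ContDiffAt ℝ ∞ (fun y => shape J G u y Y Z) x :=
    h.contDiffAt_shape_apply hx contDiffAt_const contDiffAt_const
  have c := ((h.contDiffAt_fderiv hx).clm_apply hS).differentiableAt (by simp)
  rw [covariantDerivSFF, normalConnection, covariantAlong_congr e, h.covariantAlong_J hx c,
    h.covariantAlong_tangent hx (hS.differentiableAt (by simp)), map_add, h.kaehler.sq, add_comm,
    ← map_neg, h.normalPart_eq hx, h.secondFundamentalForm_eq hx, h.secondFundamentalForm_eq hx,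
    shapeDeriv, christoffelCLM_apply, christoffelCLM_apply]
  simp only [map_sub]

/-! ### The equations of Gauss and Codazzi -/

variable {ε : ℝ}
  (hc : ∀ z ∈ V, ∀ X, G z (curvature G z X (J X) (J X)) X = 4 * ε * (G z X X) ^ 2)

include hc in
/-- The Codazzi equation: in a complex space form the ambient curvature at tangent vectors has no
normal component. -/
theorem shapeDeriv_codazzi (hx : x ∈ U) (X Y Z : F) :
    shapeDeriv J G u x X Y Z = shapeDeriv J G u x Y X Z := by
  have hz := h.mapsTo x hx
  have hT : ∀ y ∈ U, ContDiffAt ℝ ∞ (fun _ : F => Z) y := fun _ _ => contDiffAt_const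
  have hl := h.lagrangian x hx
  refine sub_eq_zero.1 (h.isMetricOn_inducedMetric.ext_inner hx fun W => ?_)
  have r := h.kaehler.curvature_of_const hz (hc _ hz) (fderiv ℝ u x X) (fderiv ℝ u x Y)
    (fderiv ℝ u x Z) (J (fderiv ℝ u x W))
  have jl : ∀ A B, G (u x) (J (fderiv ℝ u x A)) (fderiv ℝ u x B) = 0 := fun A B => by
    rw [h.kaehler.inner_J_left hz, hl, neg_zero]
  rw [h.curvature_tangent hx hT, h.covariantAlong_covariantAlong_tangent hx hT,
    h.covariantAlong_covariantAlong_tangent hx hT,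
    h.leviCivita_shape hx (differentiableAt_const _) (differentiableAt_const _),
    h.leviCivita_shape hx (differentiableAt_const _) (differentiableAt_const _)] at r
  have hs : christoffelCLM (inducedMetric G u) x X Y
      = christoffelCLM (inducedMetric G u) x Y X := by
    rw [christoffelCLM_apply, christoffelCLM_apply,
      h.isMetricOn_inducedMetric.christoffel_symm hx]
  simp only [leviCivita_eq, map_add, map_sub, add_apply, sub_apply, hl, jl,
    h.kaehler.hermitian _ hz, ← inducedMetric_apply, fderiv_fun_const, Pi.zero_apply, zero_apply,
    zero_add, hs] at r
  simp only [map_sub, sub_apply, map_zero, zero_apply]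
  simp only [inducedMetric_apply, mul_zero, sub_zero, zero_mul] at r ⊢
  linarith

include hc in
/-- The Gauss equation, applied to a field `T` with `∇T = 0`. -/
theorem gauss_of_parallel (hx : x ∈ U) {T : F → F} (hT : ∀ y ∈ U, ContDiffAt ℝ ∞ T y)
    (hp : ∀ y ∈ U, ∀ X, leviCivita (inducedMetric G u) T y X = 0) (X Y W : F) :
    ε * (inducedMetric G u x Y (T x) * inducedMetric G u x X W
        - inducedMetric G u x X (T x) * inducedMetric G u x Y W)
      + inducedMetric G u x (shape J G u x X (shape J G u x Y (T x))) W
      - inducedMetric G u x (shape J G u x Y (shape J G u x X (T x))) W = 0 := by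
  have hz := h.mapsTo x hx
  have hl := h.lagrangian x hx
  have r := h.kaehler.curvature_of_const hz (hc _ hz) (fderiv ℝ u x X) (fderiv ℝ u x Y)
    (fderiv ℝ u x (T x)) (fderiv ℝ u x W)
  have jl : ∀ A B, G (u x) (J (fderiv ℝ u x A)) (fderiv ℝ u x B) = 0 := fun A B => by
    rw [h.kaehler.inner_J_left hz, hl, neg_zero]
  have z : ∀ Y X, leviCivita (inducedMetric G u)
      (fun y => leviCivita (inducedMetric G u) T y Y) x X = 0 := by
    intro Y X
    have e : (fun y => leviCivita (inducedMetric G u) T y Y) =ᶠ[𝓝 x] fun _ => 0 := by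
      filter_upwards [h.isOpen.mem_nhds hx] with y hy using hp y hy Y
    rw [leviCivita, covariantAlong_congr e, covariantAlong_eq]
    simp
  rw [h.curvature_tangent hx hT, h.covariantAlong_covariantAlong_tangent hx hT,
    h.covariantAlong_covariantAlong_tangent hx hT, z, z] at r
  simp only [map_add, map_sub, add_apply, sub_apply, jl, zero_sub, map_neg, neg_apply,
    ← inducedMetric_apply] at r
  linarith

end IsLagrangianPatch

end LagrangianPatch

/-! ### Cubic forms on the Euclidean plane -/

section Plane

variable {F : Type*} [NormedAddCommGroup F] [NormedSpace ℝ F] [FiniteDimensional ℝ F]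

variable (F) in
/-- The trace of endomorphisms, as a continuous linear form. -/
def traceCLM : (F →L[ℝ] F) →L[ℝ] ℝ :=
  LinearMap.toContinuousLinearMap ((LinearMap.trace ℝ F).comp (ContinuousLinearMap.coeLM ℝ))

theorem traceCLM_apply (L : F →L[ℝ] F) : traceCLM F L = LinearMap.trace ℝ F (L : F →ₗ[ℝ] F) := rfl

theorem traceCLM_comp_comm (K L : F →L[ℝ] F) :
    traceCLM F (K.comp L) = traceCLM F (L.comp K) :=
  LinearMap.trace_mul_comm ℝ (K : F →ₗ[ℝ] F) (L : F →ₗ[ℝ] F)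

/-- The trace of `L` is `∑ f_i (L w_i)` if the identity is `∑ f_i ⊗ w_i`. -/
theorem traceCLM_eq_sum {ι : Type*} (s : Finset ι) (f : ι → F →L[ℝ] ℝ) (w : ι → F)
    (hfw : ∀ v, v = ∑ i ∈ s, f i v • w i) (L : F →L[ℝ] F) :
    traceCLM F L = ∑ i ∈ s, f i (L (w i)) := by
  have e : (L : F →ₗ[ℝ] F)
      = ∑ i ∈ s, ((f i : F →L[ℝ] ℝ) : F →ₗ[ℝ] ℝ).smulRight (L (w i)) := by
    ext v
    conv_lhs => rw [ContinuousLinearMap.coe_coe, hfw v, map_sum]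
    simp
  rw [traceCLM_apply, e, map_sum]
  simp

variable (hF : Module.finrank ℝ F = 2) {γ : F →L[ℝ] F →L[ℝ] ℝ} (hs : ∀ X Y, γ X Y = γ Y X)
  (hp : ∀ X, X ≠ 0 → 0 < γ X X) {k : ℝ} {e₁ e₂ : F}

/-- `e₁, e₂` is an orthogonal basis of vectors of square length `k > 0`. -/
structure IsOrthoFrame (γ : F →L[ℝ] F →L[ℝ] ℝ) (k : ℝ) (e₁ e₂ : F) : Prop where
  pos : 0 < k
  inner₁₁ : γ e₁ e₁ = k
  inner₂₂ : γ e₂ e₂ = k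
  inner₁₂ : γ e₁ e₂ = 0
  inner₂₁ : γ e₂ e₁ = 0
  expand : ∀ v, v = k⁻¹ • (γ v e₁ • e₁ + γ v e₂ • e₂)

include hF hs hp in
theorem exists_isOrthoFrame (hk : 0 < k) (h₁ : γ e₁ e₁ = k) : ∃ e₂, IsOrthoFrame γ k e₁ e₂ := by
  obtain ⟨w, hw, hw0⟩ := (Submodule.ne_bot_iff _).1
    (LinearMap.ker_ne_bot_of_finrank_lt (f := (γ e₁).toLinearMap) (by rw [hF]; simp))
  have hw : γ e₁ w = 0 := hw
  have hww := hp w hw0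
  have hsq : √(k / γ w w) * √(k / γ w w) = k / γ w w := Real.mul_self_sqrt (by positivity)
  set e₂ := √(k / γ w w) • w with he₂
  have h₂ : γ e₂ e₂ = k := by
    simp only [he₂, map_smul, smul_apply, smul_eq_mul]
    rw [← mul_assoc, hsq]
    field_simp
  have h₁₂ : γ e₁ e₂ = 0 := by simp [he₂, hw]
  have h₂₁ : γ e₂ e₁ = 0 := by rw [hs, h₁₂]
  let L : F →ₗ[ℝ] ℝ × ℝ := ((γ e₁).prod (γ e₂)).toLinearMap
  have hL : ∀ v, L v = (γ e₁ v, γ e₂ v) := fun v => rfl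
  have surj : Function.Surjective L := by
    rintro ⟨s, t⟩
    refine ⟨k⁻¹ • (s • e₁ + t • e₂), ?_⟩
    rw [hL]
    simp only [map_smul, map_add, h₁, h₂, h₁₂, h₂₁, smul_eq_mul]
    ext <;> simp <;> field_simp
  have inj : Function.Injective L :=
    (LinearMap.injective_iff_surjective_of_finrank_eq_finrank (by rw [hF]; simp)).2 surj
  refine ⟨e₂, hk, h₁, h₂, h₁₂, h₂₁, fun v => inj ?_⟩
  rw [hL, hL]
  simp only [map_smul, map_add, h₁, h₂, h₁₂, h₂₁, smul_eq_mul, hs v]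
  ext <;> simp <;> field_simp

namespace IsOrthoFrame

variable (h : IsOrthoFrame γ k e₁ e₂)
include h

theorem traceCLM_eq (L : F →L[ℝ] F) : k * traceCLM F L = γ (L e₁) e₁ + γ (L e₂) e₂ := by
  have := traceCLM_eq_sum (Finset.univ : Finset (Fin 2))
    ![k⁻¹ • γ.flip e₁, k⁻¹ • γ.flip e₂] ![e₁, e₂] (fun v => by
      conv_lhs => rw [h.expand v]
      simp [mul_smul, smul_add]) L
  have hk := h.pos.ne'
  rw [this]
  simp
  field_simp

theorem inner_eq (X Y : F) : k * γ X Y = γ X e₁ * γ Y e₁ + γ X e₂ * γ Y e₂ := by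
  have hk := h.pos.ne'
  have e : γ X Y = k⁻¹ * (γ Y e₁ * γ X e₁ + γ Y e₂ * γ X e₂) := by
    conv_lhs => rw [h.expand Y]
    simp
    ring
  rw [e]
  field_simp

theorem ext {X Y : F} (h₁ : γ X e₁ = γ Y e₁) (h₂ : γ X e₂ = γ Y e₂) : X = Y := by
  rw [h.expand X, h.expand Y, h₁, h₂]

theorem linear_ext {W : Type*} [AddCommGroup W] [Module ℝ W] [TopologicalSpace W]
    {K L : F →L[ℝ] W} (h₁ : K e₁ = L e₁) (h₂ : K e₂ = L e₂) : K = L := by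
  ext v
  rw [h.expand v]
  simp only [map_smul, map_add, h₁, h₂]

/-- A self-adjoint traceless endomorphism of the plane vanishes if its image is orthogonal to
`e₁`. -/
theorem eq_zero_of_traceless {L : F →L[ℝ] F} (hs : ∀ X Y, γ (L X) Y = γ (L Y) X)
    (ht : traceCLM F L = 0) (h0 : ∀ X, γ (L X) e₁ = 0) : L = 0 := by
  have t := h.traceCLM_eq L
  rw [ht, h0, mul_zero, zero_add] at t
  have h12 : γ (L e₁) e₂ = 0 := by rw [hs, h0]
  refine h.linear_ext (h.ext ?_ ?_) (h.ext ?_ ?_) <;> simp [h0, h12, ← t]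

end IsOrthoFrame

/-- A symmetric bilinear product `A` on the plane with totally symmetric cubic form and with
`tr A(Z, ·) = 2 γ(e₁, Z)`, such that the Gauss equation holds with zero intrinsic curvature. -/
structure IsFlatCubic (γ : F →L[ℝ] F →L[ℝ] ℝ) (ε k : ℝ) (e₁ : F) (A : F →L[ℝ] F →L[ℝ] F) :
    Prop where
  symm : ∀ X Y, A X Y = A Y X
  inner_symm : ∀ X Y Z, γ (A X Y) Z = γ (A X Z) Y
  trace : ∀ Z, traceCLM F (A Z) = 2 * γ e₁ Z
  gauss : ∀ Y, ε * (γ Y e₁ ^ 2 - k * γ Y Y) + γ (A e₁ Y) (A e₁ Y) - γ (A Y Y) (A e₁ e₁) = 0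

namespace IsFlatCubic

variable {ε : ℝ} {A : F →L[ℝ] F →L[ℝ] F} (hA : IsFlatCubic γ ε k e₁ A)
  (h : IsOrthoFrame γ k e₁ e₂)
include hA h

theorem inner₁₁₁ : γ (A e₁ e₁) e₁ = 2 * k ^ 2 - γ (A e₁ e₂) e₂ := by
  have t := h.traceCLM_eq (A e₁)
  rw [hA.trace, h.inner₁₁] at t
  linarith

theorem inner₂₂₂ : γ (A e₂ e₂) e₂ = -γ (A e₁ e₁) e₂ := by
  have t := h.traceCLM_eq (A e₂)
  rw [hA.trace, h.inner₁₂, hA.symm e₂ e₁, hA.inner_symm] at t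
  linarith

/-- The Gauss equation confines the components of `A` to a circle. -/
theorem circle : (2 * γ (A e₁ e₁) e₂) ^ 2 + (2 * γ (A e₁ e₂) e₂ - k ^ 2) ^ 2
    = k ^ 3 * (k + 2 * ε) := by
  have g := hA.gauss e₂
  have p := h.inner_eq (A e₁ e₂) (A e₁ e₂)
  have q := h.inner_eq (A e₂ e₂) (A e₁ e₁)
  have c1 : γ (A e₂ e₂) e₁ = γ (A e₁ e₂) e₂ := by rw [hA.inner_symm, hA.symm e₂ e₁]
  rw [hA.inner_symm e₁ e₂ e₁] at p
  rw [hA.inner₂₂₂ h, hA.inner₁₁₁ h, c1] at q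
  rw [h.inner₂₁, h.inner₂₂] at g
  linear_combination -2 * p + 2 * q + 2 * k * g

/-- In the degenerate case, `A` is determined by its trace. -/
theorem eq_of_degenerate (hd : k + 2 * ε = 0) (hs : ∀ X Y, γ X Y = γ Y X) (X Y : F) :
    A X Y = (1 / 2 : ℝ) • (γ e₁ X • Y + γ e₁ Y • X + γ X Y • e₁) := by
  have c := hA.circle h
  rw [hd, mul_zero] at c
  have b0 : γ (A e₁ e₁) e₂ = 0 := by
    nlinarith [sq_nonneg (2 * γ (A e₁ e₁) e₂), sq_nonneg (2 * γ (A e₁ e₂) e₂ - k ^ 2)]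
  have c0 : γ (A e₁ e₂) e₂ = k ^ 2 / 2 := by
    nlinarith [sq_nonneg (2 * γ (A e₁ e₁) e₂), sq_nonneg (2 * γ (A e₁ e₂) e₂ - k ^ 2)]
  have a0 := hA.inner₁₁₁ h
  have d0 := hA.inner₂₂₂ h
  have c1 : γ (A e₂ e₂) e₁ = γ (A e₁ e₂) e₂ := by rw [hA.inner_symm, hA.symm e₂ e₁]
  have b1 := hA.inner_symm e₁ e₂ e₁
  let A' : F →L[ℝ] F →L[ℝ] F := (1 / 2 : ℝ) • ((γ e₁).smulRight (ContinuousLinearMap.id ℝ F)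
    + (ContinuousLinearMap.smulRightL ℝ F F (γ e₁))
    + ((ContinuousLinearMap.smulRightL ℝ F F).flip e₁).comp γ)
  have hA' : ∀ X Y, A' X Y = (1 / 2 : ℝ) • (γ e₁ X • Y + γ e₁ Y • X + γ X Y • e₁) := by
    intro X Y
    simp [A']
  have e11 : A e₁ e₁ = A' e₁ e₁ := by
    refine h.ext ?_ ?_ <;> (simp [hA', h.inner₁₁, h.inner₁₂, a0, b0, c0]; try ring)
  have e12 : A e₁ e₂ = A' e₁ e₂ := by
    refine h.ext ?_ ?_ <;> (simp [hA', h.inner₁₁, h.inner₁₂, h.inner₂₂, h.inner₂₁, b0, b1, c0]; try ring)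
  have e22 : A e₂ e₂ = A' e₂ e₂ := by
    refine h.ext ?_ ?_ <;> (simp [hA', h.inner₁₁, h.inner₁₂, h.inner₂₂, d0, b0, c1, c0]; try ring)
  have e21 : A e₂ e₁ = A' e₂ e₁ := by
    rw [hA.symm, e12, hA', hA', hs e₁ e₂]
    congr 2
    abel
  rw [← hA', h.linear_ext (K := A) (L := A') (h.linear_ext e11 e12) (h.linear_ext e21 e22)]

/-- In the non-degenerate case a totally symmetric traceless infinitesimal deformation `B` of `A`
which preserves the Gauss equation vanishes: the circle of solutions of the Gauss equation carries
no Cauchy-Riemann pair of tangent vectors. -/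
theorem deriv_eq_zero (hd : k + 2 * ε ≠ 0) {B : F → F →L[ℝ] F →L[ℝ] F}
    (b₁ : ∀ X Y Z, B X Y Z = B Y X Z) (b₂ : ∀ X Y Z, B X Y Z = B X Z Y)
    (b₃ : ∀ X Y Z W, γ (B X Y Z) W = γ (B X Y W) Z) (bt : ∀ X Z, traceCLM F (B X Z) = 0)
    (bg : ∀ V Y, 2 * γ (B V e₁ Y) (A e₁ Y) - γ (B V Y Y) (A e₁ e₁) - γ (A Y Y) (B V e₁ e₁) = 0)
    (X : F) : B X = 0 := by
  have hk := h.pos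
  have c := hA.circle h
  have a0 := hA.inner₁₁₁ h
  have d0 := hA.inner₂₂₂ h
  have c1 : γ (A e₂ e₂) e₁ = γ (A e₁ e₂) e₂ := by rw [hA.inner_symm, hA.symm e₂ e₁]
  have b1 := hA.inner_symm e₁ e₂ e₁
  set b := γ (A e₁ e₁) e₂
  set c' := γ (A e₁ e₂) e₂
  set p := γ (B e₁ e₁ e₁) e₁ with hp
  set q := γ (B e₁ e₁ e₁) e₂ with hq
  have t1 := h.traceCLM_eq (B e₁ e₁)
  have t2 := h.traceCLM_eq (B e₁ e₂)
  have t3 := h.traceCLM_eq (B e₂ e₂)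
  rw [bt, mul_zero] at t1 t2 t3
  have p1121 : γ (B e₁ e₁ e₂) e₁ = q := by rw [b₃]
  have p1122 : γ (B e₁ e₁ e₂) e₂ = -p := by linarith
  have p1211 : γ (B e₁ e₂ e₁) e₁ = q := by rw [b₂, b₃]
  have p1212 : γ (B e₁ e₂ e₁) e₂ = -p := by rw [b₂, p1122]
  have p1221 : γ (B e₁ e₂ e₂) e₁ = -p := by rw [b₃, p1212]
  have p1222 : γ (B e₁ e₂ e₂) e₂ = -q := by linarith
  have p2222 : γ (B e₂ e₂ e₂) e₂ = p := by
    rw [b₁, b₂, b₁] at t3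
    have : γ (B e₂ e₂ e₁) e₁ = -p := by rw [b₂, b₁, b₃, b₂, p1122]
    have t3' := h.traceCLM_eq (B e₂ e₂)
    rw [bt, mul_zero] at t3'
    linarith
  have g1 := bg e₁ e₂
  have g2 := bg e₂ e₂
  simp only [b₁ e₂ e₁] at g2
  have i1 := h.inner_eq (B e₁ e₁ e₂) (A e₁ e₂)
  have i2 := h.inner_eq (B e₁ e₂ e₂) (A e₁ e₁)
  have i3 := h.inner_eq (A e₂ e₂) (B e₁ e₁ e₁)
  have j1 := h.inner_eq (B e₂ e₁ e₂) (A e₁ e₂)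
  have j2 := h.inner_eq (B e₂ e₂ e₂) (A e₁ e₁)
  have j3 := h.inner_eq (A e₂ e₂) (B e₂ e₁ e₁)
  have p2221 : γ (B e₂ e₂ e₂) e₁ = -q := by rw [b₃, b₂, b₁, p1222]
  rw [p1121, p1122, b1] at i1
  rw [p1221, p1222, a0] at i2
  rw [c1, d0] at i3
  simp only [b₁ e₂ e₁] at j1 j3
  rw [p1221, p1222, b1] at j1
  rw [p2221, p2222, a0] at j2
  rw [c1, d0, p1211, p1212] at j3
  have E1 : 2 * b * q - (2 * c' - k ^ 2) * p = 0 := by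
    linear_combination (k * g1 - 2 * i1 + i2 + i3) / 2
  have E2 : 2 * b * p + (2 * c' - k ^ 2) * q = 0 := by
    linear_combination -(k * g2 - 2 * j1 + j2 + j3) / 2
  have hne : k ^ 3 * (k + 2 * ε) ≠ 0 := mul_ne_zero (pow_ne_zero _ hk.ne') hd
  have hp0 : p = 0 := by
    have : (k ^ 3 * (k + 2 * ε)) * p = 0 := by
      rw [← c]; linear_combination 2 * b * E2 - (2 * c' - k ^ 2) * E1
    exact (mul_eq_zero.1 this).resolve_left hne
  have hq0 : q = 0 := by
    have : (k ^ 3 * (k + 2 * ε)) * q = 0 := by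
      rw [← c]; linear_combination 2 * b * E1 + (2 * c' - k ^ 2) * E2
    exact (mul_eq_zero.1 this).resolve_left hne
  have z111 : B e₁ e₁ e₁ = 0 := h.ext (by simpa using hp0) (by simpa using hq0)
  have z112 : B e₁ e₁ e₂ = 0 := h.ext (by rw [p1121, hq0]; simp) (by rw [p1122, hp0]; simp)
  have z122 : B e₁ e₂ e₂ = 0 := h.ext (by rw [p1221, hp0]; simp) (by rw [p1222, hq0]; simp)
  have z222 : B e₂ e₂ e₂ = 0 := h.ext (by rw [p2221, hq0]; simp) (by rw [p2222, hp0]; simp)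
  have B1 : B e₁ = 0 := h.linear_ext (h.linear_ext z111 z112)
    (h.linear_ext (by rw [b₂, z112]; rfl) z122)
  have B2 : B e₂ = 0 := h.linear_ext (by rw [show B e₂ e₁ = B e₁ e₂ by ext; rw [b₁], B1]; rfl)
    (h.linear_ext (by rw [b₂, b₁, z122]; rfl) z222)
  refine h.linear_ext ?_ ?_
  · rw [show B X e₁ = B e₁ X by ext; rw [b₁], B1]; rfl
  · rw [show B X e₂ = B e₂ X by ext; rw [b₁], B2]; rfl

end IsFlatCubic

end Plane

/-! ### Lagrangian surfaces with `|H|` constant and `J H` divergence free -/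

section MeanField

variable {E : Type*} [NormedAddCommGroup E] [NormedSpace ℝ E] [FiniteDimensional ℝ E]
variable {F : Type*} [NormedAddCommGroup F] [NormedSpace ℝ F] [FiniteDimensional ℝ F]

/-- The covariant differential `X ↦ ∇_X T` of a vector field. -/
def leviCivitaCLM (γ : F → F →L[ℝ] F →L[ℝ] ℝ) (T : F → F) (x : F) : F →L[ℝ] F :=
  fderiv ℝ T x + (christoffelCLM γ x).flip (T x)

theorem leviCivitaCLM_apply (γ : F → F →L[ℝ] F →L[ℝ] ℝ) (T : F → F) (x X : F) :
    leviCivitaCLM γ T x X = leviCivita γ T x X := by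
  simp [leviCivitaCLM, leviCivita_eq]

/-- The field `η` with `H = J du η`: half the trace of the tensor `A`. -/
def meanField (J : E →L[ℝ] E) (G : E → E →L[ℝ] E →L[ℝ] ℝ) (u : F → E) (x : F) : F :=
  (1 / 2 : ℝ) • (inducedMetric G u x).inverse ((traceCLM F).comp (shape J G u x))

/-- The covariant derivative `∇_X A` of the tensor `A`, as a bilinear map. -/
def shapeDerivCLM (J : E →L[ℝ] E) (G : E → E →L[ℝ] E →L[ℝ] ℝ) (u : F → E) (x X : F) :
    F →L[ℝ] F →L[ℝ] F :=
  fderiv ℝ (shape J G u) x X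
    + (ContinuousLinearMap.compL ℝ F F F (christoffelCLM (inducedMetric G u) x X)).comp
        (shape J G u x)
    - (shape J G u x).comp (christoffelCLM (inducedMetric G u) x X)
    - ((ContinuousLinearMap.compL ℝ F F F).flip (christoffelCLM (inducedMetric G u) x X)).comp
        (shape J G u x)

/-- A vector field with value `v` at `x` and vanishing covariant differential there. Testing tensor
identities on such fields removes the connection terms from their derivatives at `x`. -/
def parallelExtension (γ : F → F →L[ℝ] F →L[ℝ] ℝ) (x v : F) (y : F) : F :=
  v - christoffelCLM γ x (y - x) v

theorem parallelExtension_self (γ : F → F →L[ℝ] F →L[ℝ] ℝ) (x v : F) :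
    parallelExtension γ x v x = v := by
  simp [parallelExtension]

theorem contDiff_parallelExtension (γ : F → F →L[ℝ] F →L[ℝ] ℝ) (x v : F) :
    ContDiff ℝ ∞ (parallelExtension γ x v) :=
  contDiff_const.sub (((christoffelCLM γ x).contDiff.comp
    (contDiff_id.sub contDiff_const)).clm_apply contDiff_const)

theorem leviCivita_parallelExtension (γ : F → F →L[ℝ] F →L[ℝ] ℝ) (x v X : F) :
    leviCivita γ (parallelExtension γ x v) x X = 0 := by
  have e := ((hasFDerivAt_const v x).fun_sub (((christoffelCLM γ x).flip v).hasFDerivAt.comp x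
    ((hasFDerivAt_id x).sub_const x))).fderiv
  have e' : fderiv ℝ (parallelExtension γ x v) x = -(christoffelCLM γ x).flip v := by
    refine Eq.trans ?_ (e.trans ?_)
    · rfl
    · ext; simp
  rw [leviCivita_eq, parallelExtension_self, e']
  simp

namespace IsLagrangianPatch

variable {J : E →L[ℝ] E} {G : E → E →L[ℝ] E →L[ℝ] ℝ} {V : Set E} {u : F → E} {U : Set F}
  (h : IsLagrangianPatch J G V u U) {x : F}
include h

theorem shapeDerivCLM_apply (hx : x ∈ U) (X Y Z : F) :
    shapeDerivCLM J G u x X Y Z = shapeDeriv J G u x X Y Z := by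
  rw [h.shapeDeriv_eq hx]
  simp [shapeDerivCLM]

theorem inner_meanField (hx : x ∈ U) (Z : F) :
    2 * inducedMetric G u x (meanField J G u x) Z = traceCLM F (shape J G u x Z) := by
  rw [meanField, map_smul, h.isMetricOn_inducedMetric.inner_inverse hx]
  simp

theorem contDiffAt_meanField (hx : x ∈ U) : ContDiffAt ℝ ∞ (meanField J G u) x := by
  have hinv : ContDiffAt ℝ ∞ (fun y => (inducedMetric G u y).inverse) x :=
    ContDiffAt.comp x (h.isMetricOn_inducedMetric.isInvertible hx).contDiffAt_map_inverse
      (h.contDiffAt_inducedMetric hx)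
  exact (hinv.clm_apply (contDiffAt_const.clm_comp (h.contDiffAt_shape hx))).const_smul (1 / 2 : ℝ)

/-- Covariant derivatives commute with the trace: `tr (∇_X A)(Z, ·) = 2 γ(∇_X η, Z)`. -/
theorem trace_shapeDerivCLM (hx : x ∈ U) (X Z : F) :
    traceCLM F (shapeDerivCLM J G u x X Z)
      = 2 * inducedMetric G u x (leviCivita (inducedMetric G u) (meanField J G u) x X) Z := by
  have e : (fun y => inducedMetric G u y (meanField J G u y) Z) =ᶠ[𝓝 x]
      fun y => 1 / 2 * traceCLM F (shape J G u y Z) := by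
    filter_upwards [h.isOpen.mem_nhds hx] with y hy
    rw [← h.inner_meanField hy]
    ring
  have dη := (h.contDiffAt_meanField hx).differentiableAt (by simp)
  have dA := ((h.contDiffAt_shape hx).differentiableAt (by simp)).hasFDerivAt
  have r := congrArg (fun L : F →L[ℝ] ℝ => L X) e.fderiv_eq
  have d2 := (((traceCLM F).hasFDerivAt.comp x
    (dA.clm_apply (hasFDerivAt_const Z x))).const_mul (1 / 2 : ℝ)).fderiv
  simp only [Function.comp_def] at d2
  rw [h.fderiv_inner hx dη (differentiableAt_const Z) X, d2] at r
  simp [leviCivita_eq] at r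
  have t := h.inner_meanField hx (christoffelCLM (inducedMetric G u) x X Z)
  have c := traceCLM_comp_comm (christoffelCLM (inducedMetric G u) x X) (shape J G u x Z)
  have e2 : shapeDerivCLM J G u x X Z = fderiv ℝ (shape J G u) x X Z
      + (christoffelCLM (inducedMetric G u) x X).comp (shape J G u x Z)
      - shape J G u x (christoffelCLM (inducedMetric G u) x X Z)
      - (shape J G u x Z).comp (christoffelCLM (inducedMetric G u) x X) := by
    simp [shapeDerivCLM]
  rw [e2, map_sub, map_sub, map_add, c, ← t, leviCivita_eq, map_add, add_apply]
  linarith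

variable (hF : Module.finrank ℝ F = 2) {ε : ℝ}
  (hc : ∀ z ∈ V, ∀ X, G z (curvature G z X (J X) (J X)) X = 4 * ε * (G z X X) ^ 2)
  {k : ℝ} (hk : 0 < k)
  (hη : ∀ x ∈ U, inducedMetric G u x (meanField J G u x) (meanField J G u x) = k)
  (hdiv : ∀ x ∈ U, traceCLM F (leviCivitaCLM (inducedMetric G u) (meanField J G u) x) = 0)

include hF hk hη in
theorem exists_frame (hx : x ∈ U) :
    ∃ e, IsOrthoFrame (inducedMetric G u x) k (meanField J G u x) e :=
  exists_isOrthoFrame hF (h.isMetricOn_inducedMetric.symm x hx)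
    (h.isMetricOn_inducedMetric.pos x hx) hk (hη x hx)

include hF hc hk hη hdiv

/-- A closed and coclosed one-form of constant positive length on a surface is parallel. -/
theorem leviCivita_meanField (hx : x ∈ U) (X : F) :
    leviCivita (inducedMetric G u) (meanField J G u) x X = 0 := by
  obtain ⟨e, he⟩ := h.exists_frame hF hk hη hx
  have dη := (h.contDiffAt_meanField hx).differentiableAt (by simp)
  have sy := h.isMetricOn_inducedMetric.symm x hx
  rw [← leviCivitaCLM_apply, he.eq_zero_of_traceless (fun X Y => ?_) (hdiv x hx) fun X => ?_,
    zero_apply]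
  · have t1 := h.trace_shapeDerivCLM hx X Y
    have t2 := h.trace_shapeDerivCLM hx Y X
    have : shapeDerivCLM J G u x X Y = shapeDerivCLM J G u x Y X := by
      ext Z
      rw [h.shapeDerivCLM_apply hx, h.shapeDerivCLM_apply hx, h.shapeDeriv_codazzi hc hx]
    rw [this, t2] at t1
    rw [leviCivitaCLM_apply, leviCivitaCLM_apply]
    linarith
  · have e : (fun y => inducedMetric G u y (meanField J G u y) (meanField J G u y)) =ᶠ[𝓝 x]
        fun _ => k := by
      filter_upwards [h.isOpen.mem_nhds hx] with y hy using hη y hy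
    have r := congrArg (fun L : F →L[ℝ] ℝ => L X) e.fderiv_eq
    rw [h.fderiv_inner hx dη dη X, sy (meanField J G u x)] at r
    simp only [fderiv_fun_const, Pi.zero_apply, zero_apply] at r
    rw [leviCivitaCLM_apply]
    linarith

/-- The surface carries a parallel field, so it is flat, and the Gauss equation becomes algebraic in
`A`. -/
theorem isFlatCubic (hx : x ∈ U) :
    IsFlatCubic (inducedMetric G u x) ε k (meanField J G u x) (shape J G u x) where
  symm := h.shape_symm hx
  inner_symm := h.inner_shape_symm hx
  trace Z := (h.inner_meanField hx Z).symm
  gauss Y := by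
    have sy := h.isMetricOn_inducedMetric.symm x hx
    have g := h.gauss_of_parallel hc hx (fun y hy => h.contDiffAt_meanField hy)
      (fun y hy => h.leviCivita_meanField hF hc hk hη hdiv hy) (meanField J G u x) Y Y
    rw [hη x hx, sy (meanField J G u x) Y] at g
    have a := h.inner_shape_symm hx (meanField J G u x) (shape J G u x Y (meanField J G u x)) Y
    have b := h.inner_shape_symm hx Y (shape J G u x (meanField J G u x) (meanField J G u x)) Y
    rw [h.shape_symm hx Y (meanField J G u x)] at g a
    linarith

/-- The covariant derivative of the Gauss equation. -/
theorem gauss_deriv (hx : x ∈ U) (X Y : F) :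
    2 * inducedMetric G u x (shapeDeriv J G u x X (meanField J G u x) Y)
        (shape J G u x (meanField J G u x) Y)
      - inducedMetric G u x (shapeDeriv J G u x X Y Y)
        (shape J G u x (meanField J G u x) (meanField J G u x))
      - inducedMetric G u x (shape J G u x Y Y)
        (shapeDeriv J G u x X (meanField J G u x) (meanField J G u x)) = 0 := by
  set γ := inducedMetric G u with hγ
  set η := meanField J G u with hηd
  set A := shape J G u with hA
  set Y' := parallelExtension γ x Y
  have sy := h.isMetricOn_inducedMetric.symm x hx
  have cη : ContDiffAt ℝ ∞ η x := h.contDiffAt_meanField hx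
  have cY : ContDiffAt ℝ ∞ Y' x := (contDiff_parallelExtension γ x Y).contDiffAt
  have d : ∀ {f : F → F}, ContDiffAt ℝ ∞ f x → DifferentiableAt ℝ f x :=
    fun hf => hf.differentiableAt (by simp)
  have cA : ∀ {S T : F → F}, ContDiffAt ℝ ∞ S x → ContDiffAt ℝ ∞ T x →
      ContDiffAt ℝ ∞ (fun y => A y (S y) (T y)) x := h.contDiffAt_shape_apply hx
  have cγ : ∀ {S T : F → F}, ContDiffAt ℝ ∞ S x → ContDiffAt ℝ ∞ T x →
      DifferentiableAt ℝ (fun y => γ y (S y) (T y)) x := fun hS hT =>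
    (((h.contDiffAt_inducedMetric hx).clm_apply hS).clm_apply hT).differentiableAt (by simp)
  have pη : leviCivita γ η x X = 0 := h.leviCivita_meanField hF hc hk hη hdiv hx X
  have pY : leviCivita γ Y' x X = 0 := leviCivita_parallelExtension γ x Y X
  have vY : Y' x = Y := parallelExtension_self γ x Y
  have e : (fun y => ε * (γ y (Y' y) (η y) * γ y (Y' y) (η y) - k * γ y (Y' y) (Y' y))
      + γ y (A y (η y) (Y' y)) (A y (η y) (Y' y))
      - γ y (A y (Y' y) (Y' y)) (A y (η y) (η y))) =ᶠ[𝓝 x] fun _ => 0 := by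
    filter_upwards [h.isOpen.mem_nhds hx] with y hy
    have := (h.isFlatCubic hF hc hk hη hdiv hy).gauss (Y' y)
    rw [sq] at this
    exact this
  have r := congrArg (fun L : F →L[ℝ] ℝ => L X) e.fderiv_eq
  have f1 := (cγ cY cη).hasFDerivAt
  have f2 := (cγ cY cY).hasFDerivAt
  have f3 := (cγ (cA cη cY) (cA cη cY)).hasFDerivAt
  have f4 := (cγ (cA cY cY) (cA cη cη)).hasFDerivAt
  have D := (((((f1.mul f1).sub (f2.const_mul k)).const_mul ε).add f3).sub f4).fderiv
  have D' := (congrArg (fun L : F →L[ℝ] ℝ => L X) D).symm.trans r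
  simp only [fderiv_fun_const, Pi.zero_apply, zero_apply, add_apply, sub_apply, smul_apply,
    smul_eq_mul] at D'
  rw [h.fderiv_inner hx (d cY) (d cη), h.fderiv_inner hx (d cY) (d cY),
    h.fderiv_inner hx (d (cA cη cY)) (d (cA cη cY)),
    h.fderiv_inner hx (d (cA cY cY)) (d (cA cη cη)), h.leviCivita_shape hx (d cη) (d cY),
    h.leviCivita_shape hx (d cY) (d cY), h.leviCivita_shape hx (d cη) (d cη)] at D'
  rw [← hγ, ← hA, pη, pY, vY, sy (A x (η x) Y)] at D'
  simp only [map_zero, zero_apply, add_zero] at D'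
  linarith

/-- The tensor `A` is parallel. -/
theorem shapeDeriv_eq_zero (hx : x ∈ U) (X Y Z : F) : shapeDeriv J G u x X Y Z = 0 := by
  obtain ⟨e, he⟩ := h.exists_frame hF hk hη hx
  have pη := h.leviCivita_meanField hF hc hk hη hdiv hx
  by_cases hd : k + 2 * ε = 0
  · -- `A` is an algebraic expression in the parallel tensors `γ` and `η`.
    set Y' := parallelExtension (inducedMetric G u) x Y
    set Z' := parallelExtension (inducedMetric G u) x Z
    set η := meanField J G u
    have cY : ContDiffAt ℝ ∞ Y' x := (contDiff_parallelExtension _ x Y).contDiffAt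
    have cZ : ContDiffAt ℝ ∞ Z' x := (contDiff_parallelExtension _ x Z).contDiffAt
    have cη : ContDiffAt ℝ ∞ η x := h.contDiffAt_meanField hx
    have d : ∀ {f : F → F}, ContDiffAt ℝ ∞ f x → DifferentiableAt ℝ f x :=
      fun hf => hf.differentiableAt (by simp)
    have pY := leviCivita_parallelExtension (inducedMetric G u) x Y X
    have pZ := leviCivita_parallelExtension (inducedMetric G u) x Z X
    have vY : Y' x = Y := parallelExtension_self _ x Y
    have vZ : Z' x = Z := parallelExtension_self _ x Z
    have cγ : ∀ {S T : F → F}, ContDiffAt ℝ ∞ S x → ContDiffAt ℝ ∞ T x →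
        DifferentiableAt ℝ (fun y => inducedMetric G u y (S y) (T y)) x := fun hS hT =>
      (((h.contDiffAt_inducedMetric hx).clm_apply hS).clm_apply hT).differentiableAt (by simp)
    have ev : (fun y => shape J G u y (Y' y) (Z' y)) =ᶠ[𝓝 x] fun y => (1 / 2 : ℝ) •
        (inducedMetric G u y (η y) (Y' y) • Z' y + inducedMetric G u y (η y) (Z' y) • Y' y
          + inducedMetric G u y (Y' y) (Z' y) • η y) := by
      filter_upwards [h.isOpen.mem_nhds hx] with y hy
      obtain ⟨e', he'⟩ := h.exists_frame hF hk hη hy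
      exact (h.isFlatCubic hF hc hk hη hdiv hy).eq_of_degenerate he' hd
        (h.isMetricOn_inducedMetric.symm y hy) _ _
    have l := h.leviCivita_shape hx (d cY) (d cZ) X
    rw [pY, pZ, vY, vZ] at l
    simp only [map_zero, zero_apply, add_zero] at l
    rw [← l, leviCivita_eq, ev.fderiv_eq, ev.eq_of_nhds]
    have D := (((((cγ cη cY).hasFDerivAt.smul (d cZ).hasFDerivAt).add
      ((cγ cη cZ).hasFDerivAt.smul (d cY).hasFDerivAt)).add
      ((cγ cY cZ).hasFDerivAt.smul (d cη).hasFDerivAt)).const_smul (1 / 2 : ℝ)).fderiv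
    have D' := congrArg (fun L : F →L[ℝ] F => L X) D
    refine (congrArg (· + _) D').trans ?_
    simp only [add_apply, smul_apply, ContinuousLinearMap.smulRight_apply]
    rw [h.fderiv_inner hx (d cη) (d cY), h.fderiv_inner hx (d cη) (d cZ),
      h.fderiv_inner hx (d cY) (d cZ), pη, pY, pZ]
    have qη := pη X
    rw [leviCivita_eq] at pY pZ qη
    rw [eq_neg_of_add_eq_zero_left pY, eq_neg_of_add_eq_zero_left pZ,
      eq_neg_of_add_eq_zero_left qη]
    simp only [map_zero, zero_apply, add_zero, zero_smul, map_add, map_smul]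
    module
  · rw [← h.shapeDerivCLM_apply hx, (h.isFlatCubic hF hc hk hη hdiv hx).deriv_eq_zero he hd
      (B := shapeDerivCLM J G u x)]
    · rfl
    · intro X Y Z
      simp only [h.shapeDerivCLM_apply hx, h.shapeDeriv_codazzi hc hx X]
    · intro X Y Z
      simp only [h.shapeDerivCLM_apply hx]
      exact h.shapeDeriv_symm hx X Y Z
    · intro X Y Z W
      simp only [h.shapeDerivCLM_apply hx]
      exact h.inner_shapeDeriv_symm hx X Y Z W
    · intro X Z
      rw [h.trace_shapeDerivCLM hx, pη]
      simp
    · intro V Y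
      simp only [h.shapeDerivCLM_apply hx]
      exact h.gauss_deriv hF hc hk hη hdiv hx V Y

end IsLagrangianPatch

end MeanField

/-! ### Gram determinants in the coordinate plane -/

section Gram

/-- The Gram matrix of the standard basis in the inner product `γ`. -/
def gramMatrix (γ : R2 →L[ℝ] R2 →L[ℝ] ℝ) : Matrix (Fin 2) (Fin 2) ℝ :=
  Matrix.of fun i j => γ (stdVec i) (stdVec j)

theorem finrank_R2 : Module.finrank ℝ R2 = 2 := by simp [R2]

theorem eq_sum_stdVec (v : R2) : v = v 0 • stdVec 0 + v 1 • stdVec 1 := by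
  ext i
  fin_cases i <;> simp [stdVec]

theorem traceCLM_eq_coord (L : R2 →L[ℝ] R2) :
    traceCLM R2 L = L (stdVec 0) 0 + L (stdVec 1) 1 := by
  rw [traceCLM_eq_sum (Finset.univ : Finset (Fin 2))
    (fun i => (EuclideanSpace.proj i : R2 →L[ℝ] ℝ)) stdVec fun v => by
      rw [Fin.sum_univ_two]; exact eq_sum_stdVec v]
  simp

variable {γ : R2 →L[ℝ] R2 →L[ℝ] ℝ} (hs : ∀ X Y, γ X Y = γ Y X)

theorem det_gramMatrix (γ : R2 →L[ℝ] R2 →L[ℝ] ℝ) : (gramMatrix γ).det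
    = γ (stdVec 0) (stdVec 0) * γ (stdVec 1) (stdVec 1)
      - γ (stdVec 0) (stdVec 1) * γ (stdVec 1) (stdVec 0) := by
  rw [Matrix.det_fin_two]; rfl

include hs in
theorem det_gramMatrix_pos (hp : ∀ X, X ≠ 0 → 0 < γ X X) : 0 < (gramMatrix γ).det := by
  have h0 : 0 < γ (stdVec 0) (stdVec 0) := hp _ (by simp [stdVec])
  -- The square length of `γ₀₀ e₁ - γ₀₁ e₀` is `γ₀₀` times the determinant.
  have h1 := hp (γ (stdVec 0) (stdVec 0) • stdVec 1 - γ (stdVec 0) (stdVec 1) • stdVec 0)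
    (fun h => by
      have := congrArg (fun v : R2 => v 1) h
      simp [stdVec] at this
      exact h0.ne' (by simpa [stdVec] using this))
  rw [det_gramMatrix]
  simp only [map_sub, map_smul, sub_apply, smul_apply, smul_eq_mul,
    hs (stdVec 1) (stdVec 0)] at h1 ⊢
  nlinarith

/-- The derivative of the Gram determinant along an infinitesimal endomorphism `L`. -/
theorem det_gramMatrix_deriv (γ : R2 →L[ℝ] R2 →L[ℝ] ℝ) (L : R2 →L[ℝ] R2) {d : R2 → R2 → ℝ}
    (hd : ∀ X Y, d X Y = γ (L X) Y + γ X (L Y)) :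
    d (stdVec 0) (stdVec 0) * γ (stdVec 1) (stdVec 1)
      + γ (stdVec 0) (stdVec 0) * d (stdVec 1) (stdVec 1)
      - (d (stdVec 0) (stdVec 1) * γ (stdVec 1) (stdVec 0)
        + γ (stdVec 0) (stdVec 1) * d (stdVec 1) (stdVec 0))
      = 2 * (gramMatrix γ).det * traceCLM R2 L := by
  rw [det_gramMatrix, traceCLM_eq_coord]
  simp only [hd]
  rw [eq_sum_stdVec (L (stdVec 0)), eq_sum_stdVec (L (stdVec 1))]
  simp [stdVec]
  ring

include hs in
theorem traceCLM_eq_gram (hp : ∀ X, X ≠ 0 → 0 < γ X X) (L : R2 →L[ℝ] R2) :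
    traceCLM R2 L = ∑ i, ∑ j, (gramMatrix γ)⁻¹ i j * γ (L (stdVec i)) (stdVec j) := by
  have hdet := (det_gramMatrix_pos hs hp).ne'
  rw [traceCLM_eq_sum (Finset.univ : Finset (Fin 2))
    (fun i => ∑ j, (gramMatrix γ)⁻¹ i j • γ.flip (stdVec j)) stdVec fun v => ?_]
  · simp
  · rw [Fin.sum_univ_two]
    conv_rhs => rw [eq_sum_stdVec v]
    rw [Matrix.inv_def, Matrix.adjugate_fin_two, Ring.inverse_eq_inv']
    have e := det_gramMatrix γ
    set D := (gramMatrix γ).det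
    conv_lhs => rw [eq_sum_stdVec v]
    simp [gramMatrix, Fin.sum_univ_two]
    congr 2
    · field_simp
      rw [e, hs (stdVec 1) (stdVec 0)]
      ring
    · field_simp
      rw [e, hs (stdVec 1) (stdVec 0)]
      ring

end Gram

section MeanCurvature

variable {J : C2 →L[ℝ] C2} {G : C2 → C2 →L[ℝ] C2 →L[ℝ] ℝ} {V : Set C2} {u : R2 → C2} {U : Set R2}
  (h : IsLagrangianPatch J G V u U) {x : R2}

namespace IsLagrangianPatch

include h

theorem meanCurvatureVector_eq (hx : x ∈ U) :
    meanCurvatureVector G u x = J (fderiv ℝ u x (meanField J G u x)) := by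
  have sy := h.isMetricOn_inducedMetric.symm x hx
  have e : meanField J G u x = (1 / 2 : ℝ) • ∑ i, ∑ j,
      ((gramMatrix (inducedMetric G u x))⁻¹ i j) • shape J G u x (stdVec i) (stdVec j) := by
    refine h.isMetricOn_inducedMetric.ext_inner hx fun Z => ?_
    have t := h.inner_meanField hx Z
    rw [traceCLM_eq_gram sy (h.isMetricOn_inducedMetric.pos x hx)] at t
    simp only [map_smul, map_sum, smul_apply, sum_apply, smul_eq_mul]
    have s : ∀ i j : Fin 2, inducedMetric G u x (shape J G u x (stdVec i) (stdVec j)) Z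
        = inducedMetric G u x (shape J G u x Z (stdVec i)) (stdVec j) := fun i j => by
      rw [h.inner_shape_symm hx, h.shape_symm hx]
    simp only [s, ← t]
    ring
  rw [meanCurvatureVector, e]
  simp only [map_smul, map_sum, h.secondFundamentalForm_eq hx]
  rfl

theorem inner_meanCurvatureVector (hx : x ∈ U) :
    G (u x) (meanCurvatureVector G u x) (meanCurvatureVector G u x)
      = inducedMetric G u x (meanField J G u x) (meanField J G u x) := by
  rw [h.meanCurvatureVector_eq hx, h.kaehler.hermitian _ (h.mapsTo x hx)]
  rfl

/-! ### First variation of the area density -/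

/-- The logarithmic derivative of the area density is the trace of the connection. -/
theorem fderiv_sqrt_det (hx : x ∈ U) (X : R2) :
    fderiv ℝ (fun y => √(gramMatrix (inducedMetric G u y)).det) x X
      = √(gramMatrix (inducedMetric G u x)).det
        * traceCLM R2 (christoffelCLM (inducedMetric G u) x X) := by
  have hM := h.isMetricOn_inducedMetric
  have hpos := det_gramMatrix_pos (hM.symm x hx) (hM.pos x hx)
  have hγ := ((h.contDiffAt_inducedMetric hx).differentiableAt (by simp)).hasFDerivAt
  have hc : ∀ A B : R2, HasFDerivAt (fun y => inducedMetric G u y A B)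
      (fderiv ℝ (fun y => inducedMetric G u y A B) x) x := fun A B =>
    ((hγ.clm_apply (hasFDerivAt_const A x)).clm_apply
      (hasFDerivAt_const B x)).differentiableAt.hasFDerivAt
  have hd : ∀ A B : R2, fderiv ℝ (fun y => inducedMetric G u y A B) x X
      = inducedMetric G u x (christoffelCLM (inducedMetric G u) x X A) B
        + inducedMetric G u x A (christoffelCLM (inducedMetric G u) x X B) := by
    intro A B
    rw [h.fderiv_inner hx (differentiableAt_const A) (differentiableAt_const B) X]
    simp [leviCivita_eq]
  have D := ((hc (stdVec 0) (stdVec 0)).mul (hc (stdVec 1) (stdVec 1))).sub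
    ((hc (stdVec 0) (stdVec 1)).mul (hc (stdVec 1) (stdVec 0)))
  have D2 := D.sqrt (by simpa [det_gramMatrix] using hpos.ne')
  have k := det_gramMatrix_deriv (inducedMetric G u x)
    (christoffelCLM (inducedMetric G u) x X) hd
  have e : (fun y => √(gramMatrix (inducedMetric G u y)).det) = fun y =>
      √(((fun y => inducedMetric G u y (stdVec 0) (stdVec 0))
        * (fun y => inducedMetric G u y (stdVec 1) (stdVec 1))
        - (fun y => inducedMetric G u y (stdVec 0) (stdVec 1))
        * (fun y => inducedMetric G u y (stdVec 1) (stdVec 0))) y) := by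
    ext y
    rw [det_gramMatrix]
    rfl
  rw [e, D2.fderiv]
  simp only [Pi.sub_apply, Pi.mul_apply, smul_apply, sub_apply, add_apply, smul_eq_mul,
    ← det_gramMatrix] at k ⊢
  have hsq := Real.sqrt_pos.2 hpos
  have hss := Real.mul_self_sqrt hpos.le
  field_simp
  rw [sq, hss]
  linarith

/-- The first variation of the area density in the direction of the normal field `J du T`. -/
theorem hasDerivAt_sqrt_det (hx : x ∈ U) {T : R2 → R2} (hT : ContDiffAt ℝ ∞ T x) :
    HasDerivAt (fun t : ℝ => √(gramMatrix (inducedMetric G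
        (fun y => u y + t • J (fderiv ℝ u y (T y))) x)).det)
      (-(2 * √(gramMatrix (inducedMetric G u x)).det
        * inducedMetric G u x (meanField J G u x) (T x))) 0 := by
  have hM := h.isMetricOn_inducedMetric
  have hz := h.mapsTo x hx
  have sy := hM.symm x hx
  have hpos := det_gramMatrix_pos (hM.symm x hx) (hM.pos x hx)
  set ξ : R2 → C2 := fun y => J (fderiv ℝ u y (T y)) with hξ
  have cξ : DifferentiableAt ℝ ξ x := (J.contDiff.contDiffAt.comp x
    ((h.contDiffAt_fderiv hx).clm_apply hT)).differentiableAt (n := ∞) (by simp)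
  have hu := (h.smooth x hx).differentiableAt (by simp)
  let c : ℝ → C2 := fun t => u x + t • ξ x
  let ζ : R2 → ℝ → C2 := fun A t => fderiv ℝ u x A + t • fderiv ℝ ξ x A
  have dc : HasFDerivAt c ((ContinuousLinearMap.id ℝ ℝ).smulRight (ξ x)) 0 :=
    ((hasFDerivAt_id (𝕜 := ℝ) (0 : ℝ)).smul_const (ξ x)).const_add (u x)
  have dζ : ∀ A, HasFDerivAt (ζ A) ((ContinuousLinearMap.id ℝ ℝ).smulRight (fderiv ℝ ξ x A)) 0 :=
    fun A => ((hasFDerivAt_id (𝕜 := ℝ) (0 : ℝ)).smul_const (fderiv ℝ ξ x A)).const_add _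
  have c0 : c 0 = u x := by simp [c]
  have ζ0 : ∀ A, ζ A 0 = fderiv ℝ u x A := fun A => by simp [ζ]
  -- The covariant derivative of `∂w/∂x` in `t` is that of `ξ = ∂w/∂t` in `x`.
  have cov : ∀ A, covariantAlong G c (ζ A) 0 1
      = J (fderiv ℝ u x (leviCivita (inducedMetric G u) T x A))
        - fderiv ℝ u x (shape J G u x A (T x)) := by
    intro A
    have : covariantAlong G c (ζ A) 0 1 = covariantAlong G u ξ x A := by
      rw [covariantAlong, covariantAlong, (dζ A).fderiv, dc.fderiv, c0, ζ0,
        h.kaehler.christoffel_symm hz]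
      simp
    rw [this, h.covariantAlong_J hx (((h.contDiffAt_fderiv hx).clm_apply hT).differentiableAt
      (by simp)), h.covariantAlong_tangent hx (hT.differentiableAt (by simp)), map_add,
      h.kaehler.sq]
    abel
  have m : ∀ (t : ℝ) (A B : R2), inducedMetric G
      (fun y => u y + t • J (fderiv ℝ u y (T y))) x A B
      = G (c t) (ζ A t) (ζ B t) := by
    intro t A B
    have := (hu.hasFDerivAt.add (cξ.hasFDerivAt.const_smul t)).fderiv
    rw [inducedMetric_apply]
    have e : fderiv ℝ (fun y => u y + t • J (fderiv ℝ u y (T y))) x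
        = fderiv ℝ u x + t • fderiv ℝ ξ x := this
    rw [e]
    rfl
  have hG : DifferentiableAt ℝ (fun t => G (c t)) 0 := by
    refine DifferentiableAt.comp (g := G) (0 : ℝ) ?_ dc.differentiableAt
    rw [c0]
    exact (h.kaehler.contDiffAt hz).differentiableAt (by simp)
  have hm : ∀ A B, HasDerivAt (fun t => G (c t) (ζ A t) (ζ B t))
      (inducedMetric G u x (-(shape J G u x (T x) A)) B
        + inducedMetric G u x A (-(shape J G u x (T x) B))) 0 := by
    intro A B
    have d := ((hG.clm_apply (dζ A).differentiableAt).clm_apply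
      (dζ B).differentiableAt).hasFDerivAt.hasDerivAt
    have e := fderiv_inner_along h.kaehler.toIsMetricOn dc.differentiableAt (by rw [c0]; exact hz)
      (dζ A).differentiableAt (dζ B).differentiableAt 1
    rw [e, c0, ζ0, ζ0, cov, cov] at d
    refine d.congr_deriv ?_
    simp only [map_sub, sub_apply, map_neg, neg_apply, h.lagrangian x hx,
      h.kaehler.inner_J_left hz, ← inducedMetric_apply, h.shape_symm hx _ (T x)]
    ring
  have D := ((hm (stdVec 0) (stdVec 0)).mul (hm (stdVec 1) (stdVec 1))).sub
    ((hm (stdVec 0) (stdVec 1)).mul (hm (stdVec 1) (stdVec 0)))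
  have k := det_gramMatrix_deriv (inducedMetric G u x) (-(shape J G u x (T x))) (fun X Y => rfl)
  have D2 := D.sqrt (by
    change G (c 0) (ζ (stdVec 0) 0) (ζ (stdVec 0) 0) * G (c 0) (ζ (stdVec 1) 0) (ζ (stdVec 1) 0)
      - G (c 0) (ζ (stdVec 0) 0) (ζ (stdVec 1) 0) * G (c 0) (ζ (stdVec 1) 0) (ζ (stdVec 0) 0) ≠ 0
    rw [c0, ζ0, ζ0, ← inducedMetric_apply, ← inducedMetric_apply, ← inducedMetric_apply,
      ← inducedMetric_apply, ← det_gramMatrix]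
    exact hpos.ne')
  have e : (fun t : ℝ => √(gramMatrix (inducedMetric G
        (fun y => u y + t • J (fderiv ℝ u y (T y))) x)).det) = fun t =>
      √(((fun t => G (c t) (ζ (stdVec 0) t) (ζ (stdVec 0) t))
        * (fun t => G (c t) (ζ (stdVec 1) t) (ζ (stdVec 1) t))
        - (fun t => G (c t) (ζ (stdVec 0) t) (ζ (stdVec 1) t))
        * (fun t => G (c t) (ζ (stdVec 1) t) (ζ (stdVec 0) t))) t) := by
    ext t
    rw [det_gramMatrix]
    simp only [m, Pi.sub_apply, Pi.mul_apply]
  rw [e]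
  refine D2.congr_deriv ?_
  simp only [Pi.sub_apply, Pi.mul_apply, c0, ζ0, ← inducedMetric_apply] at k ⊢
  rw [map_neg, ← h.inner_meanField hx] at k
  rw [← det_gramMatrix]
  have hsq := Real.sqrt_pos.2 hpos
  have hss := Real.mul_self_sqrt hpos.le
  simp only [neg_apply] at k
  rw [div_eq_iff (by positivity)]
  linear_combination k + 4 * inducedMetric G u x (meanField J G u x) (T x) * hss

end IsLagrangianPatch

end MeanCurvature

/-! ### Integrals depending on a parameter and integration by parts -/

section Integrals

theorem continuous_mul_of_tsupport {X : Type*} [TopologicalSpace X] {ρ f : X → ℝ}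
    (hρ : Continuous ρ) (hf : ∀ x ∈ tsupport ρ, ContinuousAt f x) :
    Continuous (fun x => ρ x * f x) :=
  continuous_of_tsupport fun x hx =>
    hρ.continuousAt.mul (hf x (tsupport_mul_subset_left hx))

/-- Differentiation under the integral sign, for the product of a compactly supported function with
a function which is `C¹` near the support at time `0`. -/
theorem hasDerivAt_integral_mul {X : Type*} [NormedAddCommGroup X] [NormedSpace ℝ X]
    [MeasurableSpace X] [BorelSpace X] {μ : Measure X} [IsFiniteMeasureOnCompacts μ]
    {ρ : X → ℝ} (hρ : Continuous ρ) (hc : HasCompactSupport ρ) {S : ℝ × X → ℝ}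
    (hS : ∀ x ∈ tsupport ρ, ContDiffAt ℝ 1 S (0, x)) :
    HasDerivAt (fun t => ∫ x, ρ x * S (t, x) ∂μ) (∫ x, ρ x * fderiv ℝ S (0, x) (1, 0) ∂μ) 0 := by
  set Ω : Set (ℝ × X) := {q | ContDiffAt ℝ 1 S q} with hΩd
  have hΩ : IsOpen Ω := isOpen_iff_mem_nhds.2 fun q hq =>
    ContDiffAt.eventually (show ContDiffAt ℝ 1 S q from hq) (by simp)
  obtain ⟨A, B, hA, hB, h0A, hB', hAB⟩ := generalized_tube_lemma (s := {(0 : ℝ)})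
    isCompact_singleton hc.isCompact hΩ (by
      rintro ⟨t, x⟩ ⟨ht, hx⟩
      obtain rfl : t = 0 := ht
      exact hS x hx)
  obtain ⟨δ, hδ, hδA⟩ := Metric.nhds_basis_closedBall.mem_iff.1
    (hA.mem_nhds (h0A (mem_singleton 0)))
  have mem : ∀ t ∈ Metric.closedBall (0 : ℝ) δ, ∀ x ∈ tsupport ρ, ContDiffAt ℝ 1 S (t, x) :=
    fun t ht x hx => hAB ⟨hδA ht, hB' hx⟩
  have cont' : ∀ q ∈ Ω, ContinuousAt (fun q => fderiv ℝ S q (1, 0)) q := fun q hq =>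
    ((ContDiffAt.fderiv_right (m := 0) (show ContDiffAt ℝ 1 S q from hq) (by simp)).clm_apply
      contDiffAt_const).continuousAt
  obtain ⟨C, hC⟩ :=
    ((isCompact_closedBall (0 : ℝ) δ).prod hc.isCompact).exists_bound_of_continuousOn
    (f := fun q => fderiv ℝ S q (1, 0)) fun q hq =>
      (cont' q (mem q.1 hq.1 q.2 hq.2)).continuousWithinAt
  have cF : ∀ t ∈ Metric.closedBall (0 : ℝ) δ, Continuous fun x => ρ x * S (t, x) := fun t ht =>
    continuous_mul_of_tsupport hρ fun x hx =>
      (mem t ht x hx).continuousAt.comp (f := fun x => (t, x)) (by fun_prop)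
  have cF' : Continuous fun x => ρ x * fderiv ℝ S (0, x) (1, 0) :=
    continuous_mul_of_tsupport hρ fun x hx =>
      (cont' (0, x) (hS x hx)).comp (f := fun x => ((0 : ℝ), x)) (by fun_prop)
  have cs : ∀ f : X → ℝ, HasCompactSupport fun x => ρ x * f x := fun f => hc.mul_right
  refine (hasDerivAt_integral_of_dominated_loc_of_deriv_le (μ := μ)
    (F := fun t x => ρ x * S (t, x)) (F' := fun t x => ρ x * fderiv ℝ S (t, x) (1, 0))
    (bound := fun x => |ρ x| * C) (Metric.closedBall_mem_nhds (0 : ℝ) hδ) ?_ ?_ ?_ ?_ ?_ ?_).2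
  · filter_upwards [Metric.closedBall_mem_nhds (0 : ℝ) hδ] with t ht
    exact ((cF t ht).integrable_of_hasCompactSupport (cs _)).aestronglyMeasurable
  · exact (cF 0 (Metric.mem_closedBall_self hδ.le)).integrable_of_hasCompactSupport (cs _)
  · exact (cF'.integrable_of_hasCompactSupport (cs _)).aestronglyMeasurable
  · refine ae_of_all _ fun x t ht => ?_
    by_cases hx : x ∈ tsupport ρ
    · rw [norm_mul, Real.norm_eq_abs]
      exact mul_le_mul_of_nonneg_left (hC (t, x) ⟨ht, hx⟩) (abs_nonneg _)
    · simp [image_eq_zero_of_notMem_tsupport hx]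
  · exact ((hρ.abs.integrable_of_hasCompactSupport hc.abs).mul_const C)
  · refine ae_of_all _ fun x t ht => ?_
    by_cases hx : x ∈ tsupport ρ
    · have h1 := ((mem t ht x hx).differentiableAt (by simp)).hasFDerivAt
      have h2 : HasDerivAt (fun t : ℝ => (t, x)) (1, 0) t :=
        (hasDerivAt_id t).prodMk (hasDerivAt_const t x)
      exact (h1.comp_hasDerivAt t h2).const_mul (ρ x)
    · simp only [image_eq_zero_of_notMem_tsupport hx, zero_mul]
      exact hasDerivAt_const t 0

/-- Integration by parts against a test function `φ`. -/
theorem integral_trace_fderiv {W : R2 → R2} {φ : R2 → ℝ} (hφ : ContDiff ℝ ∞ φ)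
    (hc : HasCompactSupport φ) (hW : ∀ x ∈ tsupport φ, ContDiffAt ℝ ∞ W x) :
    ∫ x, φ x * traceCLM R2 (fderiv ℝ W x) = -∫ x, fderiv ℝ φ x (W x) := by
  have cZ : ContDiff ℝ ∞ fun x => φ x • W x := by
    refine contDiff_iff_contDiffAt.2 fun x => ?_
    by_cases hx : x ∈ tsupport φ
    · exact hφ.contDiffAt.smul (hW x hx)
    · refine (contDiffAt_const (c := (0 : R2))).congr_of_eventuallyEq ?_
      filter_upwards [(isClosed_tsupport φ).isOpen_compl.mem_nhds hx] with y hy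
      rw [image_eq_zero_of_notMem_tsupport hy, zero_smul]
  have sZ : HasCompactSupport fun x => φ x • W x := hc.smul_right
  have cD : Continuous (fderiv ℝ fun x => φ x • W x) := cZ.continuous_fderiv (by simp)
  have sD := sZ.fderiv (𝕜 := ℝ)
  have coord : ∀ i : Fin 2, ∫ x, fderiv ℝ (fun x => φ x • W x) x (stdVec i) i = 0 := by
    intro i
    have dZ : Differentiable ℝ fun x => (φ x • W x) i := by
      have : Differentiable ℝ fun x => φ x • W x := cZ.differentiable (by simp)
      exact (EuclideanSpace.proj (𝕜 := ℝ) i).differentiable.comp this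
    have e : ∀ x, fderiv ℝ (fun x => (φ x • W x) i) x (stdVec i)
        = fderiv ℝ (fun x => φ x • W x) x (stdVec i) i := by
      intro x
      have d := ((cZ.differentiable (by simp)) x).hasFDerivAt
      have := ((EuclideanSpace.proj (𝕜 := ℝ) i).hasFDerivAt.comp x d).fderiv
      simp only [Function.comp_def] at this
      exact congrArg (fun L : R2 →L[ℝ] ℝ => L (stdVec i)) this
    have c1 : Continuous fun x => fderiv ℝ (fun x => (φ x • W x) i) x (stdVec i) := by
      simp only [e]
      exact (EuclideanSpace.proj (𝕜 := ℝ) i).continuous.comp (cD.clm_apply continuous_const)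
    have s0 : HasCompactSupport fun x => (φ x • W x) i :=
      sZ.comp_left (g := fun v : R2 => v i) rfl
    have i1 : Integrable fun x => fderiv ℝ (fun x => (φ x • W x) i) x (stdVec i) :=
      c1.integrable_of_hasCompactSupport (s0.fderiv_apply (𝕜 := ℝ) _)
    have i0 : Integrable fun x => (φ x • W x) i :=
      dZ.continuous.integrable_of_hasCompactSupport s0
    have := integral_mul_fderiv_eq_neg_fderiv_mul_of_integrable (μ := volume) (v := stdVec i)
      (f := fun _ : R2 => (1 : ℝ)) (g := fun x => (φ x • W x) i) (by simp) (by simpa using i1)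
      (by simpa using i0) (fun x _ => differentiableAt_const _)
      fun x _ => dZ x
    simp only [e] at this
    simpa using this
  have ci : ∀ i : Fin 2, Integrable fun x => fderiv ℝ (fun x => φ x • W x) x (stdVec i) i := by
    intro i
    refine Continuous.integrable_of_hasCompactSupport
      ((EuclideanSpace.proj (𝕜 := ℝ) i).continuous.comp (cD.clm_apply continuous_const)) ?_
    exact sD.comp_left (g := fun L : R2 →L[ℝ] R2 => L (stdVec i) i) rfl
  have tot : ∫ x, traceCLM R2 (fderiv ℝ (fun x => φ x • W x) x) = 0 := by
    simp only [traceCLM_eq_coord]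
    rw [integral_add (ci 0) (ci 1), coord, coord, add_zero]
  have split : ∀ x, traceCLM R2 (fderiv ℝ (fun x => φ x • W x) x)
      = φ x * traceCLM R2 (fderiv ℝ W x) + fderiv ℝ φ x (W x) := by
    intro x
    by_cases hx : x ∈ tsupport φ
    · have d := (hφ.differentiable (by simp) x).hasFDerivAt.smul
        ((hW x hx).differentiableAt (by simp)).hasFDerivAt
      have e : fderiv ℝ (fun x => φ x • W x) x = _ := d.fderiv
      rw [e, map_add, map_smul, smul_eq_mul, traceCLM_apply (ContinuousLinearMap.smulRight _ _)]
      congr 1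
      exact LinearMap.trace_smulRight _ _
    · have e : (fun x => φ x • W x) =ᶠ[𝓝 x] fun _ => 0 := by
        filter_upwards [(isClosed_tsupport φ).isOpen_compl.mem_nhds hx] with y hy
        rw [image_eq_zero_of_notMem_tsupport hy, zero_smul]
      have e' : φ =ᶠ[𝓝 x] fun _ => 0 := by
        filter_upwards [(isClosed_tsupport φ).isOpen_compl.mem_nhds hx] with y hy
        rw [image_eq_zero_of_notMem_tsupport hy]
      rw [e.fderiv_eq, e'.fderiv_eq, e'.eq_of_nhds]
      simp
  have I1 : Integrable fun x => φ x * traceCLM R2 (fderiv ℝ W x) := by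
    refine (continuous_mul_of_tsupport hφ.continuous fun x hx => ?_).integrable_of_hasCompactSupport
      hc.mul_right
    exact (traceCLM R2).continuous.continuousAt.comp
      ((hW x hx).fderiv_right (m := ∞) (by simp)).continuousAt
  have I2 : Integrable fun x => fderiv ℝ φ x (W x) := by
    have : (fun x => fderiv ℝ φ x (W x)) = fun x =>
        traceCLM R2 (fderiv ℝ (fun x => φ x • W x) x) - φ x * traceCLM R2 (fderiv ℝ W x) := by
      ext x; rw [split]; ring
    rw [this]
    refine Integrable.sub ?_ I1
    simp only [traceCLM_eq_coord]
    exact (ci 0).add (ci 1)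
  simp only [split] at tot
  rw [integral_add I1 I2] at tot
  linarith

end Integrals

/-! ### The Euler-Lagrange equation of the area under Hamiltonian variations -/

section EulerLagrange

/-- The gradient of `φ` in the metric `γ`. -/
def gradient (γ : R2 → R2 →L[ℝ] R2 →L[ℝ] ℝ) (φ : R2 → ℝ) (x : R2) : R2 :=
  (γ x).inverse (fderiv ℝ φ x)

variable {J : C2 →L[ℝ] C2} {G : C2 → C2 →L[ℝ] C2 →L[ℝ] ℝ} {V : Set C2} {u : R2 → C2} {U : Set R2}

/-- The Hamiltonian field `J ∇φ` along `u`. -/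
def hamiltonianField (J : C2 →L[ℝ] C2) (G : C2 → C2 →L[ℝ] C2 →L[ℝ] ℝ) (u : R2 → C2) (φ : R2 → ℝ)
    (x : R2) : C2 :=
  J (fderiv ℝ u x (gradient (inducedMetric G u) φ x))

theorem hamiltonianField_eq_zero {φ : R2 → ℝ} {x : R2} (hx : x ∉ tsupport φ) :
    hamiltonianField J G u φ x = 0 := by
  have e' : φ =ᶠ[𝓝 x] fun _ => 0 := by
    filter_upwards [(isClosed_tsupport φ).isOpen_compl.mem_nhds hx] with y hy
    rw [image_eq_zero_of_notMem_tsupport hy]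
  rw [hamiltonianField, gradient, e'.fderiv_eq]
  simp

namespace IsLagrangianPatch

variable (h : IsLagrangianPatch J G V u U)
include h

theorem contDiffAt_gradient {φ : R2 → ℝ} (hφ : ContDiff ℝ ∞ φ) {x : R2} (hx : x ∈ U) :
    ContDiffAt ℝ ∞ (gradient (inducedMetric G u) φ) x := by
  have hinv : ContDiffAt ℝ ∞ (fun y => (inducedMetric G u y).inverse) x :=
    ContDiffAt.comp x (h.isMetricOn_inducedMetric.isInvertible hx).contDiffAt_map_inverse
      (h.contDiffAt_inducedMetric hx)
  exact hinv.clm_apply (hφ.contDiffAt.fderiv_right (by simp))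

theorem contDiff_hamiltonianField {φ : R2 → ℝ} (hφ : ContDiff ℝ ∞ φ) (hU : tsupport φ ⊆ U) :
    ContDiff ℝ ∞ (hamiltonianField J G u φ) := by
  refine contDiff_iff_contDiffAt.2 fun x => ?_
  by_cases hx : x ∈ tsupport φ
  · exact J.contDiff.contDiffAt.comp x
      ((h.contDiffAt_fderiv (hU hx)).clm_apply (h.contDiffAt_gradient hφ (hU hx)))
  · refine (contDiffAt_const (c := (0 : C2))).congr_of_eventuallyEq ?_
    filter_upwards [(isClosed_tsupport φ).isOpen_compl.mem_nhds hx] with y hy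
    exact hamiltonianField_eq_zero hy

/-- The first variation of the area under the Hamiltonian variation `J ∇φ`. -/
theorem hasDerivAt_area {φ ρ : R2 → ℝ} (hφ : ContDiff ℝ ∞ φ) (hφU : tsupport φ ⊆ U)
    (hρ : Continuous ρ) (hρc : HasCompactSupport ρ) (hρU : tsupport ρ ⊆ U)
    (hρφ : ∀ x ∈ tsupport φ, ρ x = 1) :
    HasDerivAt (fun t : ℝ => ∫ x, ρ x * √(gramMatrix (inducedMetric G
        (fun y => u y + t • hamiltonianField J G u φ y) x)).det)
      (∫ x, -(2 * (√(gramMatrix (inducedMetric G u x)).det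
        * fderiv ℝ φ x (meanField J G u x)))) 0 := by
  set ξ := hamiltonianField J G u φ with hξ
  have cξ : ContDiff ℝ ∞ ξ := h.contDiff_hamiltonianField hφ hφU
  set S : ℝ × R2 → ℝ := fun q =>
    √(gramMatrix (inducedMetric G (fun y => u y + q.1 • ξ y) q.2)).det with hS
  have hM := h.isMetricOn_inducedMetric
  have smooth : ∀ x ∈ U, ContDiffAt ℝ 1 S (0, x) := by
    intro x hx
    have hz := h.mapsTo x hx
    let m : R2 → R2 → ℝ × R2 → ℝ := fun A B q => G (u q.2 + q.1 • ξ q.2)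
      (fderiv ℝ u q.2 A + q.1 • fderiv ℝ ξ q.2 A) (fderiv ℝ u q.2 B + q.1 • fderiv ℝ ξ q.2 B)
    have cm : ∀ A B, ContDiffAt ℝ ∞ (m A B) (0, x) := by
      intro A B
      have c2 : ContDiffAt ℝ ∞ (Prod.snd : ℝ × R2 → R2) (0, x) := contDiffAt_snd
      have c1 : ContDiffAt ℝ ∞ (Prod.fst : ℝ × R2 → ℝ) (0, x) := contDiffAt_fst
      have cu : ContDiffAt ℝ ∞ (fun q : ℝ × R2 => u q.2) (0, x) :=
        ContDiffAt.comp (0, x) (f := Prod.snd) (h.smooth x hx) c2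
      have cdu : ContDiffAt ℝ ∞ (fun q : ℝ × R2 => fderiv ℝ u q.2) (0, x) :=
        ContDiffAt.comp (0, x) (f := Prod.snd) (h.contDiffAt_fderiv hx) c2
      have cxi : ContDiffAt ℝ ∞ (fun q : ℝ × R2 => ξ q.2) (0, x) :=
        ContDiffAt.comp (0, x) (f := Prod.snd) cξ.contDiffAt c2
      have cdxi : ContDiffAt ℝ ∞ (fun q : ℝ × R2 => fderiv ℝ ξ q.2) (0, x) :=
        ContDiffAt.comp (0, x) (f := Prod.snd) (cξ.contDiffAt.fderiv_right (by simp)) c2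
      have cG : ContDiffAt ℝ ∞ (fun q : ℝ × R2 => G (u q.2 + q.1 • ξ q.2)) (0, x) := by
        refine ContDiffAt.comp (0, x) (g := G) (f := fun q : ℝ × R2 => u q.2 + q.1 • ξ q.2) ?_
          (cu.add (c1.smul cxi))
        simpa using h.kaehler.contDiffAt hz
      have cA : ∀ A, ContDiffAt ℝ ∞ (fun q : ℝ × R2 =>
          fderiv ℝ u q.2 A + q.1 • fderiv ℝ ξ q.2 A) (0, x) := fun A =>
        (cdu.clm_apply contDiffAt_const).add (c1.smul (cdxi.clm_apply contDiffAt_const))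
      exact (cG.clm_apply (cA A)).clm_apply (cA B)
    have ev : S =ᶠ[𝓝 (0, x)] fun q => √(m (stdVec 0) (stdVec 0) q * m (stdVec 1) (stdVec 1) q
        - m (stdVec 0) (stdVec 1) q * m (stdVec 1) (stdVec 0) q) := by
      filter_upwards [(h.isOpen.preimage continuous_snd).mem_nhds
        (show ((0 : ℝ), x) ∈ Prod.snd ⁻¹' U from hx)] with q hq
      have e : fderiv ℝ (fun y => u y + q.1 • ξ y) q.2 = fderiv ℝ u q.2 + q.1 • fderiv ℝ ξ q.2 :=
        (((h.smooth q.2 hq).differentiableAt (by simp)).hasFDerivAt.add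
          ((cξ.differentiable (by simp) q.2).hasFDerivAt.const_smul q.1)).fderiv
      simp only [hS, det_gramMatrix, inducedMetric_apply, e]
      rfl
    refine ((((cm _ _).mul (cm _ _)).sub ((cm _ _).mul (cm _ _))).sqrt ?_).congr_of_eventuallyEq
      ev |>.of_le (by simp)
    have hpos := det_gramMatrix_pos (hM.symm x hx) (hM.pos x hx)
    rw [det_gramMatrix] at hpos
    simp only [m, zero_smul, add_zero]
    exact hpos.ne'
  have D := hasDerivAt_integral_mul (μ := volume) hρ hρc fun x hx => smooth x (hρU hx)
  refine D.congr_deriv (integral_congr_ae (ae_of_all _ fun x => ?_))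
  by_cases hx : x ∈ tsupport ρ
  · have hxU := hρU hx
    have d1 := h.hasDerivAt_sqrt_det hxU (h.contDiffAt_gradient hφ hxU)
    have d2 : HasDerivAt (fun t : ℝ => S (t, x)) (fderiv ℝ S (0, x) (1, 0)) 0 :=
      HasFDerivAt.comp_hasDerivAt (f := fun t : ℝ => (t, x)) (0 : ℝ)
        (((smooth x hxU).differentiableAt (by simp)).hasFDerivAt)
        ((hasDerivAt_id (0 : ℝ)).prodMk (hasDerivAt_const (0 : ℝ) x))
    have e := d2.unique d1
    have e2 : inducedMetric G u x (meanField J G u x) (gradient (inducedMetric G u) φ x)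
        = fderiv ℝ φ x (meanField J G u x) := by
      rw [hM.symm x hxU, gradient, hM.inner_inverse hxU]
    simp only
    rw [e, e2]
    by_cases hxφ : x ∈ tsupport φ
    · rw [hρφ x hxφ]
      ring
    · have e' : φ =ᶠ[𝓝 x] fun _ => 0 := by
        filter_upwards [(isClosed_tsupport φ).isOpen_compl.mem_nhds hxφ] with y hy
        rw [image_eq_zero_of_notMem_tsupport hy]
      rw [e'.fderiv_eq]
      simp
  · have hxφ : x ∉ tsupport φ := fun hxφ => hx (subset_tsupport _ (by
      rw [Function.mem_support, hρφ x hxφ]; exact one_ne_zero))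
    have e' : φ =ᶠ[𝓝 x] fun _ => 0 := by
      filter_upwards [(isClosed_tsupport φ).isOpen_compl.mem_nhds hxφ] with y hy
      rw [image_eq_zero_of_notMem_tsupport hy]
    simp only
    rw [e'.fderiv_eq, image_eq_zero_of_notMem_tsupport hx]
    simp

/-- If the first variation of the area vanishes for all Hamiltonian variations, then `J H` is
divergence free. -/
theorem trace_leviCivitaCLM_meanField (hint : ∀ φ : R2 → ℝ, ContDiff ℝ ∞ φ → HasCompactSupport φ →
      tsupport φ ⊆ U → ∫ x, √(gramMatrix (inducedMetric G u x)).det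
        * fderiv ℝ φ x (meanField J G u x) = 0) {x : R2} (hx : x ∈ U) :
    traceCLM R2 (leviCivitaCLM (inducedMetric G u) (meanField J G u) x) = 0 := by
  have hM := h.isMetricOn_inducedMetric
  set s : R2 → ℝ := fun y => √(gramMatrix (inducedMetric G u y)).det with hs
  have hpos : ∀ y ∈ U, 0 < (gramMatrix (inducedMetric G u y)).det := fun y hy =>
    det_gramMatrix_pos (hM.symm y hy) (hM.pos y hy)
  have cs : ∀ y ∈ U, ContDiffAt ℝ ∞ s y := by
    intro y hy
    have c : ∀ A B : R2, ContDiffAt ℝ ∞ (fun y => inducedMetric G u y A B) y := fun A B =>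
      ((h.contDiffAt_inducedMetric hy).clm_apply contDiffAt_const).clm_apply contDiffAt_const
    have p := hpos y hy
    simp only [hs, det_gramMatrix] at p ⊢
    exact (((c _ _).mul (c _ _)).sub ((c _ _).mul (c _ _))).sqrt p.ne'
  set W : R2 → R2 := fun y => s y • meanField J G u y with hW
  have cW : ∀ y ∈ U, ContDiffAt ℝ ∞ W y := fun y hy => (cs y hy).smul (h.contDiffAt_meanField hy)
  have tr : ∀ y ∈ U, traceCLM R2 (fderiv ℝ W y)
      = s y * traceCLM R2 (leviCivitaCLM (inducedMetric G u) (meanField J G u) y) := by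
    intro y hy
    have d : fderiv ℝ W y = _ := (((cs y hy).differentiableAt (by simp)).hasFDerivAt.smul
      ((h.contDiffAt_meanField hy).differentiableAt (by simp)).hasFDerivAt).fderiv
    have t : traceCLM R2 ((fderiv ℝ s y).smulRight (meanField J G u y))
        = fderiv ℝ s y (meanField J G u y) := LinearMap.trace_smulRight _ _
    have fl : (christoffelCLM (inducedMetric G u) y).flip (meanField J G u y)
        = christoffelCLM (inducedMetric G u) y (meanField J G u y) := by
      ext1 X
      rw [ContinuousLinearMap.flip_apply, christoffelCLM_apply, christoffelCLM_apply,
        hM.christoffel_symm hy]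
    rw [d, map_add, map_smul, t, hs, h.fderiv_sqrt_det hy, leviCivitaCLM, map_add, fl,
      smul_eq_mul, mul_add]
  have cT : ContinuousOn (fun y => traceCLM R2 (fderiv ℝ W y)) U := fun y hy =>
    ((traceCLM R2).continuous.continuousAt.comp
      ((cW y hy).fderiv_right (m := ∞) (by simp)).continuousAt).continuousWithinAt
  have ae := h.isOpen.ae_eq_zero_of_integral_contDiff_smul_eq_zero (μ := volume)
    (cT.locallyIntegrableOn h.isOpen.measurableSet) (fun φ hφ hc hU => by
      simp only [smul_eq_mul]
      rw [integral_trace_fderiv hφ hc fun y hy => cW y (hU hy), neg_eq_zero, ← hint φ hφ hc hU]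
      simp only [hW, hs, map_smul, smul_eq_mul])
  have z := Measure.eqOn_open_of_ae_eq (μ := volume) (g := fun _ => (0 : ℝ))
    ((ae_restrict_iff' h.isOpen.measurableSet).2 ae) h.isOpen cT continuousOn_const hx
  simp only [tr x hx] at z
  exact (mul_eq_zero.1 z).resolve_left (Real.sqrt_pos.2 (hpos x hx)).ne'

end IsLagrangianPatch

end EulerLagrange

/-! ### Charts of the ambient complex surface -/

section AmbientCharts

variable {N : Type*} [TopologicalSpace N] [ChartedSpace C2 N] [IsManifold 𝓘(ℂ, C2) ω N]

/-- The complex structure of the coordinate plane: multiplication by `i`. -/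
def mulI : C2 →L[ℝ] C2 :=
  (Complex.I • ContinuousLinearMap.id ℂ C2).restrictScalars ℝ

theorem mulI_apply (v : C2) : mulI v = Complex.I • v := rfl

theorem mdifferentiable_chart {ψ : OpenPartialHomeomorph N C2} (hψ : ψ ∈ atlas C2 N) :
    ψ.MDifferentiable 𝓘(ℝ, C2) 𝓘(ℝ, C2) := by
  have : IsManifold 𝓘(ℝ, C2) 1 N := IsManifold.of_le (n := ∞) (by exact_mod_cast le_top)
  exact mdifferentiable_of_mem_atlas hψ

/-- The differentials of holomorphic charts are complex linear. -/
theorem mfderiv_chart_symm_smul_I {ψ : OpenPartialHomeomorph N C2} (hψ : ψ ∈ atlas C2 N) {z : C2}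
    (hz : z ∈ ψ.target) (v : C2) :
    mfderiv 𝓘(ℝ, C2) 𝓘(ℝ, C2) ψ.symm z (mulI v)
      = mulI (mfderiv 𝓘(ℝ, C2) 𝓘(ℝ, C2) ψ.symm z v) := by
  have : IsManifold 𝓘(ℂ, C2) 1 N := IsManifold.of_le (n := ω) le_top
  have h1 := ((mdifferentiable_of_mem_atlas (I := 𝓘(ℂ, C2)) hψ).mdifferentiableAt_symm
    hz).hasMFDerivAt
  let D : C2 →L[ℂ] C2 := mfderiv 𝓘(ℂ, C2) 𝓘(ℂ, C2) ψ.symm z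
  let D' : C2 →L[ℝ] C2 := D.restrictScalars ℝ
  have h2 : HasMFDerivAt 𝓘(ℝ, C2) 𝓘(ℝ, C2) ψ.symm z D' := ⟨h1.1, h1.2.restrictScalars ℝ⟩
  rw [h2.mfderiv]
  exact D.map_smul Complex.I v

theorem chartMetric_apply (g : Metric N) (ψ : OpenPartialHomeomorph N C2) (z X Y : C2) :
    chartMetric g ψ z X Y = g.inner (ψ.symm z) (mfderiv 𝓘(ℝ, C2) 𝓘(ℝ, C2) ψ.symm z X)
      (mfderiv 𝓘(ℝ, C2) 𝓘(ℝ, C2) ψ.symm z Y) := rfl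

theorem contMDiffOn_chart_symm {ψ : OpenPartialHomeomorph N C2} (hψ : ψ ∈ atlas C2 N) :
    ContMDiffOn 𝓘(ℝ, C2) 𝓘(ℝ, C2) ∞ ψ.symm ψ.target :=
  contMDiffOn_symm_of_mem_maximalAtlas (IsManifold.subset_maximalAtlas hψ)

theorem contMDiffOn_chart {ψ : OpenPartialHomeomorph N C2} (hψ : ψ ∈ atlas C2 N) :
    ContMDiffOn 𝓘(ℝ, C2) 𝓘(ℝ, C2) ∞ ψ ψ.source :=
  contMDiffOn_of_mem_maximalAtlas (IsManifold.subset_maximalAtlas hψ)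

theorem contDiffOn_chartMetric (g : Metric N) {ψ : OpenPartialHomeomorph N C2}
    (hψ : ψ ∈ atlas C2 N) : ContDiffOn ℝ ∞ (chartMetric g ψ) ψ.target := by
  refine contDiffOn_clm_apply.2 fun X => contDiffOn_clm_apply.2 fun Y => ?_
  have hvf : ∀ X : C2, ContMDiffOn 𝓘(ℝ, C2) (𝓘(ℝ, C2).prod 𝓘(ℝ, C2)) ∞
      (fun z => (⟨ψ.symm z, mfderiv 𝓘(ℝ, C2) 𝓘(ℝ, C2) ψ.symm z X⟩ :
        TangentBundle 𝓘(ℝ, C2) N)) ψ.target := by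
    intro X
    have h1 := (contMDiffOn_chart_symm hψ).contMDiffOn_tangentMapWithin (m := ∞) (by simp)
      ψ.open_target.uniqueMDiffOn
    have h2 : ContMDiffOn 𝓘(ℝ, C2) (𝓘(ℝ, C2).prod 𝓘(ℝ, C2)) ∞
        (fun z => (⟨z, X⟩ : TangentBundle 𝓘(ℝ, C2) C2)) ψ.target := by
      intro z hz
      apply ContMDiffAt.contMDiffWithinAt
      rw [Bundle.contMDiffAt_totalSpace]
      refine ⟨contMDiffAt_id, ?_⟩
      simp
      exact contMDiffAt_const
    refine (h1.comp h2 (fun z hz => hz)).congr fun z hz => ?_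
    simp [tangentMapWithin, mfderivWithin_of_isOpen ψ.open_target hz]
  have h := ContMDiffOn.clm_bundle_apply₂ (F₁ := C2) (F₂ := C2) (F₃ := ℝ)
    (E₁ := fun p : N => TangentSpace 𝓘(ℝ, C2) p) (E₂ := fun p : N => TangentSpace 𝓘(ℝ, C2) p)
    (E₃ := Bundle.Trivial N ℝ) (IB := 𝓘(ℝ, C2)) (IM := 𝓘(ℝ, C2))
    (g.contMDiff.comp_contMDiffOn (contMDiffOn_chart_symm hψ)) (hvf X) (hvf Y)
  intro z hz
  have h' := h z hz
  rw [Bundle.contMDiffWithinAt_totalSpace] at h'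
  exact h'.2.contDiffWithinAt

theorem isKaehlerOn_chartMetric {g : Metric N} (hg : IsKaehler g)
    {ψ : OpenPartialHomeomorph N C2} (hψ : ψ ∈ atlas C2 N) :
    IsKaehlerOn mulI (chartMetric g ψ) ψ.target where
  isOpen := ψ.open_target
  contDiffOn := contDiffOn_chartMetric g hψ
  symm z _ X Y := g.symm _ _ _
  pos z hz X hX := by
    refine g.pos _ _ fun h0 => hX ?_
    have hinj : Function.Injective (mfderiv 𝓘(ℝ, C2) 𝓘(ℝ, C2) ψ.symm z) :=
      (mdifferentiable_chart hψ).symm.mfderiv_injective hz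
    exact hinj (h0.trans (map_zero _).symm)
  sq X := by
    simp only [mulI_apply, smul_smul, Complex.I_mul_I, neg_smul, one_smul]
  hermitian z hz X Y := by
    rw [chartMetric_apply, mfderiv_chart_symm_smul_I hψ hz, mfderiv_chart_symm_smul_I hψ hz]
    exact hg.hermitian _ _ _
  parallel z hz X Y := hg.parallel ψ hψ z hz X Y

end AmbientCharts

/-! ### Lagrangian immersions in charts -/

section SurfaceCharts

variable {N : Type*} [TopologicalSpace N] [ChartedSpace C2 N] [IsManifold 𝓘(ℂ, C2) ω N]
variable {M : Type*} [TopologicalSpace M] [ChartedSpace R2 M] [IsManifold 𝓘(ℝ, R2) ∞ M]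

/-- The part of the chart domain `χ.target` which `f` maps into the domain of the chart `ψ`. -/
def patch (f : M → N) (χ : OpenPartialHomeomorph M R2) (ψ : OpenPartialHomeomorph N C2) :
    Set R2 :=
  χ.target ∩ χ.symm ⁻¹' (f ⁻¹' ψ.source)

theorem mdifferentiable_chart_surface {χ : OpenPartialHomeomorph M R2} (hχ : χ ∈ atlas R2 M) :
    χ.MDifferentiable 𝓘(ℝ, R2) 𝓘(ℝ, R2) := by
  have : IsManifold 𝓘(ℝ, R2) 1 M := IsManifold.of_le (n := ∞) (by exact_mod_cast le_top)
  exact mdifferentiable_of_mem_atlas hχ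

theorem contMDiffOn_chart_surface_symm {χ : OpenPartialHomeomorph M R2} (hχ : χ ∈ atlas R2 M) :
    ContMDiffOn 𝓘(ℝ, R2) 𝓘(ℝ, R2) ∞ χ.symm χ.target :=
  contMDiffOn_symm_of_mem_maximalAtlas (IsManifold.subset_maximalAtlas hχ)

theorem contMDiffOn_chart_surface {χ : OpenPartialHomeomorph M R2} (hχ : χ ∈ atlas R2 M) :
    ContMDiffOn 𝓘(ℝ, R2) 𝓘(ℝ, R2) ∞ χ χ.source :=
  contMDiffOn_of_mem_maximalAtlas (IsManifold.subset_maximalAtlas hχ)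

theorem isOpen_patch {f : M → N} (hf : Continuous f) (χ : OpenPartialHomeomorph M R2)
    (ψ : OpenPartialHomeomorph N C2) : IsOpen (patch f χ ψ) :=
  χ.isOpen_inter_preimage_symm (ψ.open_source.preimage hf)

theorem contDiffAt_localRep {f : M → N} (hf : ContMDiff 𝓘(ℝ, R2) 𝓘(ℝ, C2) ∞ f)
    {χ : OpenPartialHomeomorph M R2} (hχ : χ ∈ atlas R2 M)
    {ψ : OpenPartialHomeomorph N C2} (hψ : ψ ∈ atlas C2 N) {x : R2} (hx : x ∈ patch f χ ψ) :
    ContDiffAt ℝ ∞ (localRep f χ ψ) x := by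
  have h1 := (contMDiffOn_chart_surface_symm hχ).contMDiffAt (χ.open_target.mem_nhds hx.1)
  have h2 := (contMDiffOn_chart hψ).contMDiffAt (ψ.open_source.mem_nhds hx.2)
  exact (ContMDiffAt.comp x h2 (ContMDiffAt.comp x (hf _) h1)).contDiffAt

/-- A map `F` into `N` with coordinate expression `w` has differential `dψ⁻¹ ∘ dw`. -/
theorem mfderiv_of_coordinates {F : R2 → N} {w : R2 → C2} {x : R2}
    {ψ : OpenPartialHomeomorph N C2} (hψ : ψ ∈ atlas C2 N) (hw : DifferentiableAt ℝ w x)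
    (hwx : w x ∈ ψ.target) (hF : F =ᶠ[𝓝 x] fun y => ψ.symm (w y)) (X : R2) :
    mfderiv 𝓘(ℝ, R2) 𝓘(ℝ, C2) F x X
      = (mfderiv 𝓘(ℝ, C2) 𝓘(ℝ, C2) ψ.symm (w x) (fderiv ℝ w x X) : C2) := by
  have h1 := ((mdifferentiable_chart hψ).mdifferentiableAt_symm hwx).hasMFDerivAt
  have h2 := hw.hasFDerivAt.hasMFDerivAt
  have h3 := (HasMFDerivAt.comp x h1 h2).congr_of_eventuallyEq hF
  rw [h3.mfderiv]
  rfl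

theorem eventuallyEq_localRep {f : M → N} (hf : Continuous f) {χ : OpenPartialHomeomorph M R2}
    {ψ : OpenPartialHomeomorph N C2} {x : R2} (hx : x ∈ patch f χ ψ) :
    (fun y => f (χ.symm y)) =ᶠ[𝓝 x] fun y => ψ.symm (localRep f χ ψ y) := by
  filter_upwards [(isOpen_patch hf χ ψ).mem_nhds hx] with y hy
  exact (ψ.left_inv hy.2).symm

theorem mfderiv_comp_chart_symm {f : M → N} (hf : ContMDiff 𝓘(ℝ, R2) 𝓘(ℝ, C2) ∞ f)
    {χ : OpenPartialHomeomorph M R2} (hχ : χ ∈ atlas R2 M) {x : R2} (hx : x ∈ χ.target) (X : R2) :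
    mfderiv 𝓘(ℝ, R2) 𝓘(ℝ, C2) (fun y => f (χ.symm y)) x X
      = mfderiv 𝓘(ℝ, R2) 𝓘(ℝ, C2) f (χ.symm x) (mfderiv 𝓘(ℝ, R2) 𝓘(ℝ, R2) χ.symm x X) := by
  have h1 := ((hf.mdifferentiable (by simp)) (χ.symm x)).hasMFDerivAt
  have h2 := ((mdifferentiable_chart_surface hχ).mdifferentiableAt_symm hx).hasMFDerivAt
  have h3 := HasMFDerivAt.comp x h1 h2
  exact congrArg (fun L : R2 →L[ℝ] C2 => L X) h3.mfderiv

/-- The differential of `f` and of its coordinate expression correspond under the charts. -/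
theorem mfderiv_localRep {f : M → N} (hf : ContMDiff 𝓘(ℝ, R2) 𝓘(ℝ, C2) ∞ f)
    {χ : OpenPartialHomeomorph M R2} (hχ : χ ∈ atlas R2 M)
    {ψ : OpenPartialHomeomorph N C2} (hψ : ψ ∈ atlas C2 N) {x : R2} (hx : x ∈ patch f χ ψ)
    (X : R2) :
    (mfderiv 𝓘(ℝ, C2) 𝓘(ℝ, C2) ψ.symm (localRep f χ ψ x) (fderiv ℝ (localRep f χ ψ) x X) : C2)
      = mfderiv 𝓘(ℝ, R2) 𝓘(ℝ, C2) f (χ.symm x) (mfderiv 𝓘(ℝ, R2) 𝓘(ℝ, R2) χ.symm x X) := by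
  rw [← mfderiv_comp_chart_symm hf hχ hx.1]
  exact (mfderiv_of_coordinates hψ ((contDiffAt_localRep hf hχ hψ hx).differentiableAt (by simp))
    (ψ.map_source hx.2) (eventuallyEq_localRep hf.continuous hx) X).symm

/-- Transport of `g` along an equality of base points; the tangent spaces of `N` are all the type
`C2`. -/
theorem inner_eq_of_eq (g : Metric N) {p q : N} (h : p = q) {v w v' w' : C2}
    (hv : v = v') (hw : w = w') :
    g.inner p (v : TangentSpace 𝓘(ℝ, C2) p) (w : TangentSpace 𝓘(ℝ, C2) p)
      = g.inner q (v' : TangentSpace 𝓘(ℝ, C2) q) (w' : TangentSpace 𝓘(ℝ, C2) q) := by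
  subst h hv hw; rfl

theorem isLagrangianPatch_localRep {g : Metric N} (hg : IsKaehler g) {f : M → N}
    (hf : IsLagrangianImmersion g f)
    {χ : OpenPartialHomeomorph M R2} (hχ : χ ∈ atlas R2 M)
    {ψ : OpenPartialHomeomorph N C2} (hψ : ψ ∈ atlas C2 N) :
    IsLagrangianPatch mulI (chartMetric g ψ) ψ.target (localRep f χ ψ) (patch f χ ψ) where
  kaehler := isKaehlerOn_chartMetric hg hψ
  isOpen := isOpen_patch hf.smooth.continuous χ ψ
  mapsTo x hx := ψ.map_source hx.2
  smooth x hx := contDiffAt_localRep hf.smooth hχ hψ hx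
  immersion x hx := by
    intro X Y hXY
    have hinj : Function.Injective (mfderiv 𝓘(ℝ, R2) 𝓘(ℝ, R2) χ.symm x) :=
      (mdifferentiable_chart_surface hχ).symm.mfderiv_injective hx.1
    refine hinj (hf.immersion (χ.symm x) ?_)
    refine (mfderiv_localRep hf.smooth hχ hψ hx X).symm.trans ?_
    rw [hXY]
    exact mfderiv_localRep hf.smooth hχ hψ hx Y
  lagrangian x hx X Y := by
    rw [chartMetric_apply]
    refine (inner_eq_of_eq g (ψ.left_inv hx.2) (mfderiv_localRep hf.smooth hχ hψ hx X)
      ((mfderiv_chart_symm_smul_I hψ (ψ.map_source hx.2) _).trans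
        (congrArg mulI (mfderiv_localRep hf.smooth hχ hψ hx Y)))).trans ?_
    exact hf.lagrangian (χ.symm x) _ _
  finrank_eq := by
    have h := Module.finrank_mul_finrank ℝ ℂ C2
    rw [Complex.finrank_real_complex, finrank_euclideanSpace_fin] at h
    rw [← h, finrank_euclideanSpace_fin]

/-- The area density of a map with coordinate expression `w` in the chart `ψ`. -/
theorem areaDensity_eq (g : Metric N) {F : M → N} {χ : OpenPartialHomeomorph M R2} {w : R2 → C2}
    {x : R2} {ψ : OpenPartialHomeomorph N C2} (hψ : ψ ∈ atlas C2 N)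
    (hw : DifferentiableAt ℝ w x) (hwx : w x ∈ ψ.target)
    (hF : (fun y => F (χ.symm y)) =ᶠ[𝓝 x] fun y => ψ.symm (w y)) :
    areaDensity g F χ x = √(gramMatrix (inducedMetric (chartMetric g ψ) w x)).det := by
  unfold areaDensity gramMatrix
  congr 3
  funext i j
  rw [inducedMetric_apply, chartMetric_apply]
  exact inner_eq_of_eq g hF.eq_of_nhds (mfderiv_of_coordinates hψ hw hwx hF _)
    (mfderiv_of_coordinates hψ hw hwx hF _)

end SurfaceCharts

/-! ### Test functions in a chart -/

section TestFunctions

variable {M : Type*} [TopologicalSpace M] [ChartedSpace R2 M]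

/-- The function on `M` which is `φ` in the chart `χ` and zero outside the domain of `χ`. -/
def extendByZero (χ : OpenPartialHomeomorph M R2) (φ : R2 → ℝ) : M → ℝ :=
  χ.source.indicator fun p => φ (χ p)

theorem extendByZero_symm {χ : OpenPartialHomeomorph M R2} (φ : R2 → ℝ) {x : R2}
    (hx : x ∈ χ.target) : extendByZero χ φ (χ.symm x) = φ x := by
  rw [extendByZero, indicator_of_mem (χ.map_target hx), χ.right_inv hx]

theorem isCompact_image_tsupport {χ : OpenPartialHomeomorph M R2} {φ : R2 → ℝ}
    (hφc : HasCompactSupport φ) (hφ : tsupport φ ⊆ χ.target) :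
    IsCompact (χ.symm '' tsupport φ) :=
  hφc.isCompact.image_of_continuousOn (χ.continuousOn_symm.mono hφ)

theorem extendByZero_of_notMem {χ : OpenPartialHomeomorph M R2} {φ : R2 → ℝ} {p : M}
    (hp : p ∉ χ.symm '' tsupport φ) : extendByZero χ φ p = 0 := by
  by_cases hs : p ∈ χ.source
  · rw [extendByZero, indicator_of_mem hs]
    exact image_eq_zero_of_notMem_tsupport fun h => hp ⟨χ p, h, χ.left_inv hs⟩
  · exact indicator_of_notMem hs _

variable [T2Space M]

theorem tsupport_extendByZero {χ : OpenPartialHomeomorph M R2} {φ : R2 → ℝ}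
    (hφc : HasCompactSupport φ) (hφ : tsupport φ ⊆ χ.target) :
    tsupport (extendByZero χ φ) ⊆ χ.symm '' tsupport φ := by
  refine closure_minimal (fun p hp => ?_) (isCompact_image_tsupport hφc hφ).isClosed
  by_contra h
  exact hp (extendByZero_of_notMem h)

theorem hasCompactSupport_extendByZero {χ : OpenPartialHomeomorph M R2} {φ : R2 → ℝ}
    (hφc : HasCompactSupport φ) (hφ : tsupport φ ⊆ χ.target) :
    HasCompactSupport (extendByZero χ φ) :=
  (isCompact_image_tsupport hφc hφ).of_isClosed_subset (isClosed_tsupport _)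
    (tsupport_extendByZero hφc hφ)

theorem tsupport_extendByZero_subset_source {χ : OpenPartialHomeomorph M R2} {φ : R2 → ℝ}
    (hφc : HasCompactSupport φ) (hφ : tsupport φ ⊆ χ.target) :
    tsupport (extendByZero χ φ) ⊆ χ.source := by
  refine (tsupport_extendByZero hφc hφ).trans ?_
  rintro _ ⟨x, hx, rfl⟩
  exact χ.map_target (hφ hx)

theorem contMDiff_extendByZero [IsManifold 𝓘(ℝ, R2) ∞ M] {χ : OpenPartialHomeomorph M R2}
    (hχ : χ ∈ atlas R2 M) {φ : R2 → ℝ} (hφs : ContDiff ℝ ∞ φ)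
    (hφc : HasCompactSupport φ) (hφ : tsupport φ ⊆ χ.target) :
    ContMDiff 𝓘(ℝ, R2) 𝓘(ℝ, ℝ) ∞ (extendByZero χ φ) := by
  refine contMDiff_of_tsupport fun p hp => ?_
  have hps := tsupport_extendByZero_subset_source hφc hφ hp
  have h1 := (contMDiffOn_chart_surface hχ).contMDiffAt (χ.open_source.mem_nhds hps)
  refine (ContMDiffAt.comp p hφs.contMDiff.contMDiffAt h1).congr_of_eventuallyEq ?_
  filter_upwards [χ.open_source.mem_nhds hps] with q hq
  exact indicator_of_mem hq _

/-- Smooth cutoff functions in the coordinate plane. -/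
theorem exists_cutoff {S U : Set R2} (hS : IsCompact S) (hU : IsOpen U) (hSU : S ⊆ U) :
    ∃ ρ : R2 → ℝ, ContDiff ℝ ∞ ρ ∧ HasCompactSupport ρ ∧ tsupport ρ ⊆ U ∧ ∀ x ∈ S, ρ x = 1 := by
  obtain ⟨L, hL, hSL, hLU⟩ := exists_compact_between hS hU hSU
  obtain ⟨ρ, h0, h1, -⟩ := exists_contMDiffMap_zero_one_of_isClosed (n := ⊤) 𝓘(ℝ, R2)
    (s := (interior L)ᶜ) isOpen_interior.isClosed_compl hS.isClosed
    (disjoint_compl_left_iff_subset.2 hSL)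
  have hsub : tsupport ρ ⊆ L := by
    refine closure_minimal (fun x hx => ?_) hL.isClosed
    by_contra hxL
    exact hx (h0 fun h => hxL (interior_subset h))
  exact ⟨ρ, ρ.contMDiff.contDiff, hL.of_isClosed_subset (isClosed_tsupport _) hsub,
    hsub.trans hLU, h1⟩

end TestFunctions

/-! ### Hamiltonian deformations supported in a chart -/

section Deformation

variable {N : Type*} [TopologicalSpace N] [ChartedSpace C2 N] [IsManifold 𝓘(ℂ, C2) ω N]
variable {M : Type*} [TopologicalSpace M] [ChartedSpace R2 M] [IsManifold 𝓘(ℝ, R2) ∞ M]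

open Classical in
/-- The deformation which is `u + t ξ` in the charts `χ`, `ψ`, where `u` is the coordinate
expression of `f`, and which leaves `f` fixed outside the domain of these charts. -/
def chartDeformation (f : M → N) (χ : OpenPartialHomeomorph M R2)
    (ψ : OpenPartialHomeomorph N C2) (ξ : R2 → C2) (t : ℝ) (p : M) : N :=
  if p ∈ χ.source ∩ f ⁻¹' ψ.source then ψ.symm (localRep f χ ψ (χ p) + t • ξ (χ p)) else f p

variable {f : M → N} {χ : OpenPartialHomeomorph M R2} {ψ : OpenPartialHomeomorph N C2}
  {ξ : R2 → C2}

theorem chartDeformation_of_mem {p : M} (hp : p ∈ χ.source ∩ f ⁻¹' ψ.source) (t : ℝ) :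
    chartDeformation f χ ψ ξ t p = ψ.symm (localRep f χ ψ (χ p) + t • ξ (χ p)) :=
  if_pos hp

theorem chartDeformation_of_notMem {p : M} (hp : p ∉ χ.source ∩ f ⁻¹' ψ.source) (t : ℝ) :
    chartDeformation f χ ψ ξ t p = f p :=
  if_neg hp

theorem chartDeformation_eq {p : M} {t : ℝ} (h : t • ξ (χ p) = 0) :
    chartDeformation f χ ψ ξ t p = f p := by
  by_cases hp : p ∈ χ.source ∩ f ⁻¹' ψ.source
  · rw [chartDeformation_of_mem hp, h, add_zero, localRep, χ.left_inv hp.1, ψ.left_inv hp.2]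
  · exact chartDeformation_of_notMem hp t

theorem chartDeformation_zero : chartDeformation f χ ψ ξ 0 = f := by
  funext p
  exact chartDeformation_eq (zero_smul _ _)

theorem chartDeformation_fixed {S : Set R2} (hS : ∀ x ∉ S, ξ x = 0) {p : M}
    (hp : p ∉ χ.symm '' S) (t : ℝ) : chartDeformation f χ ψ ξ t p = f p := by
  by_cases hs : p ∈ χ.source
  · refine chartDeformation_eq ?_
    rw [hS _ fun h => hp ⟨χ p, h, χ.left_inv hs⟩, smul_zero]
  · exact chartDeformation_of_notMem (fun h => hs h.1) t

theorem mem_domain_of_mem_patch {x : R2} (hx : x ∈ patch f χ ψ) :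
    χ.symm x ∈ χ.source ∩ f ⁻¹' ψ.source :=
  ⟨χ.map_target hx.1, hx.2⟩

theorem mem_patch_of_mem_domain {p : M} (hp : p ∈ χ.source ∩ f ⁻¹' ψ.source) :
    χ p ∈ patch f χ ψ := by
  refine ⟨χ.map_source hp.1, ?_⟩
  rw [mem_preimage, χ.left_inv hp.1]
  exact hp.2

theorem chartDeformation_symm {x : R2} (hx : x ∈ patch f χ ψ) (t : ℝ) :
    chartDeformation f χ ψ ξ t (χ.symm x) = ψ.symm (localRep f χ ψ x + t • ξ x) := by
  rw [chartDeformation_of_mem (mem_domain_of_mem_patch hx), χ.right_inv hx.1]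

/-- For small `t` the deformation stays in the domain of the chart `ψ`. -/
theorem exists_add_smul_mem_target (hf : ContMDiff 𝓘(ℝ, R2) 𝓘(ℝ, C2) ∞ f) (hχ : χ ∈ atlas R2 M)
    (hψ : ψ ∈ atlas C2 N) {S : Set R2} (hS : IsCompact S) (hSU : S ⊆ patch f χ ψ)
    (hξ : Continuous ξ) (hξS : ∀ x ∉ S, ξ x = 0) :
    ∃ δ : ℝ, 0 < δ ∧ ∀ t ∈ Ioo (-δ) δ, ∀ x ∈ patch f χ ψ,
      localRep f χ ψ x + t • ξ x ∈ ψ.target := by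
  have hev : ∀ᶠ t in 𝓝 (0 : ℝ), ∀ x ∈ S, localRep f χ ψ x + t • ξ x ∈ ψ.target := by
    refine hS.eventually_forall_of_forall_eventually fun x hx => ?_
    have hcont : ContinuousAt (fun q : ℝ × R2 => localRep f χ ψ q.2 + q.1 • ξ q.2) (0, x) := by
      have h1 : ContinuousAt (fun q : ℝ × R2 => localRep f χ ψ q.2) (0, x) :=
        ContinuousAt.comp (g := localRep f χ ψ)
          (contDiffAt_localRep hf hχ hψ (hSU hx)).continuousAt continuousAt_snd
      exact h1.add (by fun_prop)
    refine hcont.eventually_mem (ψ.open_target.mem_nhds ?_)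
    simpa [localRep] using ψ.map_source (hSU hx).2
  obtain ⟨δ, hδ, h⟩ := Metric.eventually_nhds_iff.1 hev
  refine ⟨δ, hδ, fun t ht x hx => ?_⟩
  by_cases hxS : x ∈ S
  · exact h (by rw [Real.dist_eq, sub_zero]; exact abs_lt.2 ht) x hxS
  · rw [hξS x hxS, smul_zero, add_zero]
    exact ψ.map_source hx.2

theorem isDeformation_chartDeformation [T2Space M] (hf : ContMDiff 𝓘(ℝ, R2) 𝓘(ℝ, C2) ∞ f)
    (hχ : χ ∈ atlas R2 M) (hψ : ψ ∈ atlas C2 N) {S : Set R2} (hS : IsCompact S)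
    (hSU : S ⊆ patch f χ ψ) (hξ : ContDiff ℝ ∞ ξ) (hξS : ∀ x ∉ S, ξ x = 0) {δ : ℝ} (hδ : 0 < δ)
    (hmem : ∀ t ∈ Ioo (-δ) δ, ∀ x ∈ patch f χ ψ, localRep f χ ψ x + t • ξ x ∈ ψ.target) :
    IsDeformation f (chartDeformation f χ ψ ξ) δ (χ.symm '' S) where
  pos := hδ
  initial := chartDeformation_zero
  isCompact := hS.image_of_continuousOn (χ.continuousOn_symm.mono fun x hx => (hSU hx).1)
  fixed t _ p hp := chartDeformation_fixed hξS hp t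
  smooth := by
    have hK : IsCompact (χ.symm '' S) :=
      hS.image_of_continuousOn (χ.continuousOn_symm.mono fun x hx => (hSU hx).1)
    rintro ⟨t, p⟩ ⟨ht, -⟩
    apply ContMDiffAt.contMDiffWithinAt
    by_cases hp : p ∈ χ.source ∩ f ⁻¹' ψ.source
    · have hpU := mem_patch_of_mem_domain hp
      have hopen : IsOpen (χ.source ∩ f ⁻¹' ψ.source) :=
        χ.open_source.inter (ψ.open_source.preimage hf.continuous)
      have h1 : ContMDiffAt (𝓘(ℝ, ℝ).prod 𝓘(ℝ, R2)) 𝓘(ℝ, R2) ∞ (fun q : ℝ × M => χ q.2) (t, p) :=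
        ContMDiffAt.comp (t, p) (g := χ)
          ((contMDiffOn_chart_surface hχ).contMDiffAt (χ.open_source.mem_nhds hp.1))
          contMDiffAt_snd
      have h2 : ContMDiffAt (𝓘(ℝ, ℝ).prod 𝓘(ℝ, R2)) 𝓘(ℝ, C2) ∞
          (fun q : ℝ × M => localRep f χ ψ (χ q.2)) (t, p) :=
        ContMDiffAt.comp (t, p) (g := localRep f χ ψ)
          (contDiffAt_localRep hf hχ hψ hpU).contMDiffAt h1
      have h3 : ContMDiffAt (𝓘(ℝ, ℝ).prod 𝓘(ℝ, R2)) 𝓘(ℝ, C2) ∞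
          (fun q : ℝ × M => ξ (χ q.2)) (t, p) :=
        ContMDiffAt.comp (t, p) (g := ξ) hξ.contMDiff.contMDiffAt h1
      have h4 : ContMDiffAt (𝓘(ℝ, ℝ).prod 𝓘(ℝ, R2)) 𝓘(ℝ, C2) ∞
          (fun q : ℝ × M => localRep f χ ψ (χ q.2) + q.1 • ξ (χ q.2)) (t, p) :=
        h2.add (contMDiffAt_fst.smul h3)
      have h5 := (contMDiffOn_chart_symm hψ).contMDiffAt
        (ψ.open_target.mem_nhds (hmem t ht _ hpU))
      refine (ContMDiffAt.comp (t, p)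
        (f := fun q : ℝ × M => localRep f χ ψ (χ q.2) + q.1 • ξ (χ q.2)) h5
        h4).congr_of_eventuallyEq ?_
      filter_upwards [(hopen.preimage continuous_snd).mem_nhds (x := (t, p)) hp] with q hq
      exact chartDeformation_of_mem hq q.1
    · have hpK : p ∉ χ.symm '' S := by
        rintro ⟨x, hx, rfl⟩
        exact hp (mem_domain_of_mem_patch (hSU hx))
      refine (ContMDiffAt.comp (t, p) (g := f) (hf p) contMDiffAt_snd).congr_of_eventuallyEq ?_
      filter_upwards [(hK.isClosed.isOpen_compl.preimage continuous_snd).mem_nhds (x := (t, p))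
        hpK] with q hq
      exact chartDeformation_fixed hξS hq q.1

/-- The variation field of the deformation is `ξ`, transported by the chart `ψ`. -/
theorem variationField_chartDeformation (hψ : ψ ∈ atlas C2 N) {x : R2} (hx : x ∈ patch f χ ψ) :
    (variationField (chartDeformation f χ ψ ξ) (χ.symm x) : C2)
      = mfderiv 𝓘(ℝ, C2) 𝓘(ℝ, C2) ψ.symm (localRep f χ ψ x) (ξ x) := by
  have e : (fun t : ℝ => chartDeformation f χ ψ ξ t (χ.symm x))
      = fun t => ψ.symm (localRep f χ ψ x + t • ξ x) := funext fun t => chartDeformation_symm hx t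
  have h1 := ((mdifferentiable_chart hψ).mdifferentiableAt_symm
    (ψ.map_source hx.2)).hasMFDerivAt
  have h2 : HasDerivAt (fun t : ℝ => localRep f χ ψ x + t • ξ x) (ξ x) 0 := by
    simpa using ((hasDerivAt_id (0 : ℝ)).smul_const (ξ x)).const_add (localRep f χ ψ x)
  have h0 : localRep f χ ψ x + (0 : ℝ) • ξ x = localRep f χ ψ x := by simp
  have h3 := HasMFDerivAt.comp (0 : ℝ) (f := fun t : ℝ => localRep f χ ψ x + t • ξ x)
    (g := ψ.symm) (by rw [h0]; exact h1) h2.hasFDerivAt.hasMFDerivAt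
  have h4 := h3.congr_of_eventuallyEq (Eventually.of_forall fun t => congrFun e t)
  refine (congrArg (fun L : ℝ →L[ℝ] C2 => L 1) h4.mfderiv).trans ?_
  exact congrArg (fun v : C2 => (mfderiv 𝓘(ℝ, C2) 𝓘(ℝ, C2) ψ.symm (localRep f χ ψ x) v : C2))
    (one_smul ℝ (ξ x))

theorem IsHamiltonianField.congr {g : Metric N} {f₀ : M → N} (h : f₀ = f) {φ : M → ℝ} {η : M → C2}
    (H : IsHamiltonianField g f φ η) : IsHamiltonianField g f₀ φ η := by
  subst h; exact H

theorem mfderiv_extendByZero {χ : OpenPartialHomeomorph M R2} (hχ : χ ∈ atlas R2 M) {φ : R2 → ℝ}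
    {x : R2} (hx : x ∈ χ.target) (hφ : ContMDiff 𝓘(ℝ, R2) 𝓘(ℝ, ℝ) ∞ (extendByZero χ φ)) (X : R2) :
    (mfderiv 𝓘(ℝ, R2) 𝓘(ℝ, ℝ) (extendByZero χ φ) (χ.symm x)
      (mfderiv 𝓘(ℝ, R2) 𝓘(ℝ, R2) χ.symm x X) : ℝ) = fderiv ℝ φ x X := by
  have h1 := ((hφ.mdifferentiable (by simp)) (χ.symm x)).hasMFDerivAt
  have h2 := ((mdifferentiable_chart_surface hχ).mdifferentiableAt_symm hx).hasMFDerivAt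
  have e : φ =ᶠ[𝓝 x] extendByZero χ φ ∘ χ.symm := by
    filter_upwards [χ.open_target.mem_nhds hx] with y hy
    exact (extendByZero_symm φ hy).symm
  have h3 := ((HasMFDerivAt.comp x h1 h2).congr_of_eventuallyEq e).mfderiv
  rw [mfderiv_eq_fderiv] at h3
  exact (congrArg (fun L : R2 →L[ℝ] ℝ => L X) h3).symm

/-- The variation field of the chart deformation along `J ∇φ` is Hamiltonian on `M`. -/
theorem isHamiltonianField_chartDeformation [T2Space M] {g : Metric N} (hg : IsKaehler g)
    (hf : IsLagrangianImmersion g f) (hχ : χ ∈ atlas R2 M) (hψ : ψ ∈ atlas C2 N) {φ : R2 → ℝ}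
    (hφ : ContDiff ℝ ∞ φ) (hφc : HasCompactSupport φ) (hφU : tsupport φ ⊆ patch f χ ψ) :
    IsHamiltonianField g
      (chartDeformation f χ ψ (hamiltonianField mulI (chartMetric g ψ) (localRep f χ ψ) φ) 0)
      (extendByZero χ φ)
      (variationField
        (chartDeformation f χ ψ (hamiltonianField mulI (chartMetric g ψ) (localRep f χ ψ) φ))) := by
  have h := isLagrangianPatch_localRep hg hf hχ hψ
  have hφt : tsupport φ ⊆ χ.target := hφU.trans inter_subset_left
  have hsm := contMDiff_extendByZero hχ hφ hφc hφt
  refine IsHamiltonianField.congr chartDeformation_zero ?_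
  refine ⟨hsm, hasCompactSupport_extendByZero hφc hφt, fun p => ?_⟩
  by_cases hp : p ∈ χ.source ∩ f ⁻¹' ψ.source
  · obtain ⟨x, hx, rfl⟩ : ∃ x ∈ patch f χ ψ, χ.symm x = p :=
      ⟨χ p, mem_patch_of_mem_domain hp, χ.left_inv hp.1⟩
    set v := gradient (inducedMetric (chartMetric g ψ) (localRep f χ ψ)) φ x with hv
    refine ⟨mfderiv 𝓘(ℝ, R2) 𝓘(ℝ, R2) χ.symm x v, fun X => ?_, ?_⟩
    · obtain ⟨X, rfl⟩ : ∃ X' : R2, mfderiv 𝓘(ℝ, R2) 𝓘(ℝ, R2) χ.symm x X' = X :=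
        (mdifferentiable_chart_surface hχ).symm.mfderiv_surjective hx.1 X
      have e1 := inner_eq_of_eq g (ψ.left_inv hx.2) (mfderiv_localRep hf.smooth hχ hψ hx v)
        (mfderiv_localRep hf.smooth hχ hψ hx X)
      have e2 : inducedMetric (chartMetric g ψ) (localRep f χ ψ) x v X = fderiv ℝ φ x X := by
        rw [hv, gradient, h.isMetricOn_inducedMetric.inner_inverse hx]
      exact e1.symm.trans (e2.trans (mfderiv_extendByZero hχ hx.1 hsm X).symm)
    · refine (variationField_chartDeformation hψ hx).trans ?_
      refine (mfderiv_chart_symm_smul_I hψ (ψ.map_source hx.2) _).trans ?_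
      exact congrArg mulI (mfderiv_localRep hf.smooth hχ hψ hx v)
  · have hpt : p ∉ tsupport (extendByZero χ φ) := by
      intro h'
      obtain ⟨x, hx, rfl⟩ := tsupport_extendByZero hφc hφt h'
      exact hp (mem_domain_of_mem_patch (hφU hx))
    refine ⟨0, fun X => ?_, ?_⟩
    · have e : extendByZero χ φ =ᶠ[𝓝 p] fun _ => (0 : ℝ) := notMem_tsupport_iff_eventuallyEq.1 hpt
      have e' : mfderiv 𝓘(ℝ, R2) 𝓘(ℝ, ℝ) (extendByZero χ φ) p = 0 :=
        ((hasMFDerivAt_const (0 : ℝ) p).congr_of_eventuallyEq e).mfderiv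
      rw [map_zero, map_zero]
      exact (congrArg (fun L : R2 →L[ℝ] ℝ => L X) e').symm
    · have e : (fun t : ℝ => chartDeformation f χ ψ
          (hamiltonianField mulI (chartMetric g ψ) (localRep f χ ψ) φ) t p) = fun _ => f p :=
        funext fun t => chartDeformation_of_notMem hp t
      have e' := ((hasMFDerivAt_const (I := 𝓘(ℝ, ℝ)) (I' := 𝓘(ℝ, C2)) (f p)
        (0 : ℝ)).congr_of_eventuallyEq (Eventually.of_forall fun t => congrFun e t)).mfderiv
      refine (congrArg (fun L : ℝ →L[ℝ] C2 => L 1) e').trans ?_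
      rw [map_zero]
      exact (map_zero mulI).symm

/-- The area of the deformed surface in coordinates. -/
theorem area_chartDeformation {g : Metric N} (hf : ContMDiff 𝓘(ℝ, R2) 𝓘(ℝ, C2) ∞ f)
    (hχ : χ ∈ atlas R2 M) (hψ : ψ ∈ atlas C2 N) (hξ : ContDiff ℝ ∞ ξ) {ρ : R2 → ℝ}
    (hρU : tsupport ρ ⊆ patch f χ ψ) {t : ℝ}
    (ht : ∀ x ∈ patch f χ ψ, localRep f χ ψ x + t • ξ x ∈ ψ.target) :
    area g (chartDeformation f χ ψ ξ t) (fun _ : Fin 1 => χ) (fun _ => extendByZero χ ρ)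
      = ∫ x, ρ x * √(gramMatrix
          (inducedMetric (chartMetric g ψ) (fun y => localRep f χ ψ y + t • ξ y) x)).det := by
  rw [area, Fin.sum_univ_one,
    setIntegral_congr_fun (g := fun x => ρ x * areaDensity g (chartDeformation f χ ψ ξ t) χ x)
      χ.open_target.measurableSet (fun x hx => by
        simp only [extendByZero_symm ρ hx]),
    setIntegral_eq_integral_of_forall_compl_eq_zero fun x hx => by
      rw [image_eq_zero_of_notMem_tsupport fun h => hx (hρU h).1, zero_mul]]
  refine integral_congr_ae (Eventually.of_forall fun x => ?_)
  by_cases hx : x ∈ patch f χ ψ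
  · have hw : DifferentiableAt ℝ (fun y => localRep f χ ψ y + t • ξ y) x :=
      ((contDiffAt_localRep hf hχ hψ hx).differentiableAt (by simp)).add
        ((hξ.differentiable (by simp) x).const_smul t)
    simp only
    rw [areaDensity_eq g hψ hw (ht x hx)]
    filter_upwards [(isOpen_patch hf.continuous χ ψ).mem_nhds hx] with y hy
    exact chartDeformation_symm hy t
  · simp only
    rw [image_eq_zero_of_notMem_tsupport fun h => hx (hρU h), zero_mul, zero_mul]

/-- For a Hamiltonian stationary surface the weak form of `div (J H) = 0` holds in charts. -/
theorem integral_fderiv_meanField_eq_zero [T2Space M] {g : Metric N} (hg : IsKaehler g)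
    (hf : IsLagrangianImmersion g f) (hstat : IsHamiltonianStationary g f) (hχ : χ ∈ atlas R2 M)
    (hψ : ψ ∈ atlas C2 N) {φ : R2 → ℝ} (hφ : ContDiff ℝ ∞ φ) (hφc : HasCompactSupport φ)
    (hφU : tsupport φ ⊆ patch f χ ψ) :
    ∫ x, √(gramMatrix (inducedMetric (chartMetric g ψ) (localRep f χ ψ) x)).det
      * fderiv ℝ φ x (meanField mulI (chartMetric g ψ) (localRep f χ ψ) x) = 0 := by
  have h := isLagrangianPatch_localRep hg hf hχ hψ
  have hξ := h.contDiff_hamiltonianField hφ hφU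
  have hξS : ∀ x ∉ tsupport φ,
      hamiltonianField mulI (chartMetric g ψ) (localRep f χ ψ) φ x = 0 :=
    fun x hx => hamiltonianField_eq_zero hx
  obtain ⟨ρ, hρ, hρc, hρU, hρφ⟩ := exists_cutoff hφc.isCompact h.isOpen hφU
  have hρt : tsupport ρ ⊆ χ.target := hρU.trans inter_subset_left
  obtain ⟨δ, hδ, hmem⟩ := exists_add_smul_mem_target hf.smooth hχ hψ hφc.isCompact hφU
    hξ.continuous hξS
  have hpart : IsPartition (χ.symm '' tsupport φ) (fun _ : Fin 1 => χ)
      (fun _ => extendByZero χ ρ) :=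
    { chart := fun _ => hχ
      smooth := fun _ => contMDiff_extendByZero hχ hρ hρc hρt
      compactSupport := fun _ => hasCompactSupport_extendByZero hρc hρt
      support := fun _ => tsupport_extendByZero_subset_source hρc hρt
      sum_eq_one := by
        rintro _ ⟨x, hx, rfl⟩
        rw [Fin.sum_univ_one, extendByZero_symm ρ (hφU hx).1, hρφ x hx] }
  have d1 := hstat _ δ _ (isDeformation_chartDeformation hf.smooth hχ hψ hφc.isCompact hφU hξ hξS
    hδ hmem) ⟨_, isHamiltonianField_chartDeformation hg hf hχ hψ hφ hφc hφU⟩ 1 _ _ hpart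
  have d2 := h.hasDerivAt_area hφ hφU hρ.continuous hρc hρU hρφ
  have h0 := (d2.congr_of_eventuallyEq (f₁ := fun t => area g (chartDeformation f χ ψ
      (hamiltonianField mulI (chartMetric g ψ) (localRep f χ ψ) φ) t) (fun _ : Fin 1 => χ)
        (fun _ => extendByZero χ ρ)) (by
    filter_upwards [Ioo_mem_nhds (neg_lt_zero.2 hδ) hδ] with t ht
    exact area_chartDeformation hf.smooth hχ hψ hξ hρU (hmem t ht))).unique d1
  rw [integral_neg, integral_const_mul] at h0
  linarith

/-- A Hamiltonian stationary Lagrangian surface in a complex space form with `|H|` a non-zero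
constant has parallel second fundamental form. -/
theorem hasParallelSFF_of_isHamiltonianStationary [T2Space M] {g : Metric N} {ε : ℝ}
    (hg : IsComplexSpaceForm g (4 * ε)) (hf : IsLagrangianImmersion g f)
    (hstat : IsHamiltonianStationary g f) {c : ℝ} (hc : c ≠ 0)
    (hH : HasConstMeanCurvature g f c) : HasParallelSFF g f := by
  intro χ hχ ψ hψ x hx hfx X Y Z
  have h := isLagrangianPatch_localRep hg.kaehler hf hχ hψ
  have hxU : x ∈ patch f χ ψ := ⟨hx, hfx⟩
  have hk : 0 < c ^ 2 := by positivity
  have hη : ∀ y ∈ patch f χ ψ, inducedMetric (chartMetric g ψ) (localRep f χ ψ) y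
      (meanField mulI (chartMetric g ψ) (localRep f χ ψ) y)
      (meanField mulI (chartMetric g ψ) (localRep f χ ψ) y) = c ^ 2 := by
    intro y hy
    rw [← hH χ hχ ψ hψ y hy.1 hy.2, meanCurvature, h.inner_meanCurvatureVector hy, Real.sq_sqrt]
    rcases eq_or_ne (meanField mulI (chartMetric g ψ) (localRep f χ ψ) y) 0 with h0 | h0
    · rw [h0, map_zero]
    · exact (h.isMetricOn_inducedMetric.pos y hy _ h0).le
  have hdiv : ∀ y ∈ patch f χ ψ, traceCLM R2 (leviCivitaCLM
      (inducedMetric (chartMetric g ψ) (localRep f χ ψ))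
      (meanField mulI (chartMetric g ψ) (localRep f χ ψ)) y) = 0 := fun y hy =>
    h.trace_leviCivitaCLM_meanField
      (fun φ hφ hφc hφU =>
        integral_fderiv_meanField_eq_zero hg.kaehler hf hstat hχ hψ hφ hφc hφU) hy
  rw [h.covariantDerivSFF_eq hxU, h.shapeDeriv_eq_zero finrank_R2
    (fun z hz X => hg.curvature_eq ψ hψ z hz X) hk hη hdiv hxU, map_zero, map_zero]

end Deformation

end LagrangianSurface

end

theorem proposition3p1
    {N : Type*} [TopologicalSpace N] [T2Space N] [ChartedSpace LagrangianSurface.C2 N]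
    [IsManifold 𝓘(ℂ, LagrangianSurface.C2) ω N]
    {M : Type*} [TopologicalSpace M] [T2Space M] [ChartedSpace LagrangianSurface.R2 M]
    [IsManifold 𝓘(ℝ, LagrangianSurface.R2) ∞ M]
    (ε : ℝ) (g : LagrangianSurface.Metric N)
    (hN : LagrangianSurface.IsComplexSpaceForm g (4 * ε))
    (f : M → N) (hf : LagrangianSurface.IsLagrangianImmersion g f)
    (hstat : LagrangianSurface.IsHamiltonianStationary g f)
    (c : ℝ) (hc : c ≠ 0) (hH : LagrangianSurface.HasConstMeanCurvature g f c) :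
    LagrangianSurface.HasParallelSFF g f :=
  LagrangianSurface.hasParallelSFF_of_isHamiltonianStationary hN hf hstat hc hH
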